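/- Let $m,n\ge 0$ be integers and $s$ a real number with $m<s\le n$. Let $\mathcal H^s$ be the $s$-dimensional Hausdorff (outer) measure on $\mathbb R^n$, let $\dim$ denote Hausdorff dimension, let $G(n,n-m)$ be the Grassmannian of $(n-m)$-dimensional linear subspaces of $\mathbb R^n$, and let $\gamma_{n,n-m}$ be the unique Borel probability measure on $G(n,n-m)$ that is invariant under the orthogonal group $O(n)$; for a set that is not $\gamma_{n,n-m}$-measurable, $\gamma_{n,n-m}$ means the outer measure. Let $A\subset\mathbb R^n$ be $\mathcal H^s$-measurable with $0<\mathcal H^s(A)<\infty$. Then the set of points $x\in\mathbb R^n$ with $$\gamma_{n,n-m}\bigl(\{V\in G(n,n-m):\dim (A\cap (V+x))=s-m\}\bigr)=0$$ has Hausdorff dimension at most $m$. Moreover, there is a Borel set $B\subset\mathbb R^n$ with $\dim B\le m$ such that for every $x\in\mathbb R^n\setminus B$, $$\gamma_{n,n-m}\bigl(\{V\in G(n,n-m):\dim (A\cap (V+x))=s-m\}\bigr)>0.$$ -/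

import Mathlib

open MeasureTheory Set
open scoped ENNReal

noncomputable section

/-- Euclidean space `ℝⁿ`, with the Euclidean norm. -/
abbrev E (n : ℕ) : Type := EuclideanSpace ℝ (Fin n)

/-- The orthogonal group `O(n)`: the operators `g` on `ℝⁿ` with `g* g = g g* = 1`, with the topology
and the Borel σ-algebra coming from the operator norm. -/
abbrev O (n : ℕ) : Type := unitary (E n →L[ℝ] E n)

instance E.instContinuousStar (n : ℕ) : ContinuousStar (E n →L[ℝ] E n) :=
  ⟨(ContinuousLinearMap.adjoint (𝕜 := ℝ) (E := E n) (F := E n)).continuous⟩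

/-- `O(n)` is compact (closed and bounded in a finite-dimensional space). -/
instance O.instCompactSpace (n : ℕ) : CompactSpace (O n) := by
  have : ProperSpace (E n →L[ℝ] E n) := FiniteDimensional.proper ℝ _
  suffices h : IsCompact (unitary (E n →L[ℝ] E n) : Set (E n →L[ℝ] E n)) from
    isCompact_iff_compactSpace.mp h
  refine Metric.isCompact_of_isClosed_isBounded (isClosed_unitary (R := E n →L[ℝ] E n)) ?_
  refine (Metric.isBounded_closedBall (x := (0 : E n →L[ℝ] E n)) (r := 1)).subset ?_
  intro g hg
  rw [mem_closedBall_zero_iff]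
  refine ContinuousLinearMap.opNorm_le_bound _ zero_le_one fun x => ?_
  rw [one_mul]
  exact ((Unitary.linearIsometryEquiv (⟨g, hg⟩ : O n)).norm_map x).le

/-- The normalized Haar measure on `O(n)`, of total mass one. -/
def haarO (n : ℕ) : Measure (O n) := Measure.haarMeasure ⊤

/-- The Grassmannian `G(n,k)` of `k`-dimensional linear subspaces of `ℝⁿ`. -/
def G (n k : ℕ) : Type := {V : Submodule ℝ (E n) // Module.finrank ℝ V = k}

namespace G

/-- The orthogonal projection of `ℝⁿ` onto the plane `V`, as an operator on `ℝⁿ`. -/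
def proj {n k : ℕ} (V : G n k) : E n →L[ℝ] E n := V.1.starProjection

/-- The usual topology of `G(n,k)`: that of the metric `d(V, W) = ‖P_V - P_W‖`. -/
instance instTopologicalSpace (n k : ℕ) : TopologicalSpace (G n k) :=
  TopologicalSpace.induced proj inferInstance

instance instMeasurableSpace (n k : ℕ) : MeasurableSpace (G n k) := borel _

instance instBorelSpace (n k : ℕ) : BorelSpace (G n k) := ⟨rfl⟩

/-- The image `g V` of a plane `V ∈ G(n,k)` under `g ∈ O(n)`. -/
def rotate {n k : ℕ} (g : O n) (V : G n k) : G n k :=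
  ⟨V.1.map ((Unitary.linearIsometryEquiv g).toLinearEquiv : E n →ₗ[ℝ] E n),
    (LinearEquiv.finrank_map_eq _ V.1).trans V.2⟩

theorem continuous_rotate {n k : ℕ} (V : G n k) : Continuous fun g : O n => rotate g V := by
  rw [continuous_induced_rng]
  have h : (proj ∘ fun g : O n => rotate g V) =
      fun g : O n => (g : E n →L[ℝ] E n) * proj V * ((star g : O n) : E n →L[ℝ] E n) := by
    funext g
    ext1 x
    exact Submodule.starProjection_map_apply (Unitary.linearIsometryEquiv g) V.1 x
  rw [h]
  exact (continuous_subtype_val.mul continuous_const).mul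
    (continuous_subtype_val.comp continuous_star)

/-- The coordinate plane spanned by the first `k` standard basis vectors of `ℝⁿ`. -/
def coordPlane (n k : ℕ) (h : k ≤ n) : G n k :=
  ⟨Submodule.span ℝ (range fun i : Fin k => EuclideanSpace.single (Fin.castLE h i) (1 : ℝ)), by
    have hli : LinearIndependent ℝ
        (fun i : Fin k => (EuclideanSpace.single (Fin.castLE h i) (1 : ℝ) : E n)) :=
      ((EuclideanSpace.orthonormal_single (𝕜 := ℝ) (ι := Fin n)).comp _
        (Fin.castLE_injective h)).linearIndependent
    simpa using finrank_span_eq_card hli⟩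

end G

/-- The orthogonally invariant Borel probability measure `γ_{n,k}` on `G(n,k)`, for `k ≤ n`: the
law of `g V₀` for a Haar-distributed `g ∈ O(n)`, where `V₀` is a coordinate plane. (For `k > n` the
Grassmannian is empty and the measure is zero.) -/
def gammaG (n k : ℕ) : Measure (G n k) :=
  if h : k ≤ n then (haarO n).map fun g => G.rotate g (G.coordPlane n k h) else 0

theorem isProbabilityMeasure_gammaG {n k : ℕ} (h : k ≤ n) :
    IsProbabilityMeasure (gammaG n k) := by
  have : IsProbabilityMeasure (haarO n) := ⟨Measure.haarMeasure_self (K₀ := ⊤)⟩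
  rw [gammaG, dif_pos h]
  exact Measure.isProbabilityMeasure_map (G.continuous_rotate _).measurable.aemeasurable

theorem map_rotate_gammaG {n k : ℕ} (g : O n) :
    (gammaG n k).map (G.rotate g) = gammaG n k := by
  have hmul : ∀ (a b : O n) (V : G n k), G.rotate (a * b) V = G.rotate a (G.rotate b V) := by
    intro a b V
    refine Subtype.ext (SetLike.coe_injective ?_)
    simp [G.rotate, image_image]
  have hcont : Continuous (G.rotate g : G n k → G n k) := by
    rw [continuous_induced_rng]
    have h : (G.proj ∘ (G.rotate g : G n k → G n k)) =
        fun V => (g : E n →L[ℝ] E n) * G.proj V * ((star g : O n) : E n →L[ℝ] E n) := by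
      funext V
      ext1 x
      exact Submodule.starProjection_map_apply (Unitary.linearIsometryEquiv g) V.1 x
    rw [h]
    exact (continuous_const.mul continuous_induced_dom).mul continuous_const
  unfold gammaG
  split_ifs with h
  · rw [Measure.map_map hcont.measurable (G.continuous_rotate _).measurable]
    have hinv : (haarO n).map (fun a => g * a) = haarO n :=
      map_mul_left_eq_self (Measure.haarMeasure ⊤) g
    conv_rhs => rw [← hinv]
    rw [Measure.map_map (G.continuous_rotate _).measurable (measurable_const_mul g)]
    congr 1
    funext a
    exact (hmul g a _).symm
  · simp

/-- The translated plane `V + x`. -/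
def G.translate {n k : ℕ} (V : G n k) (x : E n) : Set (E n) := (fun v => v + x) '' (V.1 : Set (E n))

/-- The planes `V ∈ G(n, n-m)` with `dim (A ∩ (V + x)) = s - m`. -/
def sectionPlanes {n : ℕ} (m : ℕ) (s : ℝ) (A : Set (E n)) (x : E n) : Set (G n (n - m)) :=
  {V | dimH (A ∩ V.translate x) = ENNReal.ofReal (s - m)}

end

/-!
The planes through `x` are `x + g V₀` for a random rotation `g`, where `V₀` is a coordinate plane,
and they are the fibres of the linear maps `transv m g` onto `ℝᵐ`. The upper bound
`dim (A ∩ (x + g V₀)) ≤ s - m` holds for every `x` and almost every `g`, because a set of diameter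
`d` at distance `r` from `x` is met by `x + g V₀` with probability at most a multiple of
`(d / r) ^ m`.

For the lower bound, replace `A` by a compact subset `K` whose measure `μ = μH[s].restrict K`
satisfies `μ (B(y, r)) ≤ C r ^ s`. Since `s > m`, the pieces of `μ` in dyadic cubes have finite
`m`-energy, so the densities of their projections, smoothed at scale `δ`, converge in `L²` as
`δ → 0`; the squared `L²` norms of the densities of the pieces of level `k` add up to at most a
multiple of `2 ^ (-k (s - m))`. By duality with Frostman measures, the set of `x` at which the
`g`-average of `F (g, transv m g x)` exceeds `l` has Hausdorff content of every dimension `τ > m`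
bounded by a multiple of `l ^ (-2) ∫ F ^ 2`, provided `F` is nonnegative and equicontinuous. Along
scales tending to zero quickly, a Borel–Cantelli argument then gives a Borel set of dimension at
most `m` outside which, for almost every `g`, the densities converge at `transv m g x` and their
squares over the cubes of level `k` add up to `2 ^ (-k (s - m))`, up to a power of `k`.

Where the limit density is positive, the measures `μ`, weighted by Gaussians concentrating on the
slice, keep their mass, and the square sums force the slice to have dimension at least `s - m`.
If the limit vanished for almost every `g`, the average over `g` of the densities at scale `δ` would
tend to zero; by Fatou its lower limit is at least a positive multiple of `∫ |y - x| ^ (-m) dμ y`,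
which is positive.
-/

noncomputable section

open Filter Topology

/-! ### Rotations and transversal coordinates -/

section Transversal

variable {n m : ℕ}

/-- `ℝᵐ`, realized as the space of the last `m` coordinates of `ℝⁿ`. -/
abbrev LastSpace (n m : ℕ) : Type := EuclideanSpace ℝ {i : Fin n // n - m ≤ (i : ℕ)}

theorem card_lastCoords (h : m ≤ n) : Fintype.card {i : Fin n // n - m ≤ (i : ℕ)} = m := by
  have hfirst : Fintype.card {i : Fin n // (i : ℕ) < n - m} = n - m := by
    rw [Fintype.card_subtype, Fin.card_filter_val_lt]
    omega
  have hcompl := Fintype.card_subtype_compl fun i : Fin n => (i : ℕ) < n - m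
  simp only [not_lt, Fintype.card_fin, hfirst] at hcompl
  omega

theorem finrank_lastSpace (h : m ≤ n) : Module.finrank ℝ (LastSpace n m) = m := by
  rw [finrank_euclideanSpace, card_lastCoords h]

/-- The projection of `ℝⁿ` onto its last `m` coordinates. -/
def lastProj (n m : ℕ) : E n →L[ℝ] LastSpace n m :=
  LinearMap.toContinuousLinearMap
    { toFun := fun z => WithLp.toLp 2 fun i => z i.1
      map_add' := fun _ _ => rfl
      map_smul' := fun _ _ => rfl }

theorem lastProj_apply (z : E n) (i : {i : Fin n // n - m ≤ (i : ℕ)}) :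
    lastProj n m z i = z i.1 := rfl

theorem norm_lastProj_sq (z : E n) :
    ‖lastProj n m z‖ ^ 2 = ∑ i : Fin n, if n - m ≤ (i : ℕ) then z i ^ 2 else 0 := by
  rw [EuclideanSpace.norm_sq_eq, ← Finset.sum_filter]
  simp only [lastProj_apply, Real.norm_eq_abs, sq_abs]
  exact (Finset.sum_subtype (Finset.univ.filter fun i : Fin n => n - m ≤ (i : ℕ)) (by simp)
    (fun i => z i ^ 2)).symm

theorem norm_lastProj_le (z : E n) : ‖lastProj n m z‖ ≤ ‖z‖ := by
  refine le_of_sq_le_sq ?_ (norm_nonneg _)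
  rw [norm_lastProj_sq, EuclideanSpace.norm_sq_eq]
  refine Finset.sum_le_sum fun i _ => ?_
  split_ifs
  · simp
  · positivity

theorem ker_lastProj :
    LinearMap.ker (lastProj n m : E n →ₗ[ℝ] LastSpace n m) =
      (G.coordPlane n (n - m) (Nat.sub_le n m)).1 := by
  refine le_antisymm (fun z hz => ?_) (Submodule.span_le.2 ?_)
  · rw [← (EuclideanSpace.basisFun (Fin n) ℝ).sum_repr z]
    refine Submodule.sum_mem _ fun i _ => ?_
    by_cases hi : n - m ≤ (i : ℕ)
    · have hzi : z i = 0 := congrArg (fun v : LastSpace n m => v ⟨i, hi⟩) hz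
      simp [hzi]
    · rw [EuclideanSpace.basisFun_apply]
      exact Submodule.smul_mem _ _ (Submodule.subset_span ⟨⟨i, by omega⟩, rfl⟩)
  · rintro _ ⟨i, rfl⟩
    refine PiLp.ext fun j => ?_
    have hne : j.1 ≠ Fin.castLE (Nat.sub_le n m) i := fun e => by
      have hj := j.2
      rw [e, Fin.val_castLE] at hj
      omega
    simp [lastProj_apply, hne]

/-- The coordinates of a point transversal to the plane `g V₀`, where `V₀` is the coordinate plane
spanned by the first `n - m` basis vectors: the fibres of `transv m g` are the translates of
`g V₀`. -/
def transv {n : ℕ} (m : ℕ) (g : O n) : E n →L[ℝ] LastSpace n m :=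
  lastProj n m ∘L (star g : O n)

theorem transv_apply (g : O n) (x : E n) :
    transv m g x = lastProj n m ((Unitary.linearIsometryEquiv g).symm x) := rfl

@[fun_prop]
theorem continuous_transv : Continuous (transv m : O n → E n →L[ℝ] LastSpace n m) := by
  unfold transv
  fun_prop

theorem norm_transv_le (g : O n) (x : E n) : ‖transv m g x‖ ≤ ‖x‖ := by
  rw [transv_apply]
  exact (norm_lastProj_le _).trans_eq (LinearIsometryEquiv.norm_map _ _)

theorem mem_translate_rotate_iff (g : O n) (x y : E n) :
    y ∈ (G.rotate g (G.coordPlane n (n - m) (Nat.sub_le n m))).translate x ↔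
      transv m g (y - x) = 0 := by
  have hker (v : E n) :
      lastProj n m v = 0 ↔ v ∈ (G.coordPlane n (n - m) (Nat.sub_le n m)).1 := by
    rw [← ker_lastProj]
    rfl
  rw [transv_apply, hker]
  simp only [G.translate, G.rotate, mem_image, SetLike.mem_coe, Submodule.mem_map]
  constructor
  · rintro ⟨v, ⟨w, hw, rfl⟩, rfl⟩
    simpa using hw
  · exact fun hyx => ⟨y - x, ⟨_, hyx, by simp⟩, by simp⟩

instance isProbabilityMeasure_haarO (n : ℕ) : IsProbabilityMeasure (haarO n) :=
  ⟨Measure.haarMeasure_self (K₀ := ⊤)⟩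

instance isMulLeftInvariant_haarO (n : ℕ) : (haarO n).IsMulLeftInvariant :=
  inferInstanceAs (Measure.haarMeasure ⊤).IsMulLeftInvariant

theorem lintegral_symm_apply_eq_of_norm_eq (f : E n → ℝ≥0∞) {x y : E n} (h : ‖x‖ = ‖y‖) :
    ∫⁻ g, f ((Unitary.linearIsometryEquiv g).symm x) ∂haarO n =
      ∫⁻ g, f ((Unitary.linearIsometryEquiv g).symm y) ∂haarO n := by
  -- The reflection `a` exchanging `x` and `y` is absorbed by the invariance of Haar measure.
  obtain ⟨a, ha⟩ : ∃ a : O n, Unitary.linearIsometryEquiv a x = y :=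
    ⟨Unitary.linearIsometryEquiv.symm (ℝ ∙ (x - y))ᗮ.reflection, by
      rw [MulEquiv.apply_symm_apply]
      exact Submodule.reflection_sub h⟩
  rw [← lintegral_mul_left_eq_self (fun g => f ((Unitary.linearIsometryEquiv g).symm y)) a]
  refine lintegral_congr fun g => ?_
  have hcancel : (Unitary.linearIsometryEquiv (a * g)).symm y =
      (Unitary.linearIsometryEquiv g).symm x := by
    rw [← ha, LinearIsometryEquiv.symm_apply_eq]
    simp
  rw [hcancel]

theorem continuous_symm_apply :
    Continuous fun p : O n × E n => (Unitary.linearIsometryEquiv p.1).symm p.2 := by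
  change Continuous fun p : O n × E n => ((star p.1 : O n) : E n →L[ℝ] E n) p.2
  fun_prop

/-- Integration in polar form: the average of `f` over a random direction is read off from an
integral over `ℝⁿ` against a radial weight. -/
theorem lintegral_norm_mul_lintegral_symm_apply {f : E n → ℝ≥0∞} (hf : Measurable f)
    {w : ℝ → ℝ≥0∞} (hw : Measurable w) {e : E n} (he : ‖e‖ = 1) :
    (∫⁻ z : E n, w ‖z‖) * ∫⁻ g, f ((Unitary.linearIsometryEquiv g).symm e) ∂haarO n =
      ∫⁻ z : E n, w ‖z‖ * f (‖z‖⁻¹ • z) := by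
  have : Nontrivial (E n) := ⟨⟨e, 0, fun h => by simp [h] at he⟩⟩
  let R (g : O n) (z : E n) : E n := (Unitary.linearIsometryEquiv g).symm z
  have hR : Measurable fun p : O n × E n => R p.1 p.2 := continuous_symm_apply.measurable
  have hradial (g : O n) :
      ∫⁻ z : E n, w ‖z‖ * f (‖z‖⁻¹ • R g z) = ∫⁻ z : E n, w ‖z‖ * f (‖z‖⁻¹ • z) := by
    rw [← (Unitary.linearIsometryEquiv g).symm.measurePreserving.lintegral_comp
      (f := fun z => w ‖z‖ * f (‖z‖⁻¹ • z)) (by fun_prop)]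
    simp only [LinearIsometryEquiv.norm_map, R]
  have hdirection {z : E n} (hz : z ≠ 0) :
      ∫⁻ g, f (‖z‖⁻¹ • R g z) ∂haarO n = ∫⁻ g, f (R g e) ∂haarO n := by
    simp only [R, ← map_smul]
    refine lintegral_symm_apply_eq_of_norm_eq f ?_
    rw [he, norm_smul, norm_inv, norm_norm, inv_mul_cancel₀ (norm_ne_zero_iff.2 hz)]
  calc (∫⁻ z : E n, w ‖z‖) * ∫⁻ g, f (R g e) ∂haarO n
      = ∫⁻ z : E n, (∫⁻ g, w ‖z‖ * f (‖z‖⁻¹ • R g z) ∂haarO n) := by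
        rw [← lintegral_mul_const _ (by fun_prop)]
        refine lintegral_congr_ae ?_
        filter_upwards [Measure.ae_ne volume (0 : E n)] with z hz
        rw [lintegral_const_mul _ (by fun_prop), hdirection hz]
    _ = ∫⁻ g, (∫⁻ z : E n, w ‖z‖ * f (‖z‖⁻¹ • R g z)) ∂haarO n :=
        (lintegral_lintegral_swap (by fun_prop)).symm
    _ = ∫⁻ z : E n, w ‖z‖ * f (‖z‖⁻¹ • z) := by
        simp only [hradial, lintegral_const, measure_univ, mul_one]

end Transversal

/-! ### Gaussian kernels -/

section GaussKernel

variable {F : Type*} [NormedAddCommGroup F] {m : ℕ}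

/-- The Gaussian kernel of width `σ` on an `m`-dimensional space, without the normalizing constant
`π ^ (-m / 2)`. -/
def gaussKernel (m : ℕ) (σ : ℝ) (v : F) : ℝ :=
  (σ ^ m)⁻¹ * Real.exp (-(‖v‖ ^ 2 / σ ^ 2))

theorem gaussKernel_nonneg {σ : ℝ} (hσ : 0 < σ) (v : F) : 0 ≤ gaussKernel m σ v := by
  unfold gaussKernel; positivity

theorem gaussKernel_le {σ : ℝ} (hσ : 0 < σ) (v : F) : gaussKernel m σ v ≤ (σ ^ m)⁻¹ := by
  refine mul_le_of_le_one_right (by positivity) ?_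
  rw [Real.exp_le_one_iff, neg_nonpos]
  positivity

@[fun_prop]
theorem continuous_gaussKernel (σ : ℝ) : Continuous (gaussKernel m σ : F → ℝ) := by
  unfold gaussKernel; fun_prop

theorem gaussKernel_smul [NormedSpace ℝ F] {σ r : ℝ} (hr : 0 < r) (v : F) :
    gaussKernel m σ (r • v) = (r ^ m)⁻¹ * gaussKernel m (σ / r) v := by
  unfold gaussKernel
  rw [norm_smul, Real.norm_of_nonneg hr.le, div_pow, div_pow, ← mul_assoc, ← mul_inv]
  congr 2
  · field_simp
  · field_simp

end GaussKernel

section GaussianConvolution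

variable {F : Type*} [NormedAddCommGroup F] [InnerProductSpace ℝ F]

theorem weighted_norm_sq_add (p q : F) {a b : ℝ} (hab : a + b ≠ 0) :
    a * ‖p‖ ^ 2 + b * ‖q‖ ^ 2 =
      (a + b) * ‖(a + b)⁻¹ • (a • p + b • q)‖ ^ 2 + a * b / (a + b) * ‖p - q‖ ^ 2 := by
  rw [norm_smul, mul_pow, norm_add_sq_real, norm_sub_sq_real, norm_smul, norm_smul,
    real_inner_smul_left, real_inner_smul_right, mul_pow, mul_pow]
  simp only [Real.norm_eq_abs, sq_abs]
  field_simp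
  ring

theorem gaussKernel_mul_gaussKernel {m : ℕ} {δ ε : ℝ} (hδ : 0 < δ) (hε : 0 < ε) (a b u : F) :
    gaussKernel m δ (a - u) * gaussKernel m ε (b - u) =
      (δ ^ m)⁻¹ * (ε ^ m)⁻¹ * Real.exp (-(‖a - b‖ ^ 2 / (δ ^ 2 + ε ^ 2))) *
        Real.exp (-((δ ^ 2)⁻¹ + (ε ^ 2)⁻¹) *
          ‖u - ((δ ^ 2)⁻¹ + (ε ^ 2)⁻¹)⁻¹ • ((δ ^ 2)⁻¹ • a + (ε ^ 2)⁻¹ • b)‖ ^ 2) := by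
  set A := (δ ^ 2)⁻¹ with hA
  set B := (ε ^ 2)⁻¹ with hB
  have hAB : A + B ≠ 0 := by positivity
  have hsquare := weighted_norm_sq_add (a - u) (b - u) hAB
  have hcentre : (A + B)⁻¹ • (A • (a - u) + B • (b - u)) =
      (A + B)⁻¹ • (A • a + B • b) - u := by
    rw [show A • (a - u) + B • (b - u) = (A • a + B • b) - (A + B) • u by module, smul_sub,
      inv_smul_smul₀ hAB]
  have hharmonic : A * B / (A + B) = (δ ^ 2 + ε ^ 2)⁻¹ := by
    rw [hA, hB]; field_simp; ring
  rw [hcentre, hharmonic, sub_sub_sub_cancel_right,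
    norm_sub_rev ((A + B)⁻¹ • (A • a + B • b)) u] at hsquare
  unfold gaussKernel
  rw [mul_mul_mul_comm, ← Real.exp_add, mul_assoc ((δ ^ m)⁻¹ * (ε ^ m)⁻¹), ← Real.exp_add]
  congr 2
  rw [div_eq_inv_mul, div_eq_inv_mul, div_eq_inv_mul]
  linarith

variable [FiniteDimensional ℝ F] [MeasurableSpace F] [BorelSpace F]

theorem integrable_exp_neg_mul_norm_sq {b : ℝ} (hb : 0 < b) :
    Integrable fun z : F => Real.exp (-b * ‖z‖ ^ 2) := by
  refine Integrable.of_integral_ne_zero ?_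
  rw [GaussianFourier.integral_rexp_neg_mul_sq_norm hb]
  positivity

theorem lintegral_exp_neg_mul_norm_sub_sq {b : ℝ} (hb : 0 < b) (c : F) :
    ∫⁻ u : F, ENNReal.ofReal (Real.exp (-b * ‖u - c‖ ^ 2)) =
      ENNReal.ofReal ((Real.pi / b) ^ ((Module.finrank ℝ F : ℝ) / 2)) := by
  rw [lintegral_sub_right_eq_self (fun u : F => ENNReal.ofReal (Real.exp (-b * ‖u‖ ^ 2))) c,
    ← GaussianFourier.integral_rexp_neg_mul_sq_norm hb,
    ofReal_integral_eq_lintegral_ofReal (integrable_exp_neg_mul_norm_sq hb)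
      (Eventually.of_forall fun z => (Real.exp_pos _).le)]

theorem pow_eq_sq_rpow (m : ℕ) {x : ℝ} (hx : 0 ≤ x) : x ^ m = (x ^ 2) ^ ((m : ℝ) / 2) := by
  rw [← Real.rpow_natCast x 2, ← Real.rpow_mul hx, ← Real.rpow_natCast]
  congr 1
  push_cast
  ring

theorem lintegral_gaussKernel_mul_gaussKernel {m : ℕ} (hF : Module.finrank ℝ F = m) {δ ε : ℝ}
    (hδ : 0 < δ) (hε : 0 < ε) (a b : F) :
    ∫⁻ u : F, ENNReal.ofReal (gaussKernel m δ (a - u) * gaussKernel m ε (b - u)) =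
      ENNReal.ofReal (Real.pi ^ ((m : ℝ) / 2)) *
        ENNReal.ofReal (gaussKernel m √(δ ^ 2 + ε ^ 2) (a - b)) := by
  have hweight : Real.pi / ((δ ^ 2)⁻¹ + (ε ^ 2)⁻¹) =
      Real.pi * (δ ^ 2 * ε ^ 2) / (δ ^ 2 + ε ^ 2) := by
    field_simp
    ring
  simp only [gaussKernel_mul_gaussKernel hδ hε]
  simp_rw [ENNReal.ofReal_mul (p := (δ ^ m)⁻¹ * (ε ^ m)⁻¹ *
    Real.exp (-(‖a - b‖ ^ 2 / (δ ^ 2 + ε ^ 2)))) (by positivity)]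
  rw [lintegral_const_mul _ (by fun_prop), lintegral_exp_neg_mul_norm_sub_sq (by positivity), hF,
    ← ENNReal.ofReal_mul (by positivity), ← ENNReal.ofReal_mul (by positivity), gaussKernel,
    pow_eq_sq_rpow m (Real.sqrt_nonneg _), Real.sq_sqrt (by positivity), hweight,
    Real.div_rpow (by positivity) (by positivity), Real.mul_rpow Real.pi_pos.le (by positivity),
    Real.mul_rpow (by positivity) (by positivity), ← pow_eq_sq_rpow m hδ.le,
    ← pow_eq_sq_rpow m hε.le]
  congr 1
  field_simp

end GaussianConvolution

/-! ### The rotation average of the Gaussian kernel -/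

section AvgKernel

variable {n m : ℕ} {σ : ℝ}

/-- The average over all rotations of the Gaussian kernel at the transversal coordinates of `z`. -/
def avgKernel (n m : ℕ) (σ : ℝ) (z : E n) : ℝ≥0∞ :=
  ∫⁻ g, ENNReal.ofReal (gaussKernel m σ (transv m g z)) ∂haarO n

theorem avgKernel_le_inv_pow (hσ : 0 < σ) (z : E n) :
    avgKernel n m σ z ≤ ENNReal.ofReal (σ ^ m)⁻¹ := by
  refine (lintegral_mono fun g => ENNReal.ofReal_le_ofReal (gaussKernel_le hσ _)).trans ?_
  simp

@[fun_prop]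
theorem measurable_avgKernel : Measurable (avgKernel n m σ) := by
  refine Measurable.lintegral_prod_left'
    (f := fun p : O n × E n => ENNReal.ofReal (gaussKernel m σ (transv m p.1 p.2))) ?_
  fun_prop

theorem avgKernel_eq_smul {z e : E n} (hz : z ≠ 0) (he : ‖e‖ = 1) :
    avgKernel n m σ z = ENNReal.ofReal (‖z‖ ^ m)⁻¹ * avgKernel n m (σ / ‖z‖) e := by
  have hnorm : ‖z‖ = ‖‖z‖ • e‖ := by simp [norm_smul, he]
  calc avgKernel n m σ z
      = avgKernel n m σ (‖z‖ • e) := lintegral_symm_apply_eq_of_norm_eq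
        (fun v => ENNReal.ofReal (gaussKernel m σ (lastProj n m v))) hnorm
    _ = ENNReal.ofReal (‖z‖ ^ m)⁻¹ * avgKernel n m (σ / ‖z‖) e := by
        simp only [avgKernel, map_smul, gaussKernel_smul (norm_pos_iff.2 hz)]
        rw [← lintegral_const_mul _ (by fun_prop)]
        exact lintegral_congr fun g => ENNReal.ofReal_mul (by positivity)

/-- The linear map of `ℝⁿ` multiplying the last `m` coordinates by `σ`; the map `lastScale n m 0`
is the projection to the first `n - m` coordinates. -/
def lastScale (n m : ℕ) (σ : ℝ) : E n →ₗ[ℝ] E n :=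
  Matrix.toLpLin 2 2 (Matrix.diagonal fun i : Fin n => if n - m ≤ (i : ℕ) then σ else 1)

theorem lastScale_apply (σ : ℝ) (z : E n) (i : Fin n) :
    lastScale n m σ z i = (if n - m ≤ (i : ℕ) then σ else 1) * z i := by
  rw [lastScale, Matrix.toLpLin_apply]
  simp only [Matrix.mulVec_diagonal]

theorem det_lastScale (h : m ≤ n) (σ : ℝ) : LinearMap.det (lastScale n m σ) = σ ^ m := by
  rw [lastScale, LinearMap.det_toLpLin, Matrix.det_diagonal, Finset.prod_ite, Finset.prod_const,
    Finset.prod_const_one, mul_one, ← Fintype.card_subtype, card_lastCoords h]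

theorem measurable_lastScale (σ : ℝ) : Measurable (lastScale n m σ) :=
  (LinearMap.continuous_of_finiteDimensional _).measurable

theorem lastProj_lastScale (σ : ℝ) (z : E n) :
    lastProj n m (lastScale n m σ z) = σ • lastProj n m z :=
  PiLp.ext fun i => by rw [lastProj_apply, lastScale_apply, if_pos i.2]; rfl

theorem norm_lastScale_sq (σ : ℝ) (z : E n) :
    ‖lastScale n m σ z‖ ^ 2 = ‖lastScale n m 0 z‖ ^ 2 + σ ^ 2 * ‖lastProj n m z‖ ^ 2 := by
  rw [norm_lastProj_sq, EuclideanSpace.norm_sq_eq, EuclideanSpace.norm_sq_eq, Finset.mul_sum,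
    ← Finset.sum_add_distrib]
  refine Finset.sum_congr rfl fun i _ => ?_
  simp only [lastScale_apply, Real.norm_eq_abs, sq_abs]
  split_ifs <;> ring

theorem norm_sq_eq_lastScale (m : ℕ) (z : E n) :
    ‖z‖ ^ 2 = ‖lastScale n m 0 z‖ ^ 2 + ‖lastProj n m z‖ ^ 2 := by
  have hone : lastScale n m 1 z = z := PiLp.ext fun i => by rw [lastScale_apply]; simp
  simpa [hone] using norm_lastScale_sq (m := m) 1 z

theorem lintegral_comp_lastScale (h : m ≤ n) (hσ : 0 < σ) {f : E n → ℝ≥0∞} (hf : Measurable f) :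
    ∫⁻ z, f (lastScale n m σ z) = ENNReal.ofReal (σ ^ m)⁻¹ * ∫⁻ z, f z := by
  have hdet : LinearMap.det (lastScale n m σ) ≠ 0 := by rw [det_lastScale h]; positivity
  rw [← lintegral_map hf (measurable_lastScale σ),
    Measure.map_linearMap_addHaar_eq_smul_addHaar _ hdet, lintegral_smul_measure,
    det_lastScale h, abs_of_pos (by positivity), smul_eq_mul]

theorem continuous_norm_lastScale (z : E n) : Continuous fun σ : ℝ => ‖lastScale n m σ z‖ := by
  have hsqrt (σ : ℝ) : ‖lastScale n m σ z‖ =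
      √(‖lastScale n m 0 z‖ ^ 2 + σ ^ 2 * ‖lastProj n m z‖ ^ 2) := by
    rw [← norm_lastScale_sq, Real.sqrt_sq (norm_nonneg _)]
  simp only [funext hsqrt]
  fun_prop

theorem ae_lastScale_zero_ne (h : m < n) : ∀ᵐ z : E n, lastScale n m 0 z ≠ 0 := by
  refine compl_mem_ae_iff.2 (Measure.addHaar_submodule volume (LinearMap.ker _) fun htop => ?_)
  let i : Fin n := ⟨0, by omega⟩
  have hi : lastScale n m 0 (EuclideanSpace.single i 1) i = 0 := by
    rw [LinearMap.mem_ker.1 (htop.ge trivial)]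
    rfl
  rw [lastScale_apply, if_neg (by simp only [i]; omega)] at hi
  simp at hi

end AvgKernel

section RescaledWeight

variable {n m : ℕ} {σ : ℝ}

/-- The radial weight `max 0 (1 - ‖·‖)` times the Gaussian kernel of width `σ` in the transversal
direction of a point, after the substitution `lastScale n m σ`. The substitution gives the kernel
a limit as `σ → 0`. -/
def rescaledWeight (n m : ℕ) (σ : ℝ) (z : E n) : ℝ :=
  max 0 (1 - ‖lastScale n m σ z‖) *
    Real.exp (-(‖lastProj n m z‖ ^ 2 / ‖lastScale n m σ z‖ ^ 2))

theorem measurable_rescaledWeight (σ : ℝ) : Measurable (rescaledWeight n m σ) := by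
  have hscale := measurable_lastScale (n := n) (m := m) σ
  unfold rescaledWeight
  fun_prop

theorem rescaledWeight_eq (hσ : 0 < σ) (z : E n) :
    rescaledWeight n m σ z = max 0 (1 - ‖lastScale n m σ z‖) *
      Real.exp (-((‖lastScale n m σ z‖⁻¹ * ‖lastProj n m (lastScale n m σ z)‖) ^ 2 / σ ^ 2)) := by
  rw [rescaledWeight, lastProj_lastScale, norm_smul, Real.norm_of_nonneg hσ.le]
  congr 3
  field_simp

theorem lintegral_weight_mul_avgKernel (h : m ≤ n) (hσ : 0 < σ) {e : E n} (he : ‖e‖ = 1) :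
    (∫⁻ z : E n, ENNReal.ofReal (max 0 (1 - ‖z‖))) * avgKernel n m σ e =
      ∫⁻ z : E n, ENNReal.ofReal (rescaledWeight n m σ z) := by
  let f (v : E n) : ℝ≥0∞ := ENNReal.ofReal (gaussKernel m σ (lastProj n m v))
  let F (z : E n) : ℝ≥0∞ := ENNReal.ofReal (max 0 (1 - ‖z‖) *
    Real.exp (-((‖z‖⁻¹ * ‖lastProj n m z‖) ^ 2 / σ ^ 2)))
  have hF : Measurable F := by fun_prop
  have hpolar := lintegral_norm_mul_lintegral_symm_apply (f := f)
    (w := fun r => ENNReal.ofReal (max 0 (1 - r))) (by fun_prop) (by fun_prop) he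
  refine hpolar.trans ?_
  simp only [rescaledWeight_eq hσ]
  rw [lintegral_comp_lastScale h hσ hF, ← lintegral_const_mul _ hF]
  refine lintegral_congr fun z => ?_
  simp only [f, F]
  rw [← ENNReal.ofReal_mul (by positivity), ← ENNReal.ofReal_mul (by positivity), gaussKernel,
    map_smul, norm_smul, norm_inv, norm_norm, mul_left_comm]

theorem rescaledWeight_le (hσ : 0 < σ) (z : E n) :
    rescaledWeight n m σ z ≤ Real.exp 1 * Real.exp (-‖z‖ ^ 2) := by
  have hsplit := norm_lastScale_sq (m := m) σ z
  set p := ‖lastProj n m z‖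
  set ρ := ‖lastScale n m σ z‖ with hρ
  rcases le_or_gt 1 ρ with hρ1 | hρ1
  · rw [rescaledWeight, ← hρ, max_eq_left (by linarith), zero_mul]
    positivity
  have hρ_sq : ρ ^ 2 ≤ 1 := pow_le_one₀ (norm_nonneg _) hρ1.le
  have hp : p ^ 2 ≤ p ^ 2 / ρ ^ 2 := by
    rcases (norm_nonneg (lastScale n m σ z)).eq_or_lt with hzero | hpos
    · have hp0 : σ ^ 2 * p ^ 2 ≤ 0 := by
        rw [← hρ] at hzero
        rw [← hzero] at hsplit
        linarith [sq_nonneg ‖lastScale n m 0 z‖]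
      have : p ^ 2 ≤ 0 := nonpos_of_mul_nonpos_right hp0 (by positivity)
      exact this.trans (by positivity)
    · rw [le_div_iff₀ (pow_pos hpos 2)]
      exact mul_le_of_le_one_right (sq_nonneg p) hρ_sq
  have hz : ‖z‖ ^ 2 ≤ 1 + p ^ 2 / ρ ^ 2 := by
    rw [norm_sq_eq_lastScale m z]
    linarith [mul_nonneg (sq_nonneg σ) (sq_nonneg p)]
  rw [rescaledWeight, ← Real.exp_add]
  exact (mul_le_of_le_one_left (Real.exp_pos _).le
    (max_le zero_le_one (sub_le_self 1 (norm_nonneg _)))).trans (Real.exp_le_exp.2 (by linarith))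

theorem lintegral_exp_neg_norm_sq_lt_top (n : ℕ) :
    ∫⁻ z : E n, ENNReal.ofReal (Real.exp 1 * Real.exp (-‖z‖ ^ 2)) < ∞ := by
  have hint : Integrable fun z : E n => Real.exp (-1 * ‖z‖ ^ 2) :=
    integrable_exp_neg_mul_norm_sq one_pos
  simpa using (hint.const_mul (Real.exp 1)).lintegral_lt_top

theorem tendsto_rescaledWeight {z : E n} (hz : lastScale n m 0 z ≠ 0) :
    Tendsto (fun σ => rescaledWeight n m σ z) (𝓝[>] 0) (𝓝 (rescaledWeight n m 0 z)) := by
  have hnorm : Tendsto (fun σ : ℝ => ‖lastScale n m σ z‖) (𝓝[>] 0) (𝓝 ‖lastScale n m 0 z‖) :=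
    ((continuous_norm_lastScale z).tendsto 0).mono_left nhdsWithin_le_nhds
  refine (tendsto_const_nhds.max (tendsto_const_nhds.sub hnorm)).mul ?_
  refine (Real.continuous_exp.tendsto _).comp (Tendsto.neg ?_)
  exact tendsto_const_nhds.div (hnorm.pow 2) (pow_ne_zero 2 (norm_ne_zero_iff.2 hz))

theorem tendsto_lintegral_rescaledWeight (h : m < n) :
    Tendsto (fun σ => ∫⁻ z : E n, ENNReal.ofReal (rescaledWeight n m σ z)) (𝓝[>] 0)
      (𝓝 (∫⁻ z : E n, ENNReal.ofReal (rescaledWeight n m 0 z))) := by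
  refine tendsto_lintegral_filter_of_dominated_convergence
    (fun z => ENNReal.ofReal (Real.exp 1 * Real.exp (-‖z‖ ^ 2)))
    (Eventually.of_forall fun σ => (measurable_rescaledWeight σ).ennreal_ofReal) ?_
    (lintegral_exp_neg_norm_sq_lt_top n).ne ?_
  · filter_upwards [self_mem_nhdsWithin] with σ hσ
    exact Eventually.of_forall fun z => ENNReal.ofReal_le_ofReal (rescaledWeight_le hσ z)
  · filter_upwards [ae_lastScale_zero_ne h] with z hz
    exact ENNReal.tendsto_ofReal (tendsto_rescaledWeight hz)

theorem lintegral_weight_pos (n : ℕ) : 0 < ∫⁻ z : E n, ENNReal.ofReal (max 0 (1 - ‖z‖)) := by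
  rw [lintegral_pos_iff_support (by fun_prop)]
  refine (Metric.measure_ball_pos volume (0 : E n) one_pos).trans_le (measure_mono fun z hz => ?_)
  simpa using hz

theorem lintegral_weight_lt_top (n : ℕ) :
    ∫⁻ z : E n, ENNReal.ofReal (max 0 (1 - ‖z‖)) < ∞ := by
  refine (lintegral_mono fun z => ENNReal.ofReal_le_ofReal ?_).trans_lt
    (lintegral_exp_neg_norm_sq_lt_top n)
  rcases le_or_gt 1 ‖z‖ with hz | hz
  · rw [max_eq_left (by linarith)]
    positivity
  · rw [← Real.exp_add]
    refine (max_le zero_le_one (by linarith [norm_nonneg z])).trans (Real.one_le_exp ?_)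
    nlinarith [norm_nonneg z]

theorem lintegral_rescaledWeight_zero_pos (n m : ℕ) :
    0 < ∫⁻ z : E n, ENNReal.ofReal (rescaledWeight n m 0 z) := by
  rw [lintegral_pos_iff_support (measurable_rescaledWeight 0).ennreal_ofReal]
  refine (Metric.measure_ball_pos volume (0 : E n) one_pos).trans_le (measure_mono fun z hz => ?_)
  have hle : ‖lastScale n m 0 z‖ ≤ ‖z‖ := by
    refine le_of_sq_le_sq ?_ (norm_nonneg _)
    rw [norm_sq_eq_lastScale m z]
    exact le_add_of_nonneg_right (sq_nonneg _)
  have hlt : 0 < 1 - ‖lastScale n m 0 z‖ := sub_pos.2 (hle.trans_lt (mem_ball_zero_iff.1 hz))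
  have hpos : 0 < rescaledWeight n m 0 z :=
    mul_pos (lt_max_of_lt_right hlt) (Real.exp_pos _)
  simpa using hpos

theorem exists_norm_eq_one (hn : 0 < n) : ∃ e : E n, ‖e‖ = 1 :=
  ⟨EuclideanSpace.single ⟨0, hn⟩ 1, by simp⟩

theorem avgKernel_eq_lintegral_rescaledWeight (h : m < n) (hσ : 0 < σ) {z : E n} (hz : z ≠ 0) :
    avgKernel n m σ z = (∫⁻ z : E n, ENNReal.ofReal (max 0 (1 - ‖z‖)))⁻¹ *
      (∫⁻ y : E n, ENNReal.ofReal (rescaledWeight n m (σ / ‖z‖) y)) *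
        ENNReal.ofReal (‖z‖ ^ m)⁻¹ := by
  obtain ⟨e, he⟩ := exists_norm_eq_one (n := n) (by omega)
  rw [avgKernel_eq_smul hz he,
    ← lintegral_weight_mul_avgKernel h.le (div_pos hσ (norm_pos_iff.2 hz)) he,
    ← mul_assoc, ENNReal.inv_mul_cancel (lintegral_weight_pos n).ne'
    (lintegral_weight_lt_top n).ne, one_mul, mul_comm]

theorem exists_avgKernel_le (h : m < n) :
    ∃ C : ℝ≥0∞, C ≠ ∞ ∧ ∀ σ : ℝ, 0 < σ → ∀ z : E n, z ≠ 0 →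
      avgKernel n m σ z ≤ C * ENNReal.ofReal (‖z‖ ^ m)⁻¹ := by
  refine ⟨_, ENNReal.mul_ne_top (ENNReal.inv_ne_top.2 (lintegral_weight_pos n).ne')
    (lintegral_exp_neg_norm_sq_lt_top n).ne, fun σ hσ z hz => ?_⟩
  rw [avgKernel_eq_lintegral_rescaledWeight h hσ hz]
  gcongr
  exact rescaledWeight_le (div_pos hσ (norm_pos_iff.2 hz)) _

theorem exists_tendsto_avgKernel (h : m < n) :
    ∃ c : ℝ≥0∞, 0 < c ∧ c ≠ ∞ ∧ ∀ z : E n, z ≠ 0 →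
      Tendsto (fun σ => avgKernel n m σ z) (𝓝[>] 0) (𝓝 (c * ENNReal.ofReal (‖z‖ ^ m)⁻¹)) := by
  have hW : (∫⁻ z : E n, ENNReal.ofReal (max 0 (1 - ‖z‖)))⁻¹ ≠ ∞ :=
    ENNReal.inv_ne_top.2 (lintegral_weight_pos n).ne'
  have hlimit : ∫⁻ z : E n, ENNReal.ofReal (rescaledWeight n m 0 z) ≠ ∞ := by
    refine ne_top_of_le_ne_top (lintegral_exp_neg_norm_sq_lt_top n).ne
      (le_of_tendsto (tendsto_lintegral_rescaledWeight h) ?_)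
    filter_upwards [self_mem_nhdsWithin] with σ hσ
    exact lintegral_mono fun z => ENNReal.ofReal_le_ofReal (rescaledWeight_le hσ z)
  refine ⟨_, ENNReal.mul_pos (ENNReal.inv_ne_zero.2 (lintegral_weight_lt_top n).ne)
    (lintegral_rescaledWeight_zero_pos n m).ne', ENNReal.mul_ne_top hW hlimit, fun z hz => ?_⟩
  have hz' : 0 < ‖z‖ := norm_pos_iff.2 hz
  have hdiv : Tendsto (fun σ : ℝ => σ / ‖z‖) (𝓝[>] 0) (𝓝[>] 0) := by
    refine tendsto_nhdsWithin_iff.2 ⟨?_, ?_⟩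
    · exact ((continuous_id.div_const ‖z‖).tendsto' 0 0 (zero_div _)).mono_left nhdsWithin_le_nhds
    · filter_upwards [self_mem_nhdsWithin] with σ hσ using div_pos hσ hz'
  refine (ENNReal.Tendsto.mul_const (ENNReal.Tendsto.const_mul
    ((tendsto_lintegral_rescaledWeight h).comp hdiv) (Or.inr hW))
      (Or.inr ENNReal.ofReal_ne_top)).congr' ?_
  filter_upwards [self_mem_nhdsWithin] with σ hσ
  exact (avgKernel_eq_lintegral_rescaledWeight h hσ hz).symm

end RescaledWeight

/-! ### Smoothed projections and energies -/

/-- The measure on pairs of a rotation and a transversal coordinate. -/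
def bundleMeasure (n m : ℕ) : Measure (O n × LastSpace n m) := (haarO n).prod volume

/-- The density at scale `δ` of the projection of `μ` to the transversal coordinates. -/
def smoothed {n : ℕ} (m : ℕ) (δ : ℝ) (μ : Measure (E n)) (p : O n × LastSpace n m) : ℝ :=
  ∫ y, gaussKernel m δ (transv m p.1 y - p.2) ∂μ

/-- The `m`-energy of a measure. Since `0⁻¹ = 0`, the diagonal does not contribute to it when
`m ≠ 0`. -/
def rieszEnergy {n : ℕ} (m : ℕ) (μ : Measure (E n)) : ℝ≥0∞ :=
  ∫⁻ q, ENNReal.ofReal (‖q.1 - q.2‖ ^ m)⁻¹ ∂μ.prod μ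

section Smoothed

variable {n m : ℕ} {δ ε : ℝ} {μ : Measure (E n)}

theorem integrable_gaussKernel_transv [IsFiniteMeasure μ] (hδ : 0 < δ)
    (p : O n × LastSpace n m) : Integrable (fun y => gaussKernel m δ (transv m p.1 y - p.2)) μ := by
  refine Integrable.of_bound (C := (δ ^ m)⁻¹) ?_ (Eventually.of_forall fun y => ?_)
  · exact Measurable.aestronglyMeasurable (by fun_prop)
  · rw [Real.norm_of_nonneg (gaussKernel_nonneg hδ _)]
    exact gaussKernel_le hδ _

theorem smoothed_nonneg (hδ : 0 < δ) (p : O n × LastSpace n m) : 0 ≤ smoothed m δ μ p :=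
  integral_nonneg fun _ => gaussKernel_nonneg hδ _

theorem ofReal_smoothed [IsFiniteMeasure μ] (hδ : 0 < δ) (p : O n × LastSpace n m) :
    ENNReal.ofReal (smoothed m δ μ p) =
      ∫⁻ y, ENNReal.ofReal (gaussKernel m δ (transv m p.1 y - p.2)) ∂μ :=
  ofReal_integral_eq_lintegral_ofReal (integrable_gaussKernel_transv hδ p)
    (Eventually.of_forall fun _ => gaussKernel_nonneg hδ _)

@[fun_prop]
theorem measurable_smoothed [IsFiniteMeasure μ] : Measurable (smoothed m δ μ) := by
  have hkernel : Measurable fun q : (O n × LastSpace n m) × E n =>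
      gaussKernel m δ (transv m q.1.1 q.2 - q.1.2) := by fun_prop
  exact hkernel.stronglyMeasurable.integral_prod_right'.measurable

theorem lintegral_gaussKernel_transv_mul (h : m ≤ n) (hδ : 0 < δ) (hε : 0 < ε) (y z : E n) :
    ∫⁻ p, ENNReal.ofReal (gaussKernel m δ (transv m p.1 y - p.2) *
        gaussKernel m ε (transv m p.1 z - p.2)) ∂bundleMeasure n m =
      ENNReal.ofReal (Real.pi ^ ((m : ℝ) / 2)) * avgKernel n m √(δ ^ 2 + ε ^ 2) (y - z) := by
  rw [bundleMeasure, lintegral_prod _ (by fun_prop)]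
  simp only [lintegral_gaussKernel_mul_gaussKernel (finrank_lastSpace h) hδ hε, ← map_sub]
  exact lintegral_const_mul _ (by fun_prop)

theorem lintegral_smoothed_mul [IsFiniteMeasure μ] (h : m ≤ n) (hδ : 0 < δ) (hε : 0 < ε) :
    ∫⁻ p, ENNReal.ofReal (smoothed m δ μ p * smoothed m ε μ p) ∂bundleMeasure n m =
      ENNReal.ofReal (Real.pi ^ ((m : ℝ) / 2)) *
        ∫⁻ q, avgKernel n m √(δ ^ 2 + ε ^ 2) (q.1 - q.2) ∂μ.prod μ := by
  have hprod (p : O n × LastSpace n m) :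
      ENNReal.ofReal (smoothed m δ μ p * smoothed m ε μ p) =
      ∫⁻ q, ENNReal.ofReal (gaussKernel m δ (transv m p.1 q.1 - p.2) *
        gaussKernel m ε (transv m p.1 q.2 - p.2)) ∂μ.prod μ := by
    rw [ENNReal.ofReal_mul (smoothed_nonneg hδ p), ofReal_smoothed hδ, ofReal_smoothed hε,
      ← lintegral_prod_mul (by fun_prop) (by fun_prop)]
    exact lintegral_congr fun q => (ENNReal.ofReal_mul (gaussKernel_nonneg hδ _)).symm
  have hmeas : Measurable fun r : (O n × LastSpace n m) × (E n × E n) =>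
      ENNReal.ofReal (gaussKernel m δ (transv m r.1.1 r.2.1 - r.1.2) *
        gaussKernel m ε (transv m r.1.1 r.2.2 - r.1.2)) := by fun_prop
  simp only [hprod]
  rw [bundleMeasure, lintegral_lintegral_swap hmeas.aemeasurable, ← bundleMeasure]
  simp only [lintegral_gaussKernel_transv_mul h hδ hε]
  exact lintegral_const_mul _ (by fun_prop)

theorem ae_sub_ne_zero_prod [SFinite μ] [NullSingletonClass μ] :
    ∀ᵐ q : E n × E n ∂μ.prod μ, q.1 - q.2 ≠ 0 := by
  have hmeas : MeasurableSet {q : E n × E n | q.1 - q.2 ≠ 0} :=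
    (measurableSet_singleton (0 : E n)).compl.preimage (measurable_fst.sub measurable_snd)
  refine (Measure.ae_prod_iff_ae_ae hmeas).2 (Eventually.of_forall fun y => ?_)
  filter_upwards [Measure.ae_ne μ y] with z hz
  exact sub_ne_zero.2 hz.symm

theorem exists_lintegral_smoothed_sq_le (h : m < n) : ∃ C : ℝ≥0∞, C ≠ ∞ ∧
    ∀ (μ : Measure (E n)) [IsFiniteMeasure μ] [NullSingletonClass μ] (δ : ℝ), 0 < δ →
      ∫⁻ p, ENNReal.ofReal (smoothed m δ μ p ^ 2) ∂bundleMeasure n m ≤ C * rieszEnergy m μ := by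
  obtain ⟨C, hC, hle⟩ := exists_avgKernel_le h
  refine ⟨ENNReal.ofReal (Real.pi ^ ((m : ℝ) / 2)) * C,
    ENNReal.mul_ne_top ENNReal.ofReal_ne_top hC, fun μ _ _ δ hδ => ?_⟩
  simp only [sq (smoothed m δ μ _)]
  rw [lintegral_smoothed_mul h.le hδ hδ, mul_assoc, rieszEnergy,
    ← lintegral_const_mul C (by fun_prop)]
  gcongr 1
  refine lintegral_mono_ae ?_
  filter_upwards [ae_sub_ne_zero_prod] with q hq
  exact hle _ (by positivity) _ hq

theorem exists_tendsto_lintegral_avgKernel [IsFiniteMeasure μ] [NullSingletonClass μ] (h : m < n)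
    (hE : rieszEnergy m μ ≠ ∞) :
    ∃ I : ℝ≥0∞, I ≠ ∞ ∧
      Tendsto (fun σ => ∫⁻ q, avgKernel n m σ (q.1 - q.2) ∂μ.prod μ) (𝓝[>] 0) (𝓝 I) := by
  obtain ⟨C, hC, hle⟩ := exists_avgKernel_le h
  obtain ⟨c, -, hc, hlim⟩ := exists_tendsto_avgKernel h
  refine ⟨∫⁻ q, c * ENNReal.ofReal (‖q.1 - q.2‖ ^ m)⁻¹ ∂μ.prod μ, ?_,
    tendsto_lintegral_filter_of_dominated_convergence
      (fun q => C * ENNReal.ofReal (‖q.1 - q.2‖ ^ m)⁻¹)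
      (Eventually.of_forall fun σ => by fun_prop) ?_ ?_ ?_⟩
  · rw [lintegral_const_mul _ (by fun_prop)]
    exact ENNReal.mul_ne_top hc hE
  · filter_upwards [self_mem_nhdsWithin] with σ hσ
    filter_upwards [ae_sub_ne_zero_prod] with q hq
    exact hle _ hσ _ hq
  · rw [lintegral_const_mul _ (by fun_prop)]
    exact ENNReal.mul_ne_top hC hE
  · filter_upwards [ae_sub_ne_zero_prod] with q hq
    exact hlim _ hq

theorem exists_tendsto_lintegral_smoothed_mul [IsFiniteMeasure μ] [NullSingletonClass μ]
    (h : m < n) (hE : rieszEnergy m μ ≠ ∞) :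
    ∃ Λ : ℝ≥0∞, Λ ≠ ∞ ∧
      Tendsto (fun d : ℝ × ℝ =>
        ∫⁻ p, ENNReal.ofReal (smoothed m d.1 μ p * smoothed m d.2 μ p) ∂bundleMeasure n m)
        (𝓝[>] 0 ×ˢ 𝓝[>] 0) (𝓝 Λ) := by
  obtain ⟨I, hI, hlim⟩ := exists_tendsto_lintegral_avgKernel h hE
  have hpos : ∀ᶠ d : ℝ × ℝ in 𝓝[>] 0 ×ˢ 𝓝[>] 0, 0 < d.1 ∧ 0 < d.2 :=
    (eventually_mem_nhdsWithin (a := (0 : ℝ)) (s := Ioi 0)).prod_mk eventually_mem_nhdsWithin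
  have hscale : Tendsto (fun d : ℝ × ℝ => √(d.1 ^ 2 + d.2 ^ 2)) (𝓝[>] 0 ×ˢ 𝓝[>] 0) (𝓝[>] 0) := by
    refine tendsto_nhdsWithin_iff.2 ⟨?_, ?_⟩
    · have hcont : Continuous fun d : ℝ × ℝ => √(d.1 ^ 2 + d.2 ^ 2) := by fun_prop
      refine (hcont.tendsto' (0, 0) 0 (by simp)).mono_left ?_
      rw [nhds_prod_eq]
      exact prod_mono nhdsWithin_le_nhds nhdsWithin_le_nhds
    · filter_upwards [hpos] with d hd
      have := hd.1
      exact Real.sqrt_pos.2 (by positivity)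
  refine ⟨ENNReal.ofReal (Real.pi ^ ((m : ℝ) / 2)) * I,
    ENNReal.mul_ne_top ENNReal.ofReal_ne_top hI,
    (ENNReal.Tendsto.const_mul (hlim.comp hscale) (Or.inr ENNReal.ofReal_ne_top)).congr' ?_⟩
  filter_upwards [hpos] with d hd
  exact (lintegral_smoothed_mul h.le hd.1 hd.2).symm

theorem lintegral_smoothed_sub_sq_add [IsFiniteMeasure μ] (hδ : 0 < δ) (hε : 0 < ε) :
    ∫⁻ p, ENNReal.ofReal ((smoothed m δ μ p - smoothed m ε μ p) ^ 2) ∂bundleMeasure n m +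
        2 * ∫⁻ p, ENNReal.ofReal (smoothed m δ μ p * smoothed m ε μ p) ∂bundleMeasure n m =
      ∫⁻ p, ENNReal.ofReal (smoothed m δ μ p * smoothed m δ μ p) ∂bundleMeasure n m +
        ∫⁻ p, ENNReal.ofReal (smoothed m ε μ p * smoothed m ε μ p) ∂bundleMeasure n m := by
  rw [← lintegral_const_mul _ (by fun_prop), ← lintegral_add_left (by fun_prop),
    ← lintegral_add_left (by fun_prop)]
  refine lintegral_congr fun p => ?_
  have hδp := smoothed_nonneg (μ := μ) hδ p
  have hεp := smoothed_nonneg (μ := μ) hε p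
  rw [← ENNReal.ofReal_ofNat 2, ← ENNReal.ofReal_mul zero_le_two,
    ← ENNReal.ofReal_add (sq_nonneg _) (by positivity),
    ← ENNReal.ofReal_add (by positivity) (by positivity)]
  congr 1
  ring

theorem tendsto_lintegral_smoothed_sub_sq [IsFiniteMeasure μ] [NullSingletonClass μ] (h : m < n)
    (hE : rieszEnergy m μ ≠ ∞) :
    Tendsto (fun d : ℝ × ℝ => ∫⁻ p, ENNReal.ofReal ((smoothed m d.1 μ p - smoothed m d.2 μ p) ^ 2)
      ∂bundleMeasure n m) (𝓝[>] 0 ×ˢ 𝓝[>] 0) (𝓝 0) := by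
  obtain ⟨Λ, hΛ, hlim⟩ := exists_tendsto_lintegral_smoothed_mul h hE
  have hfst := hlim.comp ((tendsto_fst (g := 𝓝[>] (0 : ℝ))).prodMk tendsto_fst)
  have hsnd := hlim.comp ((tendsto_snd (f := 𝓝[>] (0 : ℝ))).prodMk tendsto_snd)
  have hsub := ENNReal.Tendsto.sub (hfst.add hsnd)
    (ENNReal.Tendsto.const_mul (a := 2) hlim (Or.inr (by simp))) (Or.inl (by simp [hΛ]))
  rw [← two_mul, tsub_self] at hsub
  refine hsub.congr' ?_
  filter_upwards [hlim.eventually_ne hΛ,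
    (eventually_mem_nhdsWithin (a := (0 : ℝ)) (s := Ioi 0)).prod_mk eventually_mem_nhdsWithin]
    with d hfin hd
  exact (ENNReal.eq_sub_of_add_eq (ENNReal.mul_ne_top (by simp) hfin)
    (lintegral_smoothed_sub_sq_add hd.1 hd.2)).symm

end Smoothed

section Potential

variable {α : Type*} {m : ℕ} {τ R : ℝ} {d : α → ℝ}

theorem ofReal_inv_pow_le_tsum (hR : 0 < R) (hd0 : ∀ a, 0 ≤ d a) {a : α} (ha : d a ≤ R) :
    ENNReal.ofReal (d a ^ m)⁻¹ ≤ ∑' l : ℕ, ENNReal.ofReal ((R * (1 / 2) ^ (l + 1)) ^ m)⁻¹ *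
      {a | d a ≤ R * (1 / 2) ^ l}.indicator 1 a := by
  have hterm {l : ℕ} (hl : d a ≤ R * (1 / 2) ^ l) :
      ENNReal.ofReal ((R * (1 / 2) ^ (l + 1)) ^ m)⁻¹ ≤
        ∑' l : ℕ, ENNReal.ofReal ((R * (1 / 2) ^ (l + 1)) ^ m)⁻¹ *
          {a | d a ≤ R * (1 / 2) ^ l}.indicator 1 a := by
    refine le_trans ?_ (ENNReal.le_tsum l)
    rw [indicator_of_mem (show a ∈ {a | d a ≤ R * (1 / 2) ^ l} from hl), Pi.one_apply, mul_one]
  rcases (hd0 a).eq_or_lt with hzero | hpos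
  · rcases Nat.eq_zero_or_pos m with rfl | hm
    · simpa using hterm (l := 0) (by simpa using ha)
    · simp [← hzero, zero_pow hm.ne']
  · obtain ⟨l, hlower, hupper⟩ := exists_nat_pow_near_of_lt_one (x := d a / R) (y := 1 / 2)
      (by positivity) ((div_le_one hR).2 ha) (by norm_num) (by norm_num)
    rw [lt_div_iff₀' hR] at hlower
    rw [div_le_iff₀' hR] at hupper
    refine le_trans (ENNReal.ofReal_le_ofReal ?_) (hterm hupper)
    gcongr

/-- The constant in the bound of `m`-potentials by the growth exponent `τ`. -/
def potentialConst (m : ℕ) (τ : ℝ) : ℝ :=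
  2 ^ m * (1 - (1 / 2) ^ (τ - m))⁻¹

theorem half_rpow_lt_one {x : ℝ} (hx : 0 < x) : (1 / 2 : ℝ) ^ x < 1 :=
  Real.rpow_lt_one (by norm_num) (by norm_num) hx

theorem potentialConst_pos (hτ : (m : ℝ) < τ) : 0 < potentialConst m τ :=
  mul_pos (by positivity) (inv_pos.2 (sub_pos.2 (half_rpow_lt_one (sub_pos.2 hτ))))

theorem inv_pow_mul_rpow_half (m : ℕ) (τ : ℝ) (hR : 0 < R) (l : ℕ) :
    ((R * (1 / 2) ^ (l + 1)) ^ m)⁻¹ * (R * (1 / 2) ^ l) ^ τ =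
      2 ^ m * R ^ (τ - m) * ((1 / 2) ^ (τ - m)) ^ l := by
  set ρ := R * (1 / 2) ^ l with hρ
  have hρ0 : 0 < ρ := by positivity
  have hsplit : ρ ^ τ = ρ ^ m * ρ ^ (τ - m) := by
    rw [← Real.rpow_natCast, ← Real.rpow_add hρ0, add_sub_cancel]
  have hpower : ρ ^ (τ - m) = R ^ (τ - m) * ((1 / 2) ^ (τ - m)) ^ l := by
    rw [hρ, Real.mul_rpow hR.le (by positivity), Real.rpow_pow_comm (by norm_num)]
  rw [show R * (1 / 2) ^ (l + 1) = ρ / 2 by rw [hρ]; ring, div_pow, hsplit, hpower]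
  field_simp

theorem lintegral_inv_pow_le_of_growth [MeasurableSpace α] {ν : Measure α} {C : ℝ}
    (hτ : (m : ℝ) < τ) (hC : 0 ≤ C) (hR : 0 < R) (hd : Measurable d) (hd0 : ∀ a, 0 ≤ d a)
    (hdR : ∀ᵐ a ∂ν, d a ≤ R)
    (hν : ∀ r, 0 < r → r ≤ R → ν {a | d a ≤ r} ≤ ENNReal.ofReal (C * r ^ τ)) :
    ∫⁻ a, ENNReal.ofReal (d a ^ m)⁻¹ ∂ν ≤
      ENNReal.ofReal (potentialConst m τ * C * R ^ (τ - m)) := by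
  set ρ : ℕ → ℝ := fun l => R * (1 / 2) ^ l
  have hρ0 (l : ℕ) : 0 < ρ l := by positivity
  have hρR (l : ℕ) : ρ l ≤ R :=
    mul_le_of_le_one_right hR.le (pow_le_one₀ (by norm_num) (by norm_num))
  have hmeas (l : ℕ) : MeasurableSet {a | d a ≤ ρ l} := measurableSet_le hd measurable_const
  have hq : (1 / 2 : ℝ) ^ (τ - m) < 1 := half_rpow_lt_one (sub_pos.2 hτ)
  calc ∫⁻ a, ENNReal.ofReal (d a ^ m)⁻¹ ∂ν
      ≤ ∫⁻ a, ∑' l, ENNReal.ofReal (ρ (l + 1) ^ m)⁻¹ * {a | d a ≤ ρ l}.indicator 1 a ∂ν :=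
        lintegral_mono_ae (hdR.mono fun a ha => ofReal_inv_pow_le_tsum hR hd0 ha)
    _ = ∑' l, ENNReal.ofReal (ρ (l + 1) ^ m)⁻¹ * ν {a | d a ≤ ρ l} := by
        rw [lintegral_tsum fun l =>
          ((measurable_one.indicator (hmeas l)).const_mul _).aemeasurable]
        refine tsum_congr fun l => ?_
        rw [lintegral_const_mul _ (measurable_one.indicator (hmeas l)),
          lintegral_indicator_one (hmeas l)]
    _ ≤ ∑' l, ENNReal.ofReal (C * (2 ^ m * R ^ (τ - m)) * ((1 / 2) ^ (τ - m)) ^ l) := by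
        refine ENNReal.tsum_le_tsum fun l =>
          (mul_le_mul_right (hν _ (hρ0 l) (hρR l)) _).trans_eq ?_
        rw [← ENNReal.ofReal_mul (inv_nonneg.2 (pow_nonneg (hρ0 _).le m)), mul_left_comm,
          inv_pow_mul_rpow_half m τ hR, mul_assoc C]
    _ = ENNReal.ofReal (potentialConst m τ * C * R ^ (τ - m)) := by
        rw [← ENNReal.ofReal_tsum_of_nonneg (fun l => by positivity)
          ((summable_geometric_of_lt_one (by positivity) hq).mul_left _), tsum_mul_left,
          tsum_geometric_of_lt_one (by positivity) hq, potentialConst]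
        congr 1
        ring

end Potential

/-! ### Hausdorff content and Frostman measures -/

section SaturatedWeight

variable {ι κ : Type*}

theorem isCompact_setOf_sum_le [Finite ι] (S : κ → Finset ι) (c : κ → ℝ)
    (hcov : ∀ x, ∃ k, x ∈ S k) :
    IsCompact {w : ι → ℝ | (∀ x, 0 ≤ w x) ∧ ∀ k, ∑ x ∈ S k, w x ≤ c k} := by
  choose k hk using hcov
  have := Fintype.ofFinite ι
  refine Metric.isCompact_of_isClosed_isBounded ?_ ?_
  · simp only [ofPred_and, ofPred_forall]
    exact (isClosed_iInter fun x => isClosed_le (by fun_prop) (by fun_prop)).inter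
      (isClosed_iInter fun k => isClosed_le (by fun_prop) (by fun_prop))
  · refine (Metric.isBounded_Icc (0 : ι → ℝ) fun x => c (k x)).subset ?_
    rintro w ⟨hw0, hwc⟩
    exact ⟨hw0, fun x => (Finset.single_le_sum (fun y _ => hw0 y) (hk x)).trans (hwc (k x))⟩

theorem exists_pos_add_le_of_lt [Finite κ] {p : κ → Prop} {a c : κ → ℝ}
    (h : ∀ k, p k → a k < c k) : ∃ ε > 0, ∀ k, p k → a k + ε ≤ c k := by
  have hev : ∀ᶠ ε in 𝓝[>] (0 : ℝ), ∀ k, p k → a k + ε ≤ c k := by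
    refine eventually_all.2 fun k => eventually_imp_distrib_left.2 fun hk => ?_
    filter_upwards [Ioo_mem_nhdsGT (sub_pos.2 (h k hk))] with ε hε
    linarith [hε.2]
  obtain ⟨ε, hε, hε0⟩ := (hev.and eventually_mem_nhdsWithin).exists
  exact ⟨ε, hε0, hε⟩

theorem exists_saturated_weight [Finite ι] [Finite κ] (S : κ → Finset ι) {c : κ → ℝ}
    (hc : ∀ k, 0 ≤ c k) (hcov : ∀ x, ∃ k, x ∈ S k) :
    ∃ w : ι → ℝ, (∀ x, 0 ≤ w x) ∧ (∀ k, ∑ x ∈ S k, w x ≤ c k) ∧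
      ∀ x, ∃ k, x ∈ S k ∧ ∑ y ∈ S k, w y = c k := by
  classical
  have := Fintype.ofFinite ι
  obtain ⟨w, ⟨hw0, hwc⟩, hmax⟩ := (isCompact_setOf_sum_le S c hcov).exists_isMaxOn
    ⟨0, fun _ => le_rfl, fun k => by simpa using hc k⟩ (f := fun w => ∑ x, w x) (by fun_prop)
  refine ⟨w, hw0, hwc, fun x => ?_⟩
  by_contra! hunsat
  obtain ⟨ε, hε, hslack⟩ := exists_pos_add_le_of_lt (p := fun k => x ∈ S k)
    (a := fun k => ∑ y ∈ S k, w y) fun k hk => (hwc k).lt_of_ne (hunsat k hk)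
  have hsum (s : Finset ι) :
      ∑ y ∈ s, (w + Pi.single x ε : ι → ℝ) y = ∑ y ∈ s, w y + if x ∈ s then ε else 0 := by
    simp only [Pi.add_apply, Finset.sum_add_distrib, Pi.single_apply, Finset.sum_ite_eq']
  have hadm : w + Pi.single x ε ∈
      {w : ι → ℝ | (∀ x, 0 ≤ w x) ∧ ∀ k, ∑ x ∈ S k, w x ≤ c k} := by
    refine ⟨fun y => add_nonneg (hw0 y) ?_, fun k => ?_⟩
    · rw [Pi.single_apply]
      split_ifs
      exacts [hε.le, le_rfl]
    rw [hsum]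
    split_ifs with hk
    · exact hslack k hk
    · simpa using hwc k
  have hle : ∑ y, (w + Pi.single x ε : ι → ℝ) y ≤ ∑ y, w y := hmax hadm
  rw [hsum, if_pos (Finset.mem_univ x)] at hle
  linarith

end SaturatedWeight

section Content

variable {X : Type*}

/-- The `τ`-dimensional Hausdorff content: the infimum of `∑ (diam Uᵢ) ^ τ` over all countable
covers, with no restriction on the diameters. -/
def hausdorffContent [EMetricSpace X] (τ : ℝ) : OuterMeasure X :=
  OuterMeasure.mkMetric'.pre (fun s => Metric.ediam s ^ τ) ∞

theorem hausdorffContent_closedBall_le [MetricSpace X] {τ : ℝ} (hτ : 0 ≤ τ) (x : X) {r : ℝ}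
    (hr : 0 ≤ r) : hausdorffContent τ (Metric.closedBall x r) ≤ ENNReal.ofReal ((2 * r) ^ τ) := by
  refine (OuterMeasure.mkMetric'.pre_le le_top).trans ?_
  rw [← ENNReal.ofReal_rpow_of_nonneg (by positivity) hτ]
  refine ENNReal.rpow_le_rpow (Metric.ediam_le fun a ha b hb => ?_) hτ
  rw [edist_dist]
  refine ENNReal.ofReal_le_ofReal ((dist_triangle_right a b x).trans ?_)
  linarith [Metric.mem_closedBall.1 ha, Metric.mem_closedBall.1 hb]

theorem hausdorffMeasure_eq_zero_of_hausdorffContent_eq_zero [EMetricSpace X] [MeasurableSpace X]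
    [BorelSpace X] {τ : ℝ} (hτ : 0 < τ) {S : Set X} (h : hausdorffContent τ S = 0) :
    Measure.hausdorffMeasure τ S = 0 := by
  rw [Measure.hausdorffMeasure_apply, ← nonpos_iff_eq_zero]
  refine iSup₂_le fun r hr => le_of_forall_pos_le_add fun ε hε => ?_
  rw [zero_add]
  -- Every member of a cover of small total weight has small diameter.
  have hlt : hausdorffContent τ S < min ε (r ^ τ) := by
    rw [h]
    exact lt_min hε (ENNReal.rpow_pos_of_nonneg hr hτ.le)
  unfold hausdorffContent OuterMeasure.mkMetric'.pre at hlt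
  rw [OuterMeasure.boundedBy_apply] at hlt
  simp only [iInf_lt_iff] at hlt
  obtain ⟨t, hSt, ht⟩ := hlt
  have hweight (i : ℕ) : (⨆ _ : (t i).Nonempty, Metric.ediam (t i) ^ τ) ≤
      ⨆ _ : (t i).Nonempty,
        extend (fun s (_ : Metric.ediam s ≤ ∞) => Metric.ediam s ^ τ) (t i) :=
    iSup_mono fun _ => le_iInf fun _ => le_rfl
  refine iInf₂_le_of_le t hSt (iInf_le_of_le (fun i => ?_) ?_)
  · rcases (t i).eq_empty_or_nonempty with hempty | hne
    · simp [hempty]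
    · refine (ENNReal.rpow_le_rpow_iff hτ).1 ?_
      calc Metric.ediam (t i) ^ τ
          ≤ ⨆ _ : (t i).Nonempty, Metric.ediam (t i) ^ τ :=
            le_iSup (fun _ : (t i).Nonempty => Metric.ediam (t i) ^ τ) hne
        _ ≤ _ := (hweight i).trans (ENNReal.le_tsum i)
        _ ≤ r ^ τ := ht.le.trans (min_le_right _ _)
  · exact (ENNReal.tsum_le_tsum hweight).trans (ht.le.trans (min_le_left _ _))

end Content

section DiscreteFrostman

variable {X ι : Type*} {τ ρ : ℝ}

theorem exists_dyadic_radius {D r : ℝ} {L : ℕ} (hρ : 0 < ρ) (hL : D ≤ 2 ^ L * ρ) (hr : ρ ≤ r) :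
    ∃ k : Fin (L + 1), 2 ^ (k : ℕ) * ρ ≤ 2 * r ∧ ∀ d ≤ D, d ≤ r → d ≤ 2 ^ (k : ℕ) * ρ := by
  obtain ⟨l, hlower, hupper⟩ := exists_nat_pow_near ((one_le_div hρ).2 hr) (one_lt_two (α := ℝ))
  rw [le_div_iff₀ hρ] at hlower
  rw [div_lt_iff₀ hρ] at hupper
  by_cases hlL : l + 1 ≤ L
  · refine ⟨⟨l + 1, by lia⟩, ?_, fun d _ hdr => hdr.trans hupper.le⟩
    rw [pow_succ]
    linarith
  · refine ⟨Fin.last L, ?_, fun d hdD _ => hdD.trans hL⟩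
    have hpow : (2 : ℝ) ^ L ≤ 2 ^ l := pow_le_pow_right₀ one_le_two (by lia)
    rw [Fin.val_last]
    nlinarith

theorem exists_ball_saturating_weight [MetricSpace X] [Fintype ι] (p : ι → X) (hτ : 0 ≤ τ)
    (hρ : 0 < ρ) :
    ∃ w : ι → ℝ, (∀ x, 0 ≤ w x) ∧
      (∀ y r, ρ ≤ r → ∑ z with dist (p z) (p y) ≤ r, w z ≤ (2 * r) ^ τ) ∧
      ∀ x, ∃ y r, ρ ≤ r ∧ dist (p x) (p y) ≤ r ∧ ∑ z with dist (p z) (p y) ≤ r, w z = r ^ τ := by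
  obtain ⟨D, hD⟩ := (finite_range fun z : ι × ι => dist (p z.1) (p z.2)).bddAbove
  replace hD (x y : ι) : dist (p x) (p y) ≤ D := hD ⟨(x, y), rfl⟩
  obtain ⟨L, hL⟩ := pow_unbounded_of_one_lt (D / ρ) (one_lt_two (α := ℝ))
  have hDL : D ≤ 2 ^ L * ρ := ((div_lt_iff₀ hρ).1 hL).le
  let rad (k : ι × Fin (L + 1)) : ℝ := 2 ^ (k.2 : ℕ) * ρ
  have hrad0 (k) : 0 ≤ rad k := by positivity
  obtain ⟨w, hw0, hwrad, hsat⟩ := exists_saturated_weight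
    (fun k => Finset.univ.filter fun z => dist (p z) (p k.1) ≤ rad k)
    (c := fun k => rad k ^ τ) (fun k => Real.rpow_nonneg (hrad0 k) τ)
    (fun x => ⟨(x, 0), by simpa using hrad0 (x, 0)⟩)
  refine ⟨w, hw0, fun y r hr => ?_, fun x => ?_⟩
  · obtain ⟨k, hkr, hk⟩ := exists_dyadic_radius hρ hDL hr
    calc ∑ z with dist (p z) (p y) ≤ r, w z
        ≤ ∑ z with dist (p z) (p y) ≤ rad (y, k), w z :=
          Finset.sum_le_sum_of_subset_of_nonneg
            (Finset.monotone_filter_right _ fun z _ hz => hk _ (hD z y) hz) fun z _ _ => hw0 z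
      _ ≤ rad (y, k) ^ τ := hwrad (y, k)
      _ ≤ (2 * r) ^ τ := Real.rpow_le_rpow (hrad0 _) hkr hτ
  · obtain ⟨k, hxk, hk⟩ := hsat x
    exact ⟨k.1, rad k, le_mul_of_one_le_left hρ.le (one_le_pow₀ one_le_two),
      (Finset.mem_filter.1 hxk).2, hk⟩

theorem hausdorffContent_le_of_ball_saturated [MetricSpace X] [Fintype ι] {p : ι → X} {w : ι → ℝ}
    (hτ : 0 ≤ τ) (hρ : 0 ≤ ρ) (hw0 : ∀ x, 0 ≤ w x)
    (hsat : ∀ x, ∃ y r, ρ ≤ r ∧ dist (p x) (p y) ≤ r ∧ ∑ z with dist (p z) (p y) ≤ r, w z = r ^ τ)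
    {S : Set X} (hS : ∀ s ∈ S, ∃ x, dist s (p x) ≤ ρ) :
    hausdorffContent τ S ≤ ENNReal.ofReal (10 ^ τ * ∑ x, w x) := by
  classical
  choose c r hρr hcr hcap using hsat
  have hr0 (x : ι) : 0 ≤ r x := hρ.trans (hρr x)
  obtain ⟨R, hR⟩ := (finite_range r).bddAbove
  obtain ⟨u, -, hdisj, hcover⟩ :=
    Vitali.exists_disjoint_subfamily_covering_enlargement_closedBall univ (fun x => p (c x)) r R
      (fun x _ => hR ⟨x, rfl⟩) 4 (by norm_num)
  have hSu : S ⊆ ⋃ x ∈ u.toFinset, Metric.closedBall (p (c x)) (5 * r x) := by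
    intro s hs
    obtain ⟨x, hsx⟩ := hS s hs
    obtain ⟨b, hb, hxb⟩ := hcover x (mem_univ x)
    have hpb : dist (p x) (p (c b)) ≤ 4 * r b := hxb (Metric.mem_closedBall.2 (hcr x))
    refine mem_iUnion₂.2 ⟨b, mem_toFinset.2 hb, Metric.mem_closedBall.2 ?_⟩
    linarith [dist_triangle s (p x) (p (c b)), hρr b]
  have hpairwise : (u.toFinset : Set ι).PairwiseDisjoint
      fun x => Finset.univ.filter fun z => dist (p z) (p (c x)) ≤ r x := by
    intro x hx y hy hxy
    refine Finset.disjoint_left.2 fun z hzx hzy => ?_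
    exact Set.disjoint_left.1 (hdisj (mem_toFinset.1 hx) (mem_toFinset.1 hy) hxy)
      (Finset.mem_filter.1 hzx).2 (Finset.mem_filter.1 hzy).2
  have hball (x : ι) : hausdorffContent τ (Metric.closedBall (p (c x)) (5 * r x)) ≤
      ENNReal.ofReal (10 ^ τ * ∑ z with dist (p z) (p (c x)) ≤ r x, w z) := by
    rw [hcap, ← Real.mul_rpow (by norm_num) (hr0 x), show 10 * r x = 2 * (5 * r x) by ring]
    exact hausdorffContent_closedBall_le hτ _ (mul_nonneg (by norm_num) (hr0 x))
  calc hausdorffContent τ S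
      ≤ ∑ x ∈ u.toFinset, hausdorffContent τ (Metric.closedBall (p (c x)) (5 * r x)) :=
        (measure_mono hSu).trans (measure_biUnion_finset_le _ _)
    _ ≤ ∑ x ∈ u.toFinset, ENNReal.ofReal (10 ^ τ * ∑ z with dist (p z) (p (c x)) ≤ r x, w z) :=
        Finset.sum_le_sum fun x _ => hball x
    _ = ENNReal.ofReal (10 ^ τ * ∑ x ∈ u.toFinset, ∑ z with dist (p z) (p (c x)) ≤ r x, w z) := by
        rw [Finset.mul_sum, ENNReal.ofReal_sum_of_nonneg fun x _ =>
          mul_nonneg (by positivity) (Finset.sum_nonneg fun z _ => hw0 z)]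
    _ ≤ ENNReal.ofReal (10 ^ τ * ∑ x, w x) := by
        rw [← Finset.sum_biUnion hpairwise]
        gcongr
        · exact fun x _ _ => hw0 x
        · exact Finset.subset_univ _

theorem sum_ofReal_smul_dirac_apply [MeasurableSpace X] [Fintype ι] (p : ι → X) {w : ι → ℝ}
    (hw0 : ∀ x, 0 ≤ w x) {A : Set X} [DecidablePred (· ∈ A)] (hA : MeasurableSet A) :
    (∑ x, ENNReal.ofReal (w x) • Measure.dirac (p x)) A =
      ENNReal.ofReal (∑ x with p x ∈ A, w x) := by
  rw [ENNReal.ofReal_sum_of_nonneg fun x _ => hw0 x, Finset.sum_filter, Measure.finsetSum_apply]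
  refine Finset.sum_congr rfl fun x _ => ?_
  rw [Measure.smul_apply, Measure.dirac_apply' _ hA, indicator_apply]
  split_ifs <;> simp

theorem exists_measure_growth_above_scale [MetricSpace X] [MeasurableSpace X] [BorelSpace X]
    {S : Set X} (hS : TotallyBounded S) (hτ : 0 ≤ τ) (hρ : 0 < ρ) :
    ∃ ν : Measure X, IsFiniteMeasure ν ∧ (∀ᵐ y ∂ν, y ∈ S) ∧
      (∀ᵐ y ∂ν, ∀ r, ρ ≤ r → ν (Metric.closedBall y r) ≤ ENNReal.ofReal ((2 * r) ^ τ)) ∧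
      hausdorffContent τ S ≤ ENNReal.ofReal (10 ^ τ) * ν univ := by
  classical
  obtain ⟨t, htS, htfin, htcov⟩ := Metric.finite_approx_of_totallyBounded hS ρ hρ
  have := htfin.fintype
  obtain ⟨w, hw0, hgrowth, hsat⟩ := exists_ball_saturating_weight ((↑) : t → X) hτ hρ
  set ν : Measure X := ∑ x : t, ENNReal.ofReal (w x) • Measure.dirac (x : X)
  have hν {A : Set X} (hA : MeasurableSet A) :
      ν A = ENNReal.ofReal (∑ x : ↥t with ↑x ∈ A, w x) := sum_ofReal_smul_dirac_apply _ hw0 hA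
  have hνuniv : ν univ = ENNReal.ofReal (∑ x, w x) := by simpa using hν MeasurableSet.univ
  have hνt : ∀ᵐ y ∂ν, y ∈ t := by
    rw [ae_iff, show {y | y ∉ t} = tᶜ from rfl, hν htfin.measurableSet.compl]
    simp
  refine ⟨ν, ⟨hνuniv ▸ ENNReal.ofReal_lt_top⟩, hνt.mono fun y hy => htS hy, ?_, ?_⟩
  · filter_upwards [hνt] with y hy r hr
    rw [hν Metric.isClosed_closedBall.measurableSet]
    exact ENNReal.ofReal_le_ofReal (hgrowth ⟨y, hy⟩ r hr)
  · rw [hνuniv, ← ENNReal.ofReal_mul (by positivity)]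
    refine hausdorffContent_le_of_ball_saturated hτ hρ.le hw0 hsat fun s hs => ?_
    obtain ⟨x, hx, hsx⟩ := mem_iUnion₂.1 (htcov hs)
    exact ⟨⟨x, hx⟩, (Metric.mem_ball.1 hsx).le⟩

end DiscreteFrostman

section GaussianAverage

variable {F : Type*} [NormedAddCommGroup F] {m : ℕ} {ρ : ℝ}

theorem one_le_exp_mul_gaussKernel (hρ : 0 < ρ) {v : F} (hv : ‖v‖ ≤ ρ) :
    1 ≤ Real.exp 1 * ρ ^ m * gaussKernel m ρ v := by
  have hratio : ‖v‖ ^ 2 / ρ ^ 2 ≤ 1 := by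
    rw [div_le_one (by positivity)]
    gcongr
  calc 1 ≤ Real.exp (1 + -(‖v‖ ^ 2 / ρ ^ 2)) := Real.one_le_exp (by linarith)
    _ = Real.exp 1 * ρ ^ m * gaussKernel m ρ v := by
      rw [gaussKernel, Real.exp_add]
      field_simp

theorem le_add_inv_measure_mul_setLIntegral {α : Type*} [MeasurableSpace α] {μ : Measure α}
    {s : Set α} (hs : MeasurableSet s) (hs0 : μ s ≠ 0) (hs1 : μ s ≠ ∞) {a b : ℝ≥0∞} {g : α → ℝ≥0∞}
    (h : ∀ u ∈ s, a ≤ b + g u) : a ≤ b + (μ s)⁻¹ * ∫⁻ u in s, g u ∂μ := by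
  calc a = ⨍⁻ _ in s, a ∂μ := (setLAverage_const hs0 hs1 a).symm
    _ ≤ ⨍⁻ u in s, (b + g u) ∂μ := by
      rw [setLAverage_eq, setLAverage_eq]
      gcongr 1
      exact setLIntegral_mono' hs h
    _ = b + (μ s)⁻¹ * ∫⁻ u in s, g u ∂μ := by
      rw [setLAverage_eq, lintegral_add_left measurable_const, setLIntegral_const, ENNReal.add_div,
        ENNReal.mul_div_cancel_right hs0 hs1, div_eq_mul_inv, mul_comm (μ s)⁻¹]

variable [InnerProductSpace ℝ F] [FiniteDimensional ℝ F] [MeasurableSpace F] [BorelSpace F]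

variable (F) in
/-- The constant comparing averages over balls with Gaussian averages. -/
def gaussAverageConst : ℝ :=
  Real.exp 1 / volume.real (Metric.ball (0 : F) 1)

theorem ofReal_le_add_lintegral_gaussKernel (hF : Module.finrank ℝ F = m) {f : F → ℝ}
    (hf0 : ∀ u, 0 ≤ f u) (a : F) {ε : ℝ} (hρ : 0 < ρ) (hε : 0 ≤ ε)
    (hosc : ∀ u, dist u a ≤ ρ → f a ≤ f u + ε) :
    ENNReal.ofReal (f a) ≤ ENNReal.ofReal ε + ENNReal.ofReal (gaussAverageConst F) *
      ∫⁻ u, ENNReal.ofReal (f u * gaussKernel m ρ (a - u)) := by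
  have hball : volume (Metric.closedBall a ρ) =
      ENNReal.ofReal (ρ ^ m * volume.real (Metric.ball (0 : F) 1)) := by
    rw [← hF, ← Measure.addHaar_real_closedBall _ _ hρ.le,
      ofReal_measureReal measure_closedBall_lt_top.ne]
  have hunit : 0 < volume.real (Metric.ball (0 : F) 1) :=
    ENNReal.toReal_pos (Metric.measure_ball_pos volume 0 one_pos).ne' measure_ball_lt_top.ne
  have hpoint : ∀ u ∈ Metric.closedBall a ρ, ENNReal.ofReal (f a) ≤ ENNReal.ofReal ε +
      ENNReal.ofReal (Real.exp 1 * ρ ^ m) * ENNReal.ofReal (f u * gaussKernel m ρ (a - u)) := by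
    intro u hu
    have hfu := hf0 u
    have hkernel : 1 ≤ Real.exp 1 * ρ ^ m * gaussKernel m ρ (a - u) :=
      one_le_exp_mul_gaussKernel hρ (by rwa [← dist_eq_norm, dist_comm])
    have := gaussKernel_nonneg (m := m) hρ (a - u)
    rw [← ENNReal.ofReal_mul (by positivity), ← ENNReal.ofReal_add hε (by positivity)]
    refine ENNReal.ofReal_le_ofReal ((hosc u hu).trans ?_)
    rw [add_comm, mul_left_comm]
    gcongr
    exact le_mul_of_one_le_right hfu hkernel
  calc ENNReal.ofReal (f a)
      ≤ ENNReal.ofReal ε + (volume (Metric.closedBall a ρ))⁻¹ * ∫⁻ u in Metric.closedBall a ρ,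
          ENNReal.ofReal (Real.exp 1 * ρ ^ m) * ENNReal.ofReal (f u * gaussKernel m ρ (a - u)) :=
        le_add_inv_measure_mul_setLIntegral Metric.isClosed_closedBall.measurableSet
          (Metric.measure_closedBall_pos _ _ hρ).ne' measure_closedBall_lt_top.ne hpoint
    _ ≤ ENNReal.ofReal ε + (volume (Metric.closedBall a ρ))⁻¹ *
          (ENNReal.ofReal (Real.exp 1 * ρ ^ m) *
            ∫⁻ u, ENNReal.ofReal (f u * gaussKernel m ρ (a - u))) := by
        rw [lintegral_const_mul' _ _ ENNReal.ofReal_ne_top]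
        gcongr
        exact Measure.restrict_le_self
    _ = ENNReal.ofReal ε + ENNReal.ofReal (gaussAverageConst F) *
          ∫⁻ u, ENNReal.ofReal (f u * gaussKernel m ρ (a - u)) := by
        rw [← mul_assoc, hball, ← ENNReal.ofReal_inv_of_pos (by positivity),
          ← ENNReal.ofReal_mul (by positivity), gaussAverageConst]
        congr 3
        field_simp

end GaussianAverage

section CapacitaryEstimate

variable {n m : ℕ} {τ R ρ : ℝ}

theorem exists_avgKernel_le_max (h : m < n) : ∃ C : ℝ≥0∞, C ≠ ∞ ∧
    ∀ ρ σ : ℝ, 0 < ρ → ρ ≤ σ → ∀ z : E n,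
      avgKernel n m σ z ≤ C * ENNReal.ofReal (max ‖z‖ ρ ^ m)⁻¹ := by
  obtain ⟨C, hC, hle⟩ := exists_avgKernel_le h
  refine ⟨max C 1, by simp [hC], fun ρ σ hρ hσ z => ?_⟩
  rcases le_total ρ ‖z‖ with hz | hz
  · rw [max_eq_left hz]
    refine (hle σ (hρ.trans_le hσ) z (norm_pos_iff.1 (hρ.trans_le hz))).trans ?_
    gcongr
    exact le_max_left _ _
  · rw [max_eq_right hz]
    refine (avgKernel_le_inv_pow (hρ.trans_le hσ) z).trans ?_
    refine le_trans ?_ (le_mul_of_one_le_left' (le_max_right _ _))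
    gcongr

theorem lintegral_inv_max_pow_le_of_growth {X : Type*} [PseudoMetricSpace X] [MeasurableSpace X]
    [OpensMeasurableSpace X] [SecondCountableTopology X] {ν : Measure X} (hτ : (m : ℝ) < τ)
    (hρ : 0 < ρ) (hρR : ρ ≤ R) {y : X}
    (hdiam : ∀ᵐ z ∂ν, dist z y ≤ R)
    (hν : ∀ r, ρ ≤ r → ν (Metric.closedBall y r) ≤ ENNReal.ofReal ((2 * r) ^ τ)) :
    ∫⁻ z, ENNReal.ofReal (max (dist z y) ρ ^ m)⁻¹ ∂ν ≤
      ENNReal.ofReal (potentialConst m τ * 2 ^ τ * R ^ (τ - m)) := by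
  refine lintegral_inv_pow_le_of_growth hτ (by positivity) (hρ.trans_le hρR)
    ((measurable_id.dist measurable_const).max measurable_const)
    (fun z => le_max_of_le_right hρ.le) (hdiam.mono fun z hz => max_le hz hρR) fun r hr _ => ?_
  rcases lt_or_ge r ρ with hrρ | hrρ
  · simp [not_le.2 hrρ]
  · rw [← Real.mul_rpow zero_le_two hr.le]
    have hsub : {z | max (dist z y) ρ ≤ r} ⊆ Metric.closedBall y r :=
      fun z hz => (le_max_left _ ρ).trans hz
    exact (measure_mono hsub).trans (hν r hrρ)

theorem exists_lintegral_smoothed_sq_le_of_growth (h : m < n) (hτ : (m : ℝ) < τ) (hR : 0 < R) :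
    ∃ K : ℝ≥0∞, K ≠ ∞ ∧ ∀ (ν : Measure (E n)) [IsFiniteMeasure ν] (ρ : ℝ), 0 < ρ → ρ ≤ 1 →
      (∀ᵐ y ∂ν, y ∈ Metric.closedBall (0 : E n) R) →
      (∀ᵐ y ∂ν, ∀ r, ρ ≤ r → ν (Metric.closedBall y r) ≤ ENNReal.ofReal ((2 * r) ^ τ)) →
      ∫⁻ p, ENNReal.ofReal (smoothed m ρ ν p ^ 2) ∂bundleMeasure n m ≤ K * ν univ := by
  obtain ⟨C, hC, hker⟩ := exists_avgKernel_le_max (n := n) h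
  set P := ENNReal.ofReal (potentialConst m τ * 2 ^ τ * (2 * R + 1) ^ (τ - m))
  refine ⟨ENNReal.ofReal (Real.pi ^ ((m : ℝ) / 2)) * (C * P),
    by finiteness, fun ν _ ρ hρ hρ1 hsupp hgrowth => ?_⟩
  have hσ : ρ ≤ √(ρ ^ 2 + ρ ^ 2) := Real.le_sqrt_of_sq_le (by nlinarith)
  have hinner : ∀ᵐ y ∂ν, ∫⁻ z, avgKernel n m √(ρ ^ 2 + ρ ^ 2) (y - z) ∂ν ≤ C * P := by
    filter_upwards [hsupp, hgrowth] with y hy hgy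
    refine (lintegral_mono fun z => hker ρ _ hρ hσ (y - z)).trans ?_
    rw [lintegral_const_mul C (by fun_prop)]
    gcongr
    simp only [← dist_eq_norm, dist_comm y]
    refine lintegral_inv_max_pow_le_of_growth hτ hρ (by linarith) ?_ hgy
    filter_upwards [hsupp] with z hz
    linarith [dist_triangle_right z y 0, Metric.mem_closedBall.1 hy, Metric.mem_closedBall.1 hz]
  simp only [sq (smoothed m ρ ν _)]
  rw [lintegral_smoothed_mul h.le hρ hρ, lintegral_prod _ (by fun_prop), mul_assoc]
  gcongr
  exact (lintegral_mono_ae hinner).trans_eq (lintegral_const _)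

theorem lintegral_transv_le_add (h : m ≤ n) {f : O n × LastSpace n m → ℝ} (hf : Measurable f)
    (hf0 : ∀ p, 0 ≤ f p) {ε : ℝ} (hρ : 0 < ρ) (hε : 0 ≤ ε)
    (hosc : ∀ g u v, dist u v ≤ ρ → f (g, v) ≤ f (g, u) + ε) (y : E n) :
    ∫⁻ g, ENNReal.ofReal (f (g, transv m g y)) ∂haarO n ≤ ENNReal.ofReal ε +
      ENNReal.ofReal (gaussAverageConst (LastSpace n m)) *
        ∫⁻ p, ENNReal.ofReal (f p * gaussKernel m ρ (transv m p.1 y - p.2)) ∂bundleMeasure n m := by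
  refine (lintegral_mono fun g => ofReal_le_add_lintegral_gaussKernel (finrank_lastSpace h)
    (fun u => hf0 (g, u)) (transv m g y) hρ hε fun u hu => hosc g u _ hu).trans_eq ?_
  rw [lintegral_add_left measurable_const, lintegral_const, measure_univ, mul_one,
    lintegral_const_mul' _ _ ENNReal.ofReal_ne_top, bundleMeasure, lintegral_prod _ (by fun_prop)]

theorem lintegral_lintegral_mul_gaussKernel_transv {ν : Measure (E n)} [IsFiniteMeasure ν]
    {f : O n × LastSpace n m → ℝ} (hf : Measurable f) (hf0 : ∀ p, 0 ≤ f p) (hρ : 0 < ρ) :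
    ∫⁻ y, ∫⁻ p, ENNReal.ofReal (f p * gaussKernel m ρ (transv m p.1 y - p.2)) ∂bundleMeasure n m ∂ν
      = ∫⁻ p, ENNReal.ofReal (f p * smoothed m ρ ν p) ∂bundleMeasure n m := by
  have : SFinite (bundleMeasure n m) := by
    unfold bundleMeasure
    infer_instance
  rw [lintegral_lintegral_swap (Measurable.aemeasurable (by fun_prop))]
  refine lintegral_congr fun p => ?_
  simp only [ENNReal.ofReal_mul (hf0 p), ofReal_smoothed hρ]
  exact lintegral_const_mul' _ _ ENNReal.ofReal_ne_top

theorem sq_lintegral_mul_le {α : Type*} [MeasurableSpace α] {μ : Measure α} {f g : α → ℝ≥0∞}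
    (hf : AEMeasurable f μ) (hg : AEMeasurable g μ) :
    (∫⁻ a, f a * g a ∂μ) ^ 2 ≤ (∫⁻ a, f a ^ 2 ∂μ) * ∫⁻ a, g a ^ 2 ∂μ := by
  have hholder := ENNReal.lintegral_mul_le_Lp_mul_Lq μ Real.HolderConjugate.two_two hf hg
  have hsq (x : ℝ≥0∞) : (x ^ (1 / 2 : ℝ)) ^ 2 = x := by
    rw [← ENNReal.rpow_natCast, ← ENNReal.rpow_mul]
    norm_num
  simp only [ENNReal.rpow_ofNat] at hholder
  calc (∫⁻ a, f a * g a ∂μ) ^ 2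
      ≤ ((∫⁻ a, f a ^ 2 ∂μ) ^ (1 / 2 : ℝ) * (∫⁻ a, g a ^ 2 ∂μ) ^ (1 / 2 : ℝ)) ^ 2 := by
        gcongr
        exact hholder
    _ = (∫⁻ a, f a ^ 2 ∂μ) * ∫⁻ a, g a ^ 2 ∂μ := by rw [mul_pow, hsq, hsq]

theorem le_div_sq_of_mul_le {a c x y B : ℝ≥0∞} (hx : x ≠ ∞) (ha : a ≠ 0) (ha' : a ≠ ∞)
    (hxy : a * x ≤ c * y) (hy : y ^ 2 ≤ B * x) : x ≤ c ^ 2 * B / a ^ 2 := by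
  rcases eq_or_ne x 0 with rfl | hx0
  · exact zero_le
  rw [ENNReal.le_div_iff_mul_le (by simp [ha]) (by simp [ha'])]
  refine (ENNReal.mul_le_mul_iff_left hx0 hx).1 ?_
  calc x * a ^ 2 * x = (a * x) ^ 2 := by ring
    _ ≤ (c * y) ^ 2 := by gcongr
    _ = c ^ 2 * y ^ 2 := mul_pow _ _ _
    _ ≤ c ^ 2 * (B * x) := by gcongr
    _ = c ^ 2 * B * x := by ring

theorem mul_measure_univ_le_lintegral_mul_smoothed (h : m ≤ n) {f : O n × LastSpace n m → ℝ}
    (hf : Measurable f) (hf0 : ∀ p, 0 ≤ f p) {ε a : ℝ} (hρ : 0 < ρ) (hε : 0 ≤ ε) (ha : 0 ≤ a)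
    (hosc : ∀ g u v, dist u v ≤ ρ → f (g, v) ≤ f (g, u) + ε) {ν : Measure (E n)}
    [IsFiniteMeasure ν]
    (hν : ∀ᵐ y ∂ν, ENNReal.ofReal (ε + a) ≤ ∫⁻ g, ENNReal.ofReal (f (g, transv m g y)) ∂haarO n) :
    ENNReal.ofReal a * ν univ ≤ ENNReal.ofReal (gaussAverageConst (LastSpace n m)) *
      ∫⁻ p, ENNReal.ofReal (f p * smoothed m ρ ν p) ∂bundleMeasure n m := by
  rw [← lintegral_lintegral_mul_gaussKernel_transv hf hf0 hρ,
    ← lintegral_const_mul' _ _ ENNReal.ofReal_ne_top, ← lintegral_const]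
  refine lintegral_mono_ae (hν.mono fun y hy => ?_)
  have hy := hy.trans (lintegral_transv_le_add h hf hf0 hρ hε hosc y)
  rwa [ENNReal.ofReal_add hε ha, ENNReal.add_le_add_iff_left ENNReal.ofReal_ne_top] at hy

theorem sq_lintegral_mul_smoothed_le {f : O n × LastSpace n m → ℝ} (hf : Measurable f)
    (hf0 : ∀ p, 0 ≤ f p) (hρ : 0 < ρ) {ν : Measure (E n)} [IsFiniteMeasure ν] :
    (∫⁻ p, ENNReal.ofReal (f p * smoothed m ρ ν p) ∂bundleMeasure n m) ^ 2 ≤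
      (∫⁻ p, ENNReal.ofReal (f p ^ 2) ∂bundleMeasure n m) *
        ∫⁻ p, ENNReal.ofReal (smoothed m ρ ν p ^ 2) ∂bundleMeasure n m := by
  simp only [ENNReal.ofReal_mul (hf0 _), ENNReal.ofReal_pow (hf0 _),
    ENNReal.ofReal_pow (smoothed_nonneg hρ _)]
  exact sq_lintegral_mul_le (by fun_prop) (by fun_prop)

/-- Testing the superlevel set with a Frostman measure at a scale where `f` hardly oscillates
reduces the estimate to the `L²` bound for smoothed projections, by duality. -/
theorem exists_hausdorffContent_superlevel_le (h : m < n) (hτ : (m : ℝ) < τ) (hR : 0 < R) :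
    ∃ M : ℝ≥0∞, M ≠ ∞ ∧ ∀ f : O n × LastSpace n m → ℝ, Measurable f → (∀ p, 0 ≤ f p) →
      UniformEquicontinuous (fun g u => f (g, u)) → ∀ l : ℝ, 0 < l →
      hausdorffContent τ {x | x ∈ Metric.closedBall (0 : E n) R ∧
        ENNReal.ofReal l < ∫⁻ g, ENNReal.ofReal (f (g, transv m g x)) ∂haarO n} ≤
      M / ENNReal.ofReal l ^ 2 * ∫⁻ p, ENNReal.ofReal (f p ^ 2) ∂bundleMeasure n m := by
  obtain ⟨K, hK, hKν⟩ := exists_lintegral_smoothed_sq_le_of_growth h hτ hR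
  set c := ENNReal.ofReal (gaussAverageConst (LastSpace n m))
  refine ⟨ENNReal.ofReal (10 ^ τ) * (4 * c ^ 2 * K), by finiteness, fun f hf hf0 hfu l hl => ?_⟩
  set S := {x | x ∈ Metric.closedBall (0 : E n) R ∧
    ENNReal.ofReal l < ∫⁻ g, ENNReal.ofReal (f (g, transv m g x)) ∂haarO n}
  obtain ⟨η, hη, hosc⟩ := Metric.uniformEquicontinuous_iff.1 hfu (l / 2) (by positivity)
  have hρ : 0 < min (η / 2) 1 := by positivity
  set ρ := min (η / 2) 1
  have hoscρ : ∀ g u v, dist u v ≤ ρ → f (g, v) ≤ f (g, u) + l / 2 := fun g u v huv => by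
    have hclose := hosc u v (by linarith [min_le_left (η / 2) 1]) g
    rw [Real.dist_eq] at hclose
    linarith [(abs_lt.1 hclose).1]
  obtain ⟨ν, hνfin, hνS, hνgrowth, hνcontent⟩ := exists_measure_growth_above_scale
    ((isCompact_closedBall (0 : E n) R).totallyBounded.subset fun x hx => hx.1 : TotallyBounded S)
    ((Nat.cast_nonneg m).trans hτ.le) hρ
  set N := ν univ
  set Φ := ∫⁻ p, ENNReal.ofReal (f p ^ 2) ∂bundleMeasure n m
  have htest := mul_measure_univ_le_lintegral_mul_smoothed h.le hf hf0 hρ (half_pos hl).le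
    (half_pos hl).le hoscρ (hνS.mono fun y hy => (add_halves l).symm ▸ hy.2.le)
  have hdual := (sq_lintegral_mul_smoothed_le (ν := ν) hf hf0 hρ).trans (mul_le_mul_right
    (hKν ν ρ hρ (min_le_right _ _) (hνS.mono fun y hy => hy.1) hνgrowth) Φ)
  have hmass : N ≤ 4 * c ^ 2 * K * Φ / ENNReal.ofReal l ^ 2 := by
    have hhalf : ENNReal.ofReal l ^ 2 = 4 * ENNReal.ofReal (l / 2) ^ 2 := by
      rw [← ENNReal.ofReal_pow hl.le, ← ENNReal.ofReal_pow (by positivity),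
        ← ENNReal.ofReal_ofNat, ← ENNReal.ofReal_mul (by positivity)]
      congr 1
      ring
    have hN := le_div_sq_of_mul_le (measure_ne_top ν univ) (by simpa using hl)
      ENNReal.ofReal_ne_top htest (hdual.trans_eq (by ring : Φ * (K * N) = K * Φ * N))
    rwa [← ENNReal.mul_div_mul_left _ _ four_ne_zero ENNReal.ofNat_ne_top, ← hhalf,
      show 4 * (c ^ 2 * (K * Φ)) = 4 * c ^ 2 * K * Φ by ring] at hN
  calc hausdorffContent τ S ≤ ENNReal.ofReal (10 ^ τ) * N := hνcontent
    _ ≤ ENNReal.ofReal (10 ^ τ) * (4 * c ^ 2 * K * Φ / ENNReal.ofReal l ^ 2) := by gcongr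
    _ = ENNReal.ofReal (10 ^ τ) * (4 * c ^ 2 * K) / ENNReal.ofReal l ^ 2 * Φ := by
        simp only [div_eq_mul_inv]
        ring

end CapacitaryEstimate

/-! ### Densities of Hausdorff measures -/

theorem exists_measurableSet_subset_measure_eq {α : Type*} [MeasurableSpace α] {μ : Measure α}
    {A : Set α} (hA : μ.toOuterMeasure.IsCaratheodory A) (hfin : μ A ≠ ∞) :
    ∃ B ⊆ A, MeasurableSet B ∧ μ B = μ A := by
  have hnull : μ (toMeasurable μ A \ A) = 0 := by
    have hsplit : μ A + μ (toMeasurable μ A \ A) = μ A + 0 := by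
      have := hA (toMeasurable μ A)
      rw [inter_eq_self_of_subset_right (subset_toMeasurable μ A)] at this
      rw [add_zero]
      exact this.symm.trans (measure_toMeasurable A)
    exact (ENNReal.add_right_inj hfin).1 hsplit
  refine ⟨toMeasurable μ A \ toMeasurable μ (toMeasurable μ A \ A), fun x hx => ?_,
    (measurableSet_toMeasurable _ _).diff (measurableSet_toMeasurable _ _), ?_⟩
  · by_contra hxA
    exact hx.2 (subset_toMeasurable μ _ ⟨hx.1, hxA⟩)
  · rw [measure_sdiff_null (by rwa [measure_toMeasurable]), measure_toMeasurable]

theorem exists_isCompact_subset_measure_pos {X : Type*} [TopologicalSpace X] [PolishSpace X]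
    [MeasurableSpace X] [BorelSpace X] {μ : Measure X} {A : Set X}
    (hA : μ.toOuterMeasure.IsCaratheodory A) (hpos : 0 < μ A) (hfin : μ A < ∞) :
    ∃ K ⊆ A, IsCompact K ∧ 0 < μ K := by
  obtain ⟨B, hBA, hB, hμB⟩ := exists_measurableSet_subset_measure_eq hA hfin.ne
  obtain ⟨K, hKB, hK, hμK⟩ :=
    hB.exists_lt_isCompact_of_ne_top (hμB ▸ hfin.ne) (hμB.symm ▸ hpos)
  exact ⟨K, hKB.trans hBA, hK, hμK⟩

theorem exists_cover_of_hausdorffMeasure_lt {X : Type*} [EMetricSpace X] [MeasurableSpace X]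
    [BorelSpace X] {s : ℝ} (hs : 0 < s) {S : Set X} {a : ℝ≥0∞} (h : μH[s] S < a) {r : ℝ≥0∞}
    (hr : 0 < r) :
    ∃ t : ℕ → Set X, S ⊆ ⋃ i, t i ∧ (∀ i, t i ⊆ S) ∧ (∀ i, Metric.ediam (t i) ≤ r) ∧
      ∑' i, Metric.ediam (t i) ^ s < a := by
  rw [Measure.hausdorffMeasure_apply] at h
  have hscale := (le_iSup₂ (f := fun (r : ℝ≥0∞) (_ : 0 < r) => ⨅ (t : ℕ → Set X)
    (_ : S ⊆ ⋃ n, t n) (_ : ∀ n, Metric.ediam (t n) ≤ r),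
      ∑' n, ⨆ _ : (t n).Nonempty, Metric.ediam (t n) ^ s) r hr).trans_lt h
  simp only [iInf_lt_iff] at hscale
  obtain ⟨t, ht, htr, hsum⟩ := hscale
  refine ⟨fun i => t i ∩ S, fun x hx => ?_, fun i => inter_subset_right,
    fun i => (Metric.ediam_mono inter_subset_left).trans (htr i),
    (ENNReal.tsum_le_tsum fun i => ?_).trans_lt hsum⟩
  · obtain ⟨i, hi⟩ := mem_iUnion.1 (ht hx)
    exact mem_iUnion.2 ⟨i, hi, hx⟩
  · rcases (t i).eq_empty_or_nonempty with hempty | hne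
    · simp [hempty, hs]
    · rw [ciSup_pos hne]
      exact ENNReal.rpow_le_rpow (Metric.ediam_mono inter_subset_left) hs.le

section UniformDensity

variable {X : Type*} [PseudoMetricSpace X] [MeasurableSpace X] {s c : ℝ} {ν : Measure X}

theorem isClosed_setOf_measure_ball_le (ν : Measure X) (r : ℝ) (a : ℝ≥0∞) :
    IsClosed {y : X | ν (Metric.ball y r) ≤ a} := by
  rw [← isOpen_compl_iff, isOpen_iff_mem_nhds]
  intro y hy
  have hball : Metric.ball y r = ⋃ k : ℕ, Metric.ball y (r - 1 / ((k : ℝ) + 1)) := by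
    refine subset_antisymm (fun z hz => ?_)
      (iUnion_subset fun k => Metric.ball_subset_ball (sub_le_self _ (by positivity)))
    obtain ⟨k, hk⟩ := exists_nat_one_div_lt (sub_pos.2 (Metric.mem_ball.1 hz))
    exact mem_iUnion.2 ⟨k, Metric.mem_ball.2 (by linarith)⟩
  have hmono : Monotone fun k : ℕ => Metric.ball y (r - 1 / ((k : ℝ) + 1)) := fun k l hkl =>
    Metric.ball_subset_ball (sub_le_sub_left (Nat.one_div_le_one_div hkl) r)
  obtain ⟨k, hk⟩ : ∃ k : ℕ, a < ν (Metric.ball y (r - 1 / ((k : ℝ) + 1))) := by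
    rw [← lt_iSup_iff, ← hmono.measure_iUnion, ← hball]
    exact not_le.1 hy
  filter_upwards [Metric.ball_mem_nhds y (Nat.one_div_pos_of_nat (α := ℝ) (n := k))] with z hz
  refine not_le.2 (hk.trans_le (measure_mono (Metric.ball_subset_ball' ?_)))
  linarith [Metric.mem_ball'.1 hz]

/-- The points at which every ball of radius `r < ε` has `ν`-measure at most `c rˢ`. -/
def uniformDensitySet (ν : Measure X) (s c ε : ℝ) : Set X :=
  {y | ∀ r, 0 < r → r < ε → ν (Metric.ball y r) ≤ ENNReal.ofReal (c * r ^ s)}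

theorem isClosed_uniformDensitySet (ν : Measure X) (s c ε : ℝ) :
    IsClosed (uniformDensitySet ν s c ε) := by
  simp only [uniformDensitySet, ofPred_forall]
  exact isClosed_iInter fun r => isClosed_iInter fun _ => isClosed_iInter fun _ =>
    isClosed_setOf_measure_ball_le ν r _

theorem measure_closedBall_le_of_mem_uniformDensitySet [IsFiniteMeasure ν] (hs : 0 ≤ s)
    (hc : 0 ≤ c) {ε : ℝ} (hε : 0 < ε) {y : X} (hy : y ∈ uniformDensitySet ν s c ε) {r : ℝ}
    (hr : 0 < r) :
    ν (Metric.closedBall y r) ≤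
      ENNReal.ofReal ((c * 2 ^ s + ν.real univ * (2 / ε) ^ s) * r ^ s) := by
  have hsmall : 0 ≤ c * 2 ^ s * r ^ s := by positivity
  have hlarge : 0 ≤ ν.real univ * ((2 / ε) ^ s * r ^ s) := by positivity
  rw [add_mul, mul_assoc (ν.real univ)]
  rcases lt_or_ge (2 * r) ε with h2r | h2r
  · calc ν (Metric.closedBall y r) ≤ ν (Metric.ball y (2 * r)) :=
          measure_mono (Metric.closedBall_subset_ball (by linarith))
      _ ≤ ENNReal.ofReal (c * (2 * r) ^ s) := hy _ (by positivity) h2r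
      _ ≤ _ := ENNReal.ofReal_le_ofReal (by
          rw [Real.mul_rpow zero_le_two hr.le, ← mul_assoc]
          exact le_add_of_nonneg_right hlarge)
  · have hone : 1 ≤ (2 / ε) ^ s * r ^ s := by
      rw [← Real.mul_rpow (by positivity) hr.le]
      refine Real.one_le_rpow ?_ hs
      rwa [div_mul_eq_mul_div, one_le_div hε]
    calc ν (Metric.closedBall y r) ≤ ν univ := measure_mono (subset_univ _)
      _ = ENNReal.ofReal (ν.real univ) := (ofReal_measureReal (measure_ne_top _ _)).symm
      _ ≤ _ := ENNReal.ofReal_le_ofReal ((le_mul_of_one_le_right measureReal_nonneg hone).trans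
          (le_add_of_nonneg_left hsmall))

end UniformDensity

section UpperDensity

variable {X : Type*} [MetricSpace X] [MeasurableSpace X] [BorelSpace X] {s c : ℝ} {ν : Measure X}

theorem exists_countable_closedBall_cover [SecondCountableTopology X] (hc : 0 < c) {Z : Set X}
    {ε : ℝ} (hZ : ∀ y ∈ Z, ∃ r, 0 < r ∧ r < ε ∧
      ENNReal.ofReal (c * r ^ s) < ν (Metric.closedBall y r)) :
    ∃ (u : Set X) (r : X → ℝ), u.Countable ∧ (∀ y ∈ u, 0 < r y ∧ r y < ε) ∧
      (Z ⊆ ⋃ y ∈ u, Metric.closedBall y (4 * r y)) ∧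
      ∑' y : u, ENNReal.ofReal ((8 * r y) ^ s) ≤ ENNReal.ofReal (8 ^ s / c) * ν univ := by
  choose! r hr0 hrε hrν using hZ
  obtain ⟨u, huZ, hdisj, hcov⟩ :=
    Vitali.exists_disjoint_subfamily_covering_enlargement_closedBall Z id r ε
      (fun y hy => (hrε y hy).le) 4 (by norm_num)
  simp only [id_eq] at hdisj hcov
  have hu : u.Countable := hdisj.countable_of_nonempty_interior fun y hy =>
    ⟨y, Metric.ball_subset_interior_closedBall (Metric.mem_ball_self (hr0 y (huZ hy)))⟩
  refine ⟨u, r, hu, fun y hy => ⟨hr0 y (huZ hy), hrε y (huZ hy)⟩, fun y hy => ?_, ?_⟩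
  · obtain ⟨b, hbu, hb⟩ := hcov y hy
    exact mem_iUnion₂.2 ⟨b, hbu, hb (Metric.mem_closedBall_self (hr0 y hy).le)⟩
  · have hterm (y : u) : ENNReal.ofReal ((8 * r y) ^ s) ≤
        ENNReal.ofReal (8 ^ s / c) * ν (Metric.closedBall y (r y)) := by
      refine le_trans (le_of_eq ?_) (mul_le_mul_right (hrν y (huZ y.2)).le _)
      rw [← ENNReal.ofReal_mul (by positivity),
        Real.mul_rpow (by norm_num) (hr0 y (huZ y.2)).le]
      congr 1
      field_simp
    have : Countable u := hu.to_subtype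
    calc ∑' y : u, ENNReal.ofReal ((8 * r y) ^ s)
        ≤ ∑' y : u, ENNReal.ofReal (8 ^ s / c) * ν (Metric.closedBall (y : X) (r y)) :=
          ENNReal.tsum_le_tsum hterm
      _ = ENNReal.ofReal (8 ^ s / c) * ν (⋃ y ∈ u, Metric.closedBall y (r y)) := by
          rw [ENNReal.tsum_mul_left, measure_biUnion hu hdisj
            fun y _ => Metric.isClosed_closedBall.measurableSet]
      _ ≤ ENNReal.ofReal (8 ^ s / c) * ν univ := by
          gcongr
          exact subset_univ _

theorem hausdorffMeasure_le_of_upper_density [SecondCountableTopology X] (hs : 0 ≤ s) (hc : 0 < c)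
    {Z : Set X} (hZ : ∀ y ∈ Z, ∀ ε > 0, ∃ r, 0 < r ∧ r < ε ∧
      ENNReal.ofReal (c * r ^ s) < ν (Metric.closedBall y r)) :
    μH[s] Z ≤ ENNReal.ofReal (8 ^ s / c) * ν univ := by
  choose u r hu hr hcov hsum using fun N : ℕ =>
    exists_countable_closedBall_cover hc fun y hy => hZ y hy (1 / ((N : ℝ) + 1)) (by positivity)
  have (N : ℕ) : Countable (u N) := (hu N).to_subtype
  have hdiam (N : ℕ) (y : u N) :
      Metric.ediam (Metric.closedBall (y : X) (4 * r N y)) ≤ ENNReal.ofReal (8 * r N y) := by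
    refine Metric.ediam_le_of_forall_dist_le fun a ha b hb => ?_
    rw [Metric.mem_closedBall] at ha hb
    linarith [dist_triangle_right a b (y : X)]
  have hmesh : Tendsto (fun N : ℕ => ENNReal.ofReal (8 * (1 / ((N : ℝ) + 1)))) atTop (𝓝 0) := by
    simpa using ENNReal.tendsto_ofReal (tendsto_one_div_add_atTop_nhds_zero_nat.const_mul (8 : ℝ))
  calc μH[s] Z
      ≤ liminf (fun N => ∑' y : u N, Metric.ediam (Metric.closedBall (y : X) (4 * r N y)) ^ s)
          atTop := by
        refine Measure.hausdorffMeasure_le_liminf_tsum s Z _ hmesh _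
          (.of_forall fun N y => (hdiam N y).trans (ENNReal.ofReal_le_ofReal ?_))
          (.of_forall fun N => (hcov N).trans_eq (biUnion_eq_iUnion _ _))
        linarith [(hr N y y.2).2]
    _ ≤ liminf (fun _ : ℕ => ENNReal.ofReal (8 ^ s / c) * ν univ) atTop := by
        refine liminf_le_liminf (.of_forall fun N => (ENNReal.tsum_le_tsum fun y => ?_).trans
          (hsum N))
        have := (hr N y y.2).1
        rw [← ENNReal.ofReal_rpow_of_nonneg (by positivity) hs]
        exact ENNReal.rpow_le_rpow (hdiam N y) hs
    _ = ENNReal.ofReal (8 ^ s / c) * ν univ := liminf_const _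

theorem hausdorffMeasure_compl_iUnion_uniformDensitySet_le [SecondCountableTopology X]
    (hs : 0 ≤ s) (hc : 0 < c) (ν : Measure X) :
    μH[s] (⋃ N : ℕ, uniformDensitySet ν s c (1 / ((N : ℝ) + 1)))ᶜ ≤
      ENNReal.ofReal (8 ^ s / c) * ν univ := by
  refine hausdorffMeasure_le_of_upper_density hs hc fun y hy ε hε => ?_
  obtain ⟨N, hN⟩ := exists_nat_one_div_lt hε
  have hyN : y ∉ uniformDensitySet ν s c (1 / ((N : ℝ) + 1)) := fun h => hy (mem_iUnion.2 ⟨N, h⟩)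
  simp only [uniformDensitySet, mem_ofPred_eq, not_forall, not_le] at hyN
  obtain ⟨r, hr0, hrN, hr⟩ := hyN
  exact ⟨r, hr0, hrN.trans hN, hr.trans_le (measure_mono Metric.ball_subset_closedBall)⟩

theorem exists_hausdorffMeasure_inter_uniformDensitySet_pos [SecondCountableTopology X]
    (hs : 0 ≤ s) {K : Set X} (hpos : 0 < μH[s] K) (hfin : μH[s] K < ∞) :
    ∃ c > 0, ∃ ε > 0, 0 < μH[s] (K ∩ uniformDensitySet (μH[s].restrict K) s c ε) := by
  set c : ℝ := 2 * 8 ^ s with hc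
  have hc0 : 0 < c := by positivity
  refine ⟨c, hc0, ?_⟩
  by_contra! hnull
  set D : Set X := ⋃ N : ℕ, uniformDensitySet (μH[s].restrict K) s c (1 / ((N : ℝ) + 1))
  have hD : μH[s] (K ∩ D) = 0 := by
    rw [inter_iUnion]
    exact measure_iUnion_null fun N => nonpos_iff_eq_zero.1 (hnull _ (by positivity))
  have hhalf : μH[s] K ≤ μH[s] K / 2 := by
    calc μH[s] K ≤ μH[s] (K ∩ D) + μH[s] Dᶜ := by
          refine (measure_mono fun x hx => ?_).trans (measure_union_le _ _)
          by_cases hxD : x ∈ D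
          · exact Or.inl ⟨hx, hxD⟩
          · exact Or.inr hxD
      _ ≤ ENNReal.ofReal (8 ^ s / c) * μH[s] K := by
          rw [hD, zero_add, ← Measure.restrict_apply_univ K]
          exact hausdorffMeasure_compl_iUnion_uniformDensitySet_le hs hc0 _
      _ = μH[s] K / 2 := by
          rw [show (8 : ℝ) ^ s / c = 2⁻¹ by rw [hc]; field_simp,
            ENNReal.ofReal_inv_of_pos two_pos, ENNReal.ofReal_ofNat, ENNReal.div_eq_inv_mul]
  exact (ENNReal.half_lt_self hpos.ne' hfin.ne).not_ge hhalf

theorem exists_isCompact_growth [PolishSpace X] (hs : 0 ≤ s) {A : Set X}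
    (hA : (μH[s] : Measure X).toOuterMeasure.IsCaratheodory A) (hpos : 0 < μH[s] A)
    (hfin : μH[s] A < ∞) :
    ∃ K ⊆ A, IsCompact K ∧ 0 < μH[s] K ∧ ∃ C : ℝ, 0 ≤ C ∧ ∀ y ∈ K, ∀ r, 0 < r →
      μH[s] (K ∩ Metric.closedBall y r) ≤ ENNReal.ofReal (C * r ^ s) := by
  obtain ⟨K, hKA, hK, hKpos⟩ := exists_isCompact_subset_measure_pos hA hpos hfin
  have hKfin : μH[s] K < ∞ := (measure_mono hKA).trans_lt hfin
  obtain ⟨c, hc, ε, hε, hpos⟩ := exists_hausdorffMeasure_inter_uniformDensitySet_pos hs hKpos hKfin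
  have : IsFiniteMeasure (μH[s].restrict K) := ⟨by rwa [Measure.restrict_apply_univ]⟩
  refine ⟨_, inter_subset_left.trans hKA, hK.inter_right (isClosed_uniformDensitySet _ _ _ _),
    hpos, c * 2 ^ s + (μH[s].restrict K).real univ * (2 / ε) ^ s, by positivity,
    fun y hy r hr => ?_⟩
  refine (measure_mono ?_).trans ((Measure.le_restrict_apply K (Metric.closedBall y r)).trans
    (measure_closedBall_le_of_mem_uniformDensitySet hs hc.le hε hy.2 hr))
  exact fun z hz => ⟨hz.2, hz.1.1⟩

end UpperDensity

/-! ### Upper bounds for plane sections -/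

theorem exists_haarO_norm_transv_le {n m : ℕ} (h : m < n) : ∃ C : ℝ≥0∞, C ≠ ∞ ∧
    ∀ (z : E n) (d : ℝ), z ≠ 0 → 0 < d →
      haarO n {g | ‖transv m g z‖ ≤ d} ≤
        C * ENNReal.ofReal (d ^ m) * ENNReal.ofReal (‖z‖ ^ m)⁻¹ := by
  obtain ⟨C, hC, hle⟩ := exists_avgKernel_le h
  refine ⟨ENNReal.ofReal (Real.exp 1) * C, ENNReal.mul_ne_top ENNReal.ofReal_ne_top hC,
    fun z d hz hd => ?_⟩
  have hmeas : MeasurableSet {g : O n | ‖transv m g z‖ ≤ d} :=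
    measurableSet_le (by fun_prop) measurable_const
  calc haarO n {g | ‖transv m g z‖ ≤ d}
      = ∫⁻ _ in {g | ‖transv m g z‖ ≤ d}, 1 ∂haarO n := (setLIntegral_one _).symm
    _ ≤ ∫⁻ g in {g | ‖transv m g z‖ ≤ d}, ENNReal.ofReal (Real.exp 1 * d ^ m) *
          ENNReal.ofReal (gaussKernel m d (transv m g z)) ∂haarO n := by
        refine setLIntegral_mono' hmeas fun g hg => ?_
        rw [← ENNReal.ofReal_mul (by positivity), ← ENNReal.ofReal_one]
        exact ENNReal.ofReal_le_ofReal (one_le_exp_mul_gaussKernel hd hg)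
    _ ≤ ∫⁻ g, ENNReal.ofReal (Real.exp 1 * d ^ m) *
          ENNReal.ofReal (gaussKernel m d (transv m g z)) ∂haarO n := setLIntegral_le_lintegral _ _
    _ = ENNReal.ofReal (Real.exp 1 * d ^ m) * avgKernel n m d z :=
        lintegral_const_mul' _ _ ENNReal.ofReal_ne_top
    _ ≤ ENNReal.ofReal (Real.exp 1 * d ^ m) * (C * ENNReal.ofReal (‖z‖ ^ m)⁻¹) := by
        gcongr
        exact hle d hd z hz
    _ = _ := by
        rw [ENNReal.ofReal_mul (Real.exp_pos 1).le]
        ring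

theorem exists_rpow_ediam_mul_haarO_section_nonempty_le {n m : ℕ} (h : m < n) {s : ℝ}
    (hs : (m : ℝ) < s) {x : E n} {ε : ℝ} (hε : 0 < ε) : ∃ C : ℝ≥0∞, C ≠ ∞ ∧
    ∀ T : Set (E n), Metric.ediam T ≠ ∞ → (∀ y ∈ T, ε ≤ ‖y - x‖) →
      Metric.ediam T ^ (s - m) * haarO n {g | (T ∩ {y | transv m g (y - x) = 0}).Nonempty} ≤
        C * Metric.ediam T ^ s := by
  obtain ⟨C, hC, hprob⟩ := exists_haarO_norm_transv_le h
  refine ⟨C * ENNReal.ofReal (ε ^ m)⁻¹, ENNReal.mul_ne_top hC ENNReal.ofReal_ne_top,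
    fun T hT hTx => ?_⟩
  rcases eq_or_ne (Metric.ediam T) 0 with hT0 | hT0
  · simp [hT0, ENNReal.zero_rpow_of_pos (sub_pos.2 hs)]
  obtain ⟨y, hy⟩ : T.Nonempty :=
    nonempty_iff_ne_empty.2 fun hT => hT0 (by rw [hT, Metric.ediam_empty])
  set D := (Metric.ediam T).toReal
  have hD0 : 0 < D := ENNReal.toReal_pos hT0 hT
  have hTD : Metric.ediam T = ENNReal.ofReal D := (ENNReal.ofReal_toReal hT).symm
  have hsub : {g : O n | (T ∩ {y | transv m g (y - x) = 0}).Nonempty} ⊆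
      {g | ‖transv m g (y - x)‖ ≤ D} := by
    rintro g ⟨z, hz, hzx⟩
    calc ‖transv m g (y - x)‖ = ‖transv m g (y - z)‖ := by
          rw [← sub_add_sub_cancel y z x, map_add, show transv m g (z - x) = 0 from hzx, add_zero]
      _ ≤ ‖y - z‖ := norm_transv_le g _
      _ ≤ D := by
          rw [← dist_eq_norm, dist_edist]
          exact ENNReal.toReal_mono hT (Metric.edist_le_ediam_of_mem hy hz)
  calc Metric.ediam T ^ (s - m) * haarO n {g | (T ∩ {y | transv m g (y - x) = 0}).Nonempty}
      ≤ Metric.ediam T ^ (s - m) *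
          (C * ENNReal.ofReal (D ^ m) * ENNReal.ofReal (‖y - x‖ ^ m)⁻¹) := by
        gcongr
        exact (measure_mono hsub).trans
          (hprob _ D (norm_pos_iff.1 (hε.trans_le (hTx y hy))) hD0)
    _ ≤ Metric.ediam T ^ (s - m) *
          (C * ENNReal.ofReal (D ^ m) * ENNReal.ofReal (ε ^ m)⁻¹) := by
        gcongr
        exact hTx y hy
    _ = C * ENNReal.ofReal (ε ^ m)⁻¹ * (ENNReal.ofReal (D ^ m) * Metric.ediam T ^ (s - m)) := by
        ring
    _ = C * ENNReal.ofReal (ε ^ m)⁻¹ * Metric.ediam T ^ s := by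
        rw [hTD, ENNReal.ofReal_rpow_of_pos hD0, ENNReal.ofReal_rpow_of_pos hD0,
          ← ENNReal.ofReal_mul (by positivity), ← Real.rpow_natCast D m, ← Real.rpow_add hD0,
          add_sub_cancel]

/-- Each `t i` is a cover; the sets `S ω` need only meet its members rarely. The integral over `ω`
of the covering sums of `S ω` is then bounded, and Fatou's lemma applies. -/
theorem ae_hausdorffMeasure_lt_top_of_cover {X Ω : Type*} [EMetricSpace X] [MeasurableSpace X]
    [BorelSpace X] [MeasurableSpace Ω] {μ : Measure Ω} {d : ℝ} (hd : 0 < d) {S : Ω → Set X}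
    {t : ℕ → ℕ → Set X} {r : ℕ → ℝ≥0∞} (hr : Tendsto r atTop (𝓝 0))
    (htr : ∀ i l, Metric.ediam (t i l) ≤ r i) (hcov : ∀ i ω, S ω ⊆ ⋃ l, t i l) {B : ℝ≥0∞}
    (hB : B ≠ ∞)
    (hsum : ∀ i, ∑' l, Metric.ediam (t i l) ^ d * μ {ω | (t i l ∩ S ω).Nonempty} ≤ B) :
    ∀ᵐ ω ∂μ, μH[d] (S ω) < ∞ := by
  set M : ℕ → ℕ → Set Ω := fun i l => toMeasurable μ {ω | (t i l ∩ S ω).Nonempty}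
  have hM (i l : ℕ) : MeasurableSet (M i l) := measurableSet_toMeasurable _ _
  set φ : ℕ → Ω → ℝ≥0∞ := fun i ω =>
    ∑' l, Metric.ediam (t i l) ^ d * (M i l).indicator 1 ω with hφ
  have hφm (i : ℕ) : Measurable (φ i) :=
    .tsum fun l => (measurable_one.indicator (hM i l)).const_mul _
  have hint (i : ℕ) : ∫⁻ ω, φ i ω ∂μ ≤ B := by
    refine le_trans (le_of_eq ?_) (hsum i)
    rw [hφ, lintegral_tsum fun l => ((measurable_one.indicator (hM i l)).const_mul _).aemeasurable]
    simp only [lintegral_const_mul _ (measurable_one.indicator (hM i _)),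
      lintegral_indicator_one (hM i _), M, measure_toMeasurable]
  have hliminf : ∫⁻ ω, liminf (fun i => φ i ω) atTop ∂μ ≠ ∞ := by
    refine ne_top_of_le_ne_top hB ((lintegral_liminf_le hφm).trans ?_)
    exact (liminf_le_liminf (.of_forall hint)).trans_eq (liminf_const B)
  filter_upwards [ae_lt_top (Measurable.liminf hφm) hliminf] with ω hω
  refine lt_of_le_of_lt ?_ hω
  refine (Measure.hausdorffMeasure_le_liminf_tsum d (S ω) r hr (fun i l => t i l ∩ S ω)
    (.of_forall fun i l => (Metric.ediam_mono inter_subset_left).trans (htr i l))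
    (.of_forall fun i => ?_)).trans
    (liminf_le_liminf (.of_forall fun i => ENNReal.tsum_le_tsum fun l => ?_))
  · rw [← iUnion_inter]
    exact subset_inter (hcov i ω) subset_rfl
  · rcases (t i l ∩ S ω).eq_empty_or_nonempty with hempty | hne
    · simp [hempty, hd]
    · rw [indicator_of_mem (subset_toMeasurable μ _ hne), Pi.one_apply, mul_one]
      exact ENNReal.rpow_le_rpow (Metric.ediam_mono inter_subset_left) hd.le

section SectionUpperBound

variable {n m : ℕ} {s : ℝ} {A : Set (E n)}

theorem ae_hausdorffMeasure_section_lt_top (h : m < n) (hms : (m : ℝ) < s) (hfin : μH[s] A < ∞)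
    (x : E n) {ε : ℝ} (hε : 0 < ε) (hA : ∀ y ∈ A, ε ≤ ‖y - x‖) :
    ∀ᵐ g ∂haarO n, μH[s - m] (A ∩ {y | transv m g (y - x) = 0}) < ∞ := by
  have hs : 0 < s := (Nat.cast_nonneg m).trans_lt hms
  obtain ⟨C, hC, hhit⟩ := exists_rpow_ediam_mul_haarO_section_nonempty_le h hms (x := x) hε
  choose t hcov htA hdiam hsum using fun i : ℕ =>
    exists_cover_of_hausdorffMeasure_lt hs (ENNReal.lt_add_right hfin.ne one_ne_zero)
      (r := ENNReal.ofReal (1 / ((i : ℝ) + 1))) (ENNReal.ofReal_pos.2 (by positivity))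
  refine ae_hausdorffMeasure_lt_top_of_cover (sub_pos.2 hms)
    (by simpa using ENNReal.tendsto_ofReal (tendsto_one_div_add_atTop_nhds_zero_nat (𝕜 := ℝ)))
    hdiam (fun i g => inter_subset_left.trans (hcov i)) (B := C * (μH[s] A + 1))
    (ENNReal.mul_ne_top hC (by simp [hfin.ne])) fun i => ?_
  calc ∑' l, Metric.ediam (t i l) ^ (s - m) *
        haarO n {g | (t i l ∩ (A ∩ {y | transv m g (y - x) = 0})).Nonempty}
      ≤ ∑' l, C * Metric.ediam (t i l) ^ s := by
        refine ENNReal.tsum_le_tsum fun l => ?_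
        simp only [← inter_assoc, inter_eq_self_of_subset_left (htA i l)]
        exact hhit _ (ne_top_of_le_ne_top ENNReal.ofReal_ne_top (hdiam i l))
          fun y hy => hA y (htA i l hy)
    _ = C * ∑' l, Metric.ediam (t i l) ^ s := ENNReal.tsum_mul_left
    _ ≤ C * (μH[s] A + 1) := by
        gcongr
        exact (hsum i).le

theorem ae_dimH_section_le (h : m < n) (hms : (m : ℝ) < s) (hfin : μH[s] A < ∞) (x : E n) :
    ∀ᵐ g ∂haarO n, dimH (A ∩ {y | transv m g (y - x) = 0}) ≤ ENNReal.ofReal (s - m) := by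
  have hall : ∀ᵐ g ∂haarO n, ∀ N : ℕ, μH[s - m]
      ((A ∩ {y | 1 / ((N : ℝ) + 1) ≤ ‖y - x‖}) ∩ {y | transv m g (y - x) = 0}) < ∞ :=
    ae_all_iff.2 fun N => ae_hausdorffMeasure_section_lt_top h hms
      ((measure_mono inter_subset_left).trans_lt hfin) x (ε := 1 / ((N : ℝ) + 1)) (by positivity)
      fun y hy => hy.2
  filter_upwards [hall] with g hg
  have hsub : A ∩ {y | transv m g (y - x) = 0} ⊆ {x} ∪ ⋃ N : ℕ,
      (A ∩ {y | 1 / ((N : ℝ) + 1) ≤ ‖y - x‖}) ∩ {y | transv m g (y - x) = 0} := by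
    intro y hy
    by_cases hyx : y = x
    · exact Or.inl hyx
    · obtain ⟨N, hN⟩ := exists_nat_one_div_lt (norm_pos_iff.2 (sub_ne_zero.2 hyx))
      exact Or.inr (mem_iUnion.2 ⟨N, ⟨hy.1, hN.le⟩, hy.2⟩)
  refine (dimH_mono hsub).trans ?_
  rw [dimH_union, dimH_singleton, dimH_iUnion]
  refine max_le zero_le (iSup_le fun N => ?_)
  refine dimH_le_of_hausdorffMeasure_ne_top (d := (s - m).toNNReal) ?_
  rw [Real.coe_toNNReal _ (sub_pos.2 hms).le]
  exact (hg N).ne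

end SectionUpperBound

/-! ### Dyadic cubes -/

/-- The dyadic cube of side `2⁻ᵏ` with index `q`. -/
def dyadicCube {n : ℕ} (k : ℕ) (q : Fin n → ℤ) : Set (E n) :=
  {y | ∀ i, ⌊(2 : ℝ) ^ k * y i⌋ = q i}

section DyadicCube

variable {n k : ℕ} {q q' : Fin n → ℤ} {y z : E n}

theorem measurableSet_dyadicCube (k : ℕ) (q : Fin n → ℤ) : MeasurableSet (dyadicCube k q) := by
  simp only [dyadicCube, ofPred_forall]
  refine .iInter fun i => ?_
  have hfloor : Measurable fun y : E n => ⌊(2 : ℝ) ^ k * y i⌋ :=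
    Int.measurable_floor.comp (by fun_prop)
  exact hfloor (measurableSet_singleton (q i))

theorem disjoint_dyadicCube (k : ℕ) (h : q ≠ q') : Disjoint (dyadicCube k q) (dyadicCube k q') :=
  Set.disjoint_left.2 fun _ hy hy' => h (funext fun i => (hy i).symm.trans (hy' i))

theorem norm_sub_le_of_mem_dyadicCube (hy : y ∈ dyadicCube k q) (hz : z ∈ dyadicCube k q) :
    ‖y - z‖ ≤ √n * (1 / 2) ^ k := by
  have hcoord (i : Fin n) : ‖(y - z) i‖ ≤ (1 / 2) ^ k := by
    have hscaled := Int.abs_sub_lt_one_of_floor_eq_floor ((hy i).trans (hz i).symm)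
    rw [← mul_sub, abs_mul, abs_of_pos (by positivity)] at hscaled
    rw [PiLp.sub_apply, Real.norm_eq_abs, one_div_pow, le_div_iff₀' (by positivity)]
    exact hscaled.le
  rw [EuclideanSpace.norm_eq]
  refine Real.sqrt_le_iff.2 ⟨by positivity, ?_⟩
  rw [mul_pow, Real.sq_sqrt (Nat.cast_nonneg n)]
  calc ∑ i, ‖(y - z) i‖ ^ 2 ≤ ∑ _i : Fin n, ((1 / 2 : ℝ) ^ k) ^ 2 :=
        Finset.sum_le_sum fun i _ => pow_le_pow_left₀ (norm_nonneg _) (hcoord i) 2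
    _ = n * ((1 / 2) ^ k) ^ 2 := by simp

/-- The indices of the cubes of level `k` that can meet the ball of radius `2 · 2⁻ᵏ` about `y`. -/
def nearCubes (k : ℕ) (y : E n) : Finset (Fin n → ℤ) :=
  Fintype.piFinset fun i => Finset.Icc (⌊(2 : ℝ) ^ k * y i⌋ - 2) (⌊(2 : ℝ) ^ k * y i⌋ + 2)

theorem card_nearCubes (k : ℕ) (y : E n) : (nearCubes k y).card = 5 ^ n := by
  have hcard (a : ℤ) : (Finset.Icc (a - 2) (a + 2)).card = 5 := by
    rw [Int.card_Icc]
    lia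
  simp only [nearCubes, Fintype.card_piFinset, hcard, Finset.prod_const, Finset.card_univ,
    Fintype.card_fin]

theorem exists_mem_dyadicCube_of_mem_ball (hz : z ∈ Metric.ball y (2 * (1 / 2) ^ k)) :
    ∃ q ∈ nearCubes k y, z ∈ dyadicCube k q := by
  refine ⟨fun i => ⌊(2 : ℝ) ^ k * z i⌋, Fintype.mem_piFinset.2 fun i => ?_, fun i => rfl⟩
  have hcoord : |(2 : ℝ) ^ k * z i - 2 ^ k * y i| < 2 := by
    rw [← mul_sub, abs_mul, abs_of_pos (by positivity)]
    calc (2 : ℝ) ^ k * |z i - y i| ≤ 2 ^ k * ‖z - y‖ := by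
          gcongr
          exact PiLp.norm_apply_le (z - y) i
      _ < 2 ^ k * (2 * (1 / 2) ^ k) := by
          gcongr
          rwa [← dist_eq_norm]
      _ = 2 := by rw [mul_left_comm, ← mul_pow]; norm_num
  rw [abs_lt] at hcoord
  rw [Finset.mem_Icc, Int.le_floor, Int.floor_le_iff]
  push_cast
  constructor <;>
    linarith [Int.floor_le ((2 : ℝ) ^ k * y i), Int.lt_floor_add_one ((2 : ℝ) ^ k * y i)]

end DyadicCube

section DyadicCover

variable {t ε : ℝ}

theorem exists_subset_dyadic_ball {X : Type*} [PseudoMetricSpace X] [Nonempty X] (ht : 0 < t)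
    {T : Set X} (hT : Metric.ediam T ≤ 1) (hε : 0 < ε) :
    ∃ (y : X) (k : ℕ), T ⊆ Metric.ball y (2 * (1 / 2) ^ k) ∧
      ENNReal.ofReal (((1 / 2 : ℝ) ^ k) ^ t) ≤
        ENNReal.ofReal (2 ^ t) * Metric.ediam T ^ t + ENNReal.ofReal ε := by
  have hfin : Metric.ediam T ≠ ∞ := ne_top_of_le_ne_top ENNReal.one_ne_top hT
  set d := (Metric.ediam T).toReal
  have hTd : Metric.ediam T = ENNReal.ofReal d := (ENNReal.ofReal_toReal hfin).symm
  have hd1 : d ≤ 1 := ENNReal.toReal_mono ENNReal.one_ne_top hT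
  obtain ⟨y, hy⟩ : ∃ y : X, T ⊆ Metric.closedBall y d := by
    rcases T.eq_empty_or_nonempty with rfl | ⟨y, hy⟩
    · exact ⟨Classical.arbitrary X, empty_subset _⟩
    · refine ⟨y, fun z hz => ?_⟩
      rw [Metric.mem_closedBall, dist_edist]
      exact ENNReal.toReal_mono hfin (Metric.edist_le_ediam_of_mem hz hy)
  have hball (k : ℕ) (hk : d ≤ (1 / 2) ^ k) : T ⊆ Metric.ball y (2 * (1 / 2) ^ k) := by
    refine hy.trans (Metric.closedBall_subset_ball ?_)
    have : (0 : ℝ) < (1 / 2) ^ k := by positivity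
    linarith
  rcases (show 0 ≤ d from ENNReal.toReal_nonneg).eq_or_lt with hd | hd
  · have hlim : Tendsto (fun k : ℕ => ((1 / 2 : ℝ) ^ k) ^ t) atTop (𝓝 0) := by
      rw [← Real.zero_rpow ht.ne']
      exact (tendsto_pow_atTop_nhds_zero_of_lt_one (by norm_num) (by norm_num)).rpow_const
        (Or.inr ht.le)
    obtain ⟨k, hk⟩ := (hlim.eventually_lt_const hε).exists
    exact ⟨y, k, hball k (by rw [← hd]; positivity),
      le_add_left (ENNReal.ofReal_le_ofReal hk.le)⟩
  · obtain ⟨k, hlower, hupper⟩ := exists_nat_pow_near_of_lt_one hd hd1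
      (show (0 : ℝ) < 1 / 2 by norm_num) (by norm_num)
    refine ⟨y, k, hball k hupper, le_add_right ?_⟩
    rw [hTd, ENNReal.ofReal_rpow_of_pos hd, ← ENNReal.ofReal_mul (by positivity),
      ← Real.mul_rpow zero_le_two hd.le]
    refine ENNReal.ofReal_le_ofReal (Real.rpow_le_rpow (by positivity) ?_ ht.le)
    rw [pow_succ] at hlower
    linarith

theorem exists_dyadic_ball_cover {X : Type*} [MetricSpace X] [Nonempty X] [MeasurableSpace X]
    [BorelSpace X] (ht : 0 < t) {S : Set X} (hS : μH[t] S = 0) (hε : 0 < ε) :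
    ∃ (y : ℕ → X) (k : ℕ → ℕ), S ⊆ ⋃ i, Metric.ball (y i) (2 * (1 / 2) ^ k i) ∧
      ∑' i, ENNReal.ofReal (((1 / 2 : ℝ) ^ k i) ^ t) ≤ ENNReal.ofReal ε := by
  set ε' : ℝ := ε / 2 / 2 ^ t with hε'
  have hε'0 : 0 < ε' := by positivity
  obtain ⟨T, hST, -, hT, hTsum⟩ := exists_cover_of_hausdorffMeasure_lt ht (S := S)
    (a := ENNReal.ofReal ε') (by rwa [hS, ENNReal.ofReal_pos]) one_pos
  choose y k hball hk using fun i =>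
    exists_subset_dyadic_ball ht (hT i) (show 0 < ε / 2 / 2 / 2 ^ i by positivity)
  refine ⟨y, k, hST.trans (iUnion_mono hball), ?_⟩
  calc ∑' i, ENNReal.ofReal (((1 / 2 : ℝ) ^ k i) ^ t)
      ≤ ∑' i, (ENNReal.ofReal (2 ^ t) * Metric.ediam (T i) ^ t +
          ENNReal.ofReal (ε / 2 / 2 / 2 ^ i)) := ENNReal.tsum_le_tsum hk
    _ = ENNReal.ofReal (2 ^ t) * ∑' i, Metric.ediam (T i) ^ t + ENNReal.ofReal (ε / 2) := by
        rw [ENNReal.tsum_add, ENNReal.tsum_mul_left, ← ENNReal.ofReal_tsum_of_nonneg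
          (fun i => by positivity) (summable_geometric_two' _), tsum_geometric_two']
    _ ≤ ENNReal.ofReal (2 ^ t) * ENNReal.ofReal ε' + ENNReal.ofReal (ε / 2) := by gcongr
    _ = ENNReal.ofReal ε := by
        rw [← ENNReal.ofReal_mul (by positivity), ← ENNReal.ofReal_add (by positivity)
          (by positivity), hε', mul_div_cancel₀ _ (by positivity), add_halves]

theorem sum_biUnion_le_of_nonneg {ι κ : Type*} [DecidableEq κ] (I : Finset ι)
    (T : ι → Finset κ) {f : κ → ℝ} (hf : ∀ x, 0 ≤ f x) :
    ∑ x ∈ I.biUnion T, f x ≤ ∑ i ∈ I, ∑ x ∈ T i, f x := by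
  classical
  induction I using Finset.induction_on with
  | empty => simp
  | insert i I hi ih =>
    rw [Finset.biUnion_insert, Finset.sum_insert hi]
    have hunion := Finset.sum_union_inter (s₁ := T i) (s₂ := I.biUnion T) (f := f)
    have hinter : 0 ≤ ∑ x ∈ T i ∩ I.biUnion T, f x := Finset.sum_nonneg fun x _ => hf x
    linarith

theorem exists_dyadicCube_cover {n : ℕ} (ht : 0 < t) {S : Set (E n)} (hS : IsCompact S)
    (hnull : μH[t] S = 0) (hε : 0 < ε) :
    ∃ (U : Set (E n)) (𝓕 : Finset (ℕ × (Fin n → ℤ))), IsOpen U ∧ S ⊆ U ∧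
      U ⊆ ⋃ p ∈ 𝓕, dyadicCube p.1 p.2 ∧ ∑ p ∈ 𝓕, ((1 / 2 : ℝ) ^ p.1) ^ t ≤ ε := by
  obtain ⟨y, k, hcov, hsum⟩ := exists_dyadic_ball_cover ht hnull (show 0 < ε / 5 ^ n by positivity)
  obtain ⟨I, hI⟩ := hS.elim_finite_subcover (fun i => Metric.ball (y i) (2 * (1 / 2) ^ k i))
    (fun i => Metric.isOpen_ball) hcov
  refine ⟨_, I.biUnion fun i => (nearCubes (k i) (y i)).image fun q => (k i, q),
    isOpen_biUnion fun i _ => Metric.isOpen_ball, hI, fun z hz => ?_, ?_⟩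
  · obtain ⟨i, hi, hzi⟩ := mem_iUnion₂.1 hz
    obtain ⟨q, hq, hzq⟩ := exists_mem_dyadicCube_of_mem_ball hzi
    exact mem_iUnion₂.2
      ⟨(k i, q), Finset.mem_biUnion.2 ⟨i, hi, Finset.mem_image.2 ⟨q, hq, rfl⟩⟩, hzq⟩
  · have hI_sum : ∑ i ∈ I, ((1 / 2 : ℝ) ^ k i) ^ t ≤ ε / 5 ^ n := by
      rw [← ENNReal.ofReal_le_ofReal_iff (by positivity),
        ENNReal.ofReal_sum_of_nonneg fun i _ => by positivity]
      exact (ENNReal.sum_le_tsum I).trans hsum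
    refine (sum_biUnion_le_of_nonneg I _ fun p => by positivity).trans ?_
    calc ∑ i ∈ I, ∑ p ∈ (nearCubes (k i) (y i)).image (fun q => (k i, q)), ((1 / 2 : ℝ) ^ p.1) ^ t
        = ∑ i ∈ I, 5 ^ n * ((1 / 2 : ℝ) ^ k i) ^ t := by
          refine Finset.sum_congr rfl fun i _ => ?_
          rw [Finset.sum_image fun q _ q' _ h => (Prod.mk.inj h).2]
          simp [card_nearCubes]
      _ ≤ 5 ^ n * (ε / 5 ^ n) := by
          rw [← Finset.mul_sum]
          gcongr
      _ = ε := mul_div_cancel₀ _ (by positivity)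

end DyadicCover

section DyadicEnergy

theorem sum_mul_le_tsum_of_fiberwise_sum_le {κ : Type*} {w b : ℕ → ℝ} (hw : ∀ k, 0 ≤ w k)
    (hb : ∀ k, 0 ≤ b k) (hwb : Summable fun k => w k * b k) {f : ℕ → κ → ℝ}
    (𝓕 : Finset (ℕ × κ)) (hf : ∀ p ∈ 𝓕, ∀ 𝒬 : Finset κ, ∑ q ∈ 𝒬, f p.1 q ≤ b p.1) :
    ∑ p ∈ 𝓕, w p.1 * f p.1 p.2 ≤ ∑' k, w k * b k := by
  classical
  rw [← Finset.sum_fiberwise_of_maps_to (t := 𝓕.image Prod.fst) (g := Prod.fst)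
    fun p hp => Finset.mem_image_of_mem _ hp]
  refine (Finset.sum_le_sum fun k hk => ?_).trans
    (hwb.sum_le_tsum _ fun k _ => mul_nonneg (hw k) (hb k))
  obtain ⟨p₀, hp₀, rfl⟩ := Finset.mem_image.1 hk
  calc ∑ p ∈ 𝓕 with p.1 = p₀.1, w p.1 * f p.1 p.2
      = ∑ p ∈ 𝓕 with p.1 = p₀.1, w p₀.1 * f p₀.1 p.2 :=
        Finset.sum_congr rfl fun p hp => by rw [(Finset.mem_filter.1 hp).2]
    _ = w p₀.1 * ∑ q ∈ (𝓕.filter fun p => p.1 = p₀.1).image Prod.snd, f p₀.1 q := by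
        rw [Finset.sum_image, Finset.mul_sum]
        intro p hp p' hp' hsnd
        exact Prod.ext ((Finset.mem_filter.1 hp).2.trans (Finset.mem_filter.1 hp').2.symm) hsnd
    _ ≤ w p₀.1 * b p₀.1 := mul_le_mul_of_nonneg_left (hf p₀ hp₀ _) (hw _)

variable {n : ℕ} {t : ℝ} {b : ℕ → ℝ}

theorem sq_sum_measureReal_dyadicCube_le (hb : ∀ k, 0 ≤ b k)
    (hbt : Summable fun k => ((2 : ℝ) ^ k) ^ t * b k) {ν : Measure (E n)}
    {𝓕 : Finset (ℕ × (Fin n → ℤ))}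
    (hν : ∀ p ∈ 𝓕, ∀ 𝒬 : Finset (Fin n → ℤ), ∑ q ∈ 𝒬, ν.real (dyadicCube p.1 q) ^ 2 ≤ b p.1) :
    (∑ p ∈ 𝓕, ν.real (dyadicCube p.1 p.2)) ^ 2 ≤
      (∑ p ∈ 𝓕, ((1 / 2 : ℝ) ^ p.1) ^ t) * ∑' k, ((2 : ℝ) ^ k) ^ t * b k := by
  have hweights (k : ℕ) : ((1 / 2 : ℝ) ^ k) ^ t * ((2 : ℝ) ^ k) ^ t = 1 := by
    rw [← Real.mul_rpow (by positivity) (by positivity), ← mul_pow]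
    norm_num
  refine (Finset.sum_sq_le_sum_mul_sum_of_sq_le_mul 𝓕 (f := fun p => ((1 / 2 : ℝ) ^ p.1) ^ t)
    (g := fun p => ((2 : ℝ) ^ p.1) ^ t * ν.real (dyadicCube p.1 p.2) ^ 2)
    (fun p _ => by positivity) (fun p _ => by positivity)
    fun p _ => by rw [← mul_assoc, hweights, one_mul]).trans ?_
  gcongr
  exact sum_mul_le_tsum_of_fiberwise_sum_le (f := fun k q => ν.real (dyadicCube k q) ^ 2)
    (fun k => by positivity) hb hbt 𝓕 hν

/-- If `S` were null, cover it by dyadic cubes with `∑ (side)ᵗ` tiny. By Cauchy–Schwarz against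
the `ℓ²` bounds these cubes carry little `ν j`-mass, and the rest of `K` carries little as well. -/
theorem hausdorffMeasure_ne_zero_of_dyadic_sq_sum_le (ht : 0 < t) {K S : Set (E n)}
    (hS : IsCompact S) {ν : ℕ → Measure (E n)} [∀ j, IsFiniteMeasure (ν j)]
    (hνK : ∀ j, ν j Kᶜ = 0)
    (hνS : ∀ U, IsOpen U → S ⊆ U → Tendsto (fun j => (ν j).real (K \ U)) atTop (𝓝 0))
    {c : ℝ} (hc : 0 < c) (hνc : ∀ᶠ j in atTop, c ≤ (ν j).real univ) (hb : ∀ k, 0 ≤ b k)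
    (hbt : Summable fun k => ((2 : ℝ) ^ k) ^ t * b k)
    (hsq : ∀ k j, k ≤ j → ∀ 𝒬 : Finset (Fin n → ℤ),
      ∑ q ∈ 𝒬, (ν j).real (dyadicCube k q) ^ 2 ≤ b k) :
    μH[t] S ≠ 0 := by
  intro hnull
  set B := ∑' k, ((2 : ℝ) ^ k) ^ t * b k
  have hB : 0 ≤ B := tsum_nonneg fun k => mul_nonneg (by positivity) (hb k)
  obtain ⟨U, 𝓕, hU, hSU, hUcov, hsum⟩ := exists_dyadicCube_cover ht hS hnull
    (show 0 < (c / 2) ^ 2 / (B + 1) by positivity)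
  obtain ⟨J, hJ⟩ : ∃ J, ∀ p ∈ 𝓕, p.1 ≤ J := ⟨𝓕.sup Prod.fst, fun p hp => Finset.le_sup hp⟩
  obtain ⟨j, ⟨hjc, hjJ⟩, hjU⟩ := ((hνc.and (eventually_ge_atTop J)).and
    ((hνS U hU hSU).eventually_lt_const (half_pos hc))).exists
  have hcubes : ∑ p ∈ 𝓕, (ν j).real (dyadicCube p.1 p.2) ≤ c / 2 := by
    refine le_of_sq_le_sq ?_ (half_pos hc).le
    calc (∑ p ∈ 𝓕, (ν j).real (dyadicCube p.1 p.2)) ^ 2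
        ≤ (∑ p ∈ 𝓕, ((1 / 2 : ℝ) ^ p.1) ^ t) * B :=
          sq_sum_measureReal_dyadicCube_le hb hbt fun p hp => hsq p.1 j ((hJ p hp).trans hjJ)
      _ ≤ (c / 2) ^ 2 / (B + 1) * (B + 1) := by gcongr; linarith
      _ = (c / 2) ^ 2 := div_mul_cancel₀ _ (by positivity)
  have hcov : univ ⊆ Kᶜ ∪ (K \ U ∪ ⋃ p ∈ 𝓕, dyadicCube p.1 p.2) := by
    intro z _
    by_cases hzU : z ∈ U
    · exact Or.inr (Or.inr (hUcov hzU))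
    · by_cases hzK : z ∈ K
      · exact Or.inr (Or.inl ⟨hzK, hzU⟩)
      · exact Or.inl hzK
  have hmass : (ν j).real univ < c := by
    calc (ν j).real univ ≤ (ν j).real (Kᶜ ∪ (K \ U ∪ ⋃ p ∈ 𝓕, dyadicCube p.1 p.2)) :=
          measureReal_mono hcov
      _ ≤ (ν j).real Kᶜ + ((ν j).real (K \ U) + (ν j).real (⋃ p ∈ 𝓕, dyadicCube p.1 p.2)) :=
          (measureReal_union_le _ _).trans (by gcongr; exact measureReal_union_le _ _)
      _ ≤ 0 + ((ν j).real (K \ U) + ∑ p ∈ 𝓕, (ν j).real (dyadicCube p.1 p.2)) := by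
          gcongr
          · simp [Measure.real, hνK j]
          · exact measureReal_biUnion_finset_le _ _
      _ < c := by linarith
  exact hmass.not_ge hjc

end DyadicEnergy

/-! ### Exceptional sets -/

section ExceptionalSet

variable {n m : ℕ} {F : ℕ → O n × LastSpace n m → ℝ} {l : ℕ → ℝ}

theorem hausdorffMeasure_limsup_superlevel_eq_zero {τ R : ℝ} (h : m < n) (hτ : (m : ℝ) < τ)
    (hR : 0 < R) (hFm : ∀ j, Measurable (F j)) (hF0 : ∀ j p, 0 ≤ F j p)
    (hFu : ∀ j, UniformEquicontinuous fun g u => F j (g, u)) (hl : ∀ j, 0 < l j)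
    (hsum : ∑' j, (∫⁻ p, ENNReal.ofReal (F j p ^ 2) ∂bundleMeasure n m) / ENNReal.ofReal (l j) ^ 2
      ≠ ∞) :
    μH[τ] (limsup (fun j => {x | x ∈ Metric.closedBall (0 : E n) R ∧ ENNReal.ofReal (l j) <
      ∫⁻ g, ENNReal.ofReal (F j (g, transv m g x)) ∂haarO n}) atTop) = 0 := by
  obtain ⟨M, hM, hcontent⟩ := exists_hausdorffContent_superlevel_le h hτ hR
  refine hausdorffMeasure_eq_zero_of_hausdorffContent_eq_zero ((Nat.cast_nonneg m).trans_lt hτ)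
    (measure_limsup_atTop_eq_zero ?_)
  refine ne_top_of_le_ne_top (ENNReal.mul_ne_top hM hsum) ?_
  rw [← ENNReal.tsum_mul_left]
  refine ENNReal.tsum_le_tsum fun j => ?_
  rw [mul_div_assoc', ENNReal.mul_div_right_comm]
  exact hcontent (F j) (hFm j) (hF0 j) (hFu j) (l j) (hl j)

/-- A Borel–Cantelli argument for the Hausdorff content. -/
theorem exists_exceptional_set (h : m < n) (hFm : ∀ j, Measurable (F j)) (hF0 : ∀ j p, 0 ≤ F j p)
    (hFu : ∀ j, UniformEquicontinuous fun g u => F j (g, u)) (hl : ∀ j, 0 < l j)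
    (hsum : ∑' j, (∫⁻ p, ENNReal.ofReal (F j p ^ 2) ∂bundleMeasure n m) / ENNReal.ofReal (l j) ^ 2
      ≠ ∞) :
    ∃ B : Set (E n), MeasurableSet B ∧ dimH B ≤ (m : ℝ≥0∞) ∧ ∀ x ∉ B, ∀ᶠ j in atTop,
      ∫⁻ g, ENNReal.ofReal (F j (g, transv m g x)) ∂haarO n ≤ ENNReal.ofReal (l j) := by
  set S : ℕ → Set (E n) := fun j =>
    {x | ENNReal.ofReal (l j) < ∫⁻ g, ENNReal.ofReal (F j (g, transv m g x)) ∂haarO n}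
  have hSm (j : ℕ) : MeasurableSet (S j) := by
    have hF : Measurable fun q : O n × E n => ENNReal.ofReal (F j (q.1, transv m q.1 q.2)) :=
      ((hFm j).comp (by fun_prop)).ennreal_ofReal
    exact measurableSet_lt measurable_const hF.lintegral_prod_left'
  refine ⟨limsup S atTop, .measurableSet_limsup hSm, ?_, fun x hx => ?_⟩
  · have hcover : limsup S atTop ⊆ ⋃ N : ℕ,
        limsup (fun j => {x | x ∈ Metric.closedBall (0 : E n) (N + 1) ∧ x ∈ S j}) atTop := by
      intro x hx
      obtain ⟨N, hN⟩ := exists_nat_ge ‖x‖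
      rw [mem_limsup_iff_frequently_mem] at hx
      exact mem_iUnion.2 ⟨N, mem_limsup_iff_frequently_mem.2
        (hx.mono fun j hj => ⟨mem_closedBall_zero_iff.2 (by linarith), hj⟩)⟩
    refine (dimH_mono hcover).trans ?_
    rw [dimH_iUnion]
    refine iSup_le fun N => dimH_le fun d hd => not_lt.1 fun hmd => ENNReal.zero_ne_top ?_
    rw [← hd]
    exact (hausdorffMeasure_limsup_superlevel_eq_zero h (by exact_mod_cast hmd) (by positivity)
      hFm hF0 hFu hl hsum).symm
  · rw [mem_limsup_iff_frequently_mem, not_frequently] at hx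
    exact hx.mono fun j hj => not_lt.1 hj

end ExceptionalSet

/-! ### Measures of prescribed growth -/

section Growth

variable {n m : ℕ} {s C : ℝ} {μ : Measure (E n)}

theorem rieszEnergy_restrict_le [SFinite μ] (hms : (m : ℝ) < s) (hC : 0 ≤ C)
    (hμ : ∀ᵐ y ∂μ, ∀ r, 0 < r → μ (Metric.closedBall y r) ≤ ENNReal.ofReal (C * r ^ s))
    {R : ℝ} (hR : 0 < R) {Q : Set (E n)} (hQ : MeasurableSet Q)
    (hdiam : ∀ y ∈ Q, ∀ z ∈ Q, ‖y - z‖ ≤ R) :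
    rieszEnergy m (μ.restrict Q) ≤
      ENNReal.ofReal (potentialConst m s * C * R ^ (s - m)) * μ Q := by
  have hpotential : ∀ᵐ y ∂μ.restrict Q, ∫⁻ z, ENNReal.ofReal (‖y - z‖ ^ m)⁻¹ ∂μ.restrict Q ≤
      ENNReal.ofReal (potentialConst m s * C * R ^ (s - m)) := by
    filter_upwards [ae_restrict_of_ae hμ, ae_restrict_mem hQ] with y hy hyQ
    refine lintegral_inv_pow_le_of_growth hms hC hR (by fun_prop) (fun z => norm_nonneg _)
      ((ae_restrict_mem hQ).mono fun z hz => hdiam y hyQ z hz) fun r hr _ => ?_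
    refine (Measure.restrict_apply_le _ _).trans ((measure_mono fun z hz => ?_).trans (hy r hr))
    rwa [Metric.mem_closedBall', dist_eq_norm]
  rw [rieszEnergy, lintegral_prod _ (by fun_prop), ← Measure.restrict_apply_univ (μ := μ) Q,
    ← lintegral_const]
  exact lintegral_mono_ae hpotential

theorem rieszEnergy_restrict_dyadicCube_le [SFinite μ] (h : m < n) (hms : (m : ℝ) < s) (hC : 0 ≤ C)
    (hμ : ∀ᵐ y ∂μ, ∀ r, 0 < r → μ (Metric.closedBall y r) ≤ ENNReal.ofReal (C * r ^ s))
    (k : ℕ) (q : Fin n → ℤ) :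
    rieszEnergy m (μ.restrict (dyadicCube k q)) ≤
      ENNReal.ofReal (potentialConst m s * C * √n ^ (s - m) * ((1 / 2) ^ k) ^ (s - m)) *
        μ (dyadicCube k q) := by
  have hn : (0 : ℝ) < √n := Real.sqrt_pos.2 (Nat.cast_pos.2 (by lia))
  rw [mul_assoc (_ * C), ← Real.mul_rpow hn.le (by positivity)]
  exact rieszEnergy_restrict_le hms hC hμ (by positivity) (measurableSet_dyadicCube k q)
    fun y hy z hz => norm_sub_le_of_mem_dyadicCube hy hz

theorem exists_sum_lintegral_smoothed_dyadicCube_sq_le [IsFiniteMeasure μ] [NullSingletonClass μ]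
    (h : m < n) (hms : (m : ℝ) < s) (hC : 0 ≤ C)
    (hμ : ∀ᵐ y ∂μ, ∀ r, 0 < r → μ (Metric.closedBall y r) ≤ ENNReal.ofReal (C * r ^ s)) :
    ∃ D : ℝ, 0 ≤ D ∧ ∀ (k : ℕ) (𝒬 : Finset (Fin n → ℤ)) (δ : ℝ), 0 < δ →
      ∑ q ∈ 𝒬, ∫⁻ p, ENNReal.ofReal (smoothed m δ (μ.restrict (dyadicCube k q)) p ^ 2)
        ∂bundleMeasure n m ≤ ENNReal.ofReal (D * ((1 / 2) ^ k) ^ (s - m)) := by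
  obtain ⟨L, hL, hsmoothed⟩ := exists_lintegral_smoothed_sq_le (n := n) h
  set P := potentialConst m s * C * √n ^ (s - m)
  have hP : 0 ≤ P := by have := potentialConst_pos hms; positivity
  refine ⟨L.toReal * P * μ.real univ, by positivity, fun k 𝒬 δ hδ => ?_⟩
  set b := ENNReal.ofReal (P * ((1 / 2) ^ k) ^ (s - m))
  calc ∑ q ∈ 𝒬, ∫⁻ p, ENNReal.ofReal (smoothed m δ (μ.restrict (dyadicCube k q)) p ^ 2)
        ∂bundleMeasure n m
      ≤ ∑ q ∈ 𝒬, L * (b * μ (dyadicCube k q)) :=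
        Finset.sum_le_sum fun q _ => (hsmoothed _ δ hδ).trans
          (by gcongr; exact rieszEnergy_restrict_dyadicCube_le h hms hC hμ k q)
    _ = L * (b * μ (⋃ q ∈ 𝒬, dyadicCube k q)) := by
        rw [measure_biUnion_finset (fun q _ q' _ hne => disjoint_dyadicCube k hne)
          fun q _ => measurableSet_dyadicCube k q, Finset.mul_sum, Finset.mul_sum]
    _ ≤ L * (b * μ univ) := by gcongr; exact subset_univ _
    _ = ENNReal.ofReal (L.toReal * P * μ.real univ * ((1 / 2) ^ k) ^ (s - m)) := by
        rw [← ENNReal.ofReal_toReal hL, ← ofReal_measureReal, ← ENNReal.ofReal_mul (by positivity),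
          ← ENNReal.ofReal_mul (by positivity), ENNReal.toReal_ofReal ENNReal.toReal_nonneg]
        congr 1
        ring

theorem exists_finset_dyadicCube {K : Set (E n)} {R : ℝ} (hK : K ⊆ Metric.closedBall 0 R) (k : ℕ) :
    ∃ 𝒬 : Finset (Fin n → ℤ), ∀ y ∈ K, ∃ q ∈ 𝒬, y ∈ dyadicCube k q := by
  refine ⟨Fintype.piFinset fun _ => Finset.Icc ⌊-((2 : ℝ) ^ k * R)⌋ ⌊(2 : ℝ) ^ k * R⌋,
    fun y hy => ⟨fun i => ⌊(2 : ℝ) ^ k * y i⌋, Fintype.mem_piFinset.2 fun i => ?_, fun i => rfl⟩⟩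
  have hcoord : |y i| ≤ R := (PiLp.norm_apply_le y i).trans (mem_closedBall_zero_iff.1 (hK hy))
  have hscaled : |(2 : ℝ) ^ k * y i| ≤ 2 ^ k * R := by
    rw [abs_mul, abs_of_pos (by positivity : (0 : ℝ) < 2 ^ k)]
    gcongr
  exact Finset.mem_Icc.2
    ⟨Int.floor_le_floor (neg_le_of_abs_le hscaled), Int.floor_le_floor (le_of_abs_le hscaled)⟩

end Growth

/-! ### Equicontinuity of the smoothed projections -/

section Equicontinuity

theorem uniformEquicontinuous_comp_pi {ι κ α β γ : Type*} [UniformSpace α] [UniformSpace β]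
    [UniformSpace γ] {Φ : (κ → α) → γ} (hΦ : UniformContinuous Φ) {F : κ → ι → β → α}
    (hF : ∀ k, UniformEquicontinuous (F k)) :
    UniformEquicontinuous fun i x => Φ fun k => F k i x := by
  have hpi : UniformEquicontinuous fun i x k => F k i x := by
    have hF' : UniformContinuous fun (x : β) (k : κ) => UniformFun.ofFun fun i => F k i x :=
      uniformContinuous_pi.2 fun k => uniformEquicontinuous_iff_uniformContinuous.1 (hF k)
    exact uniformEquicontinuous_iff_uniformContinuous.2
      ((UniformFun.uniformEquivPiComm ι fun _ : κ => α).symm.uniformContinuous.comp hF')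
  exact fun U hU => hpi _ (hΦ hU)

theorem uniformContinuous_finsetSum {ι α β : Type*} [UniformSpace β] [AddCommGroup α]
    [UniformSpace α] [IsUniformAddGroup α] {f : ι → β → α} (I : Finset ι)
    (hf : ∀ i ∈ I, UniformContinuous (f i)) : UniformContinuous fun x => ∑ i ∈ I, f i x := by
  classical
  induction I using Finset.induction_on with
  | empty => simpa only [Finset.sum_empty] using uniformContinuous_const
  | insert i I hi ih =>
    simp only [Finset.sum_insert hi]
    exact (hf i (Finset.mem_insert_self i I)).add
      (ih fun k hk => hf k (Finset.mem_insert_of_mem hk))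

variable {n m : ℕ} {δ : ℝ} {μ : Measure (E n)}

theorem uniformContinuous_gaussKernel {F : Type*} [NormedAddCommGroup F] [ProperSpace F]
    (hδ : 0 < δ) : UniformContinuous (gaussKernel m δ : F → ℝ) := by
  refine (continuous_gaussKernel δ).uniformContinuous_of_tendsto_cocompact (x := 0) ?_
  have hnorm : Tendsto (fun v : F => ‖v‖ ^ 2 / δ ^ 2) (cocompact F) atTop :=
    ((tendsto_pow_atTop two_ne_zero).comp tendsto_norm_cocompact_atTop).atTop_div_const
      (by positivity)
  have hlim := (Real.tendsto_exp_neg_atTop_nhds_zero.comp hnorm).const_mul ((δ ^ m)⁻¹)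
  rwa [mul_zero] at hlim

theorem uniformEquicontinuous_smoothed [IsFiniteMeasure μ] (hδ : 0 < δ) :
    UniformEquicontinuous fun (g : O n) (u : LastSpace n m) => smoothed m δ μ (g, u) := by
  refine Metric.uniformEquicontinuous_iff.2 fun ε hε => ?_
  obtain ⟨η, hη, hker⟩ := Metric.uniformContinuous_iff.1
    (uniformContinuous_gaussKernel (F := LastSpace n m) (m := m) hδ) (ε / (μ.real univ + 1))
    (by positivity)
  refine ⟨η, hη, fun u v huv g => ?_⟩
  rw [dist_eq_norm, smoothed, smoothed, ← integral_sub (integrable_gaussKernel_transv hδ (g, u))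
    (integrable_gaussKernel_transv hδ (g, v))]
  have hdiff : ∀ᵐ y ∂μ, ‖gaussKernel m δ (transv m g y - u) - gaussKernel m δ (transv m g y - v)‖ ≤
      ε / (μ.real univ + 1) := .of_forall fun y => by
    rw [← dist_eq_norm]
    exact (hker (by rwa [dist_sub_left])).le
  refine (norm_integral_le_of_norm_le_const hdiff).trans_lt ?_
  rw [div_mul_eq_mul_div, div_lt_iff₀ (by positivity)]
  gcongr
  exact lt_add_one _

end Equicontinuity

/-! ### Sparse scales -/

section Scales

theorem exists_seq_tendsto_forall_consecutive {α : Type*} {l : Filter α} [l.NeBot]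
    [l.IsCountablyGenerated] {P : ℕ → α × α → Prop} (hP : ∀ j, ∀ᶠ d in l ×ˢ l, P j d) :
    ∃ δ : ℕ → α, Tendsto δ atTop l ∧ ∀ j, P j (δ (j + 1), δ j) := by
  choose V hV hVP using fun j => mem_prod_self_iff.1 (hP j)
  obtain ⟨B, hB⟩ := l.exists_antitone_basis
  have hmem (j : ℕ) : B j ∩ ⋂ i ∈ Finset.range (j + 1), V i ∈ l :=
    inter_mem (hB.mem j) ((biInter_finset_mem _).2 fun i _ => hV i)
  choose δ hδB hδV using fun j => l.nonempty_of_mem (hmem j)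
  rw [forall_congr' fun _ => mem_iInter₂] at hδV
  exact ⟨δ, hB.tendsto hδB, fun j => hVP j ⟨hδV (j + 1) j (by simp), hδV j j (by simp)⟩⟩

variable {n m : ℕ}

theorem tendsto_lintegral_sum_abs_smoothed_sub_sq (h : m < n) {ι : Type*} (I : Finset ι)
    {ν : ι → Measure (E n)} [∀ i, IsFiniteMeasure (ν i)] [∀ i, NullSingletonClass (ν i)]
    (hE : ∀ i ∈ I, rieszEnergy m (ν i) ≠ ∞) :
    Tendsto (fun d : ℝ × ℝ => ∫⁻ p, ENNReal.ofReal
      ((∑ i ∈ I, |smoothed m d.1 (ν i) p - smoothed m d.2 (ν i) p|) ^ 2) ∂bundleMeasure n m)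
      (𝓝[>] 0 ×ˢ 𝓝[>] 0) (𝓝 0) := by
  have hsum : Tendsto (fun d : ℝ × ℝ => (I.card : ℝ≥0∞) * ∑ i ∈ I, ∫⁻ p, ENNReal.ofReal
      ((smoothed m d.1 (ν i) p - smoothed m d.2 (ν i) p) ^ 2) ∂bundleMeasure n m)
      (𝓝[>] 0 ×ˢ 𝓝[>] 0) (𝓝 0) := by
    have := ENNReal.Tendsto.const_mul (a := I.card) (tendsto_finsetSum I fun i hi =>
      tendsto_lintegral_smoothed_sub_sq h (hE i hi)) (.inr (ENNReal.natCast_ne_top _))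
    simpa only [Finset.sum_const_zero, mul_zero] using this
  refine tendsto_of_tendsto_of_tendsto_of_le_of_le tendsto_const_nhds hsum (fun _ => zero_le)
    fun d => ?_
  dsimp only
  rw [← lintegral_finsetSum I fun i _ => by fun_prop,
    ← lintegral_const_mul' (I.card : ℝ≥0∞) _ (ENNReal.natCast_ne_top _)]
  refine lintegral_mono fun p => ?_
  rw [← ENNReal.ofReal_sum_of_nonneg fun i _ => sq_nonneg _, ← ENNReal.ofReal_natCast,
    ← ENNReal.ofReal_mul (Nat.cast_nonneg _)]
  simpa only [sq_abs] using ENNReal.ofReal_le_ofReal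
    (sq_sum_le_card_mul_sum_sq (s := I)
      (f := fun i => |smoothed m d.1 (ν i) p - smoothed m d.2 (ν i) p|))

end Scales

/-! ### Control of the dyadic pieces along a sequence of scales -/

section Control

variable {n : ℕ} (m : ℕ) (s : ℝ) (μ : Measure (E n)) (𝒬 : ℕ → Finset (Fin n → ℤ)) (δ : ℕ → ℝ)

/-- The density at scale `δ j` of the projections of the restriction of `μ` to the dyadic cube
of level `k` and position `q`. -/
def pieceDensity (j k : ℕ) (q : Fin n → ℤ) (p : O n × LastSpace n m) : ℝ :=
  smoothed m (δ j) (μ.restrict (dyadicCube k q)) p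

/-- The total change from scale `δ j` to scale `δ (j + 1)` of the densities of the pieces of
levels at most `j`. -/
def increment (j : ℕ) (p : O n × LastSpace n m) : ℝ :=
  ∑ a ∈ (Finset.range (j + 1)).sigma 𝒬,
    |pieceDensity m μ δ (j + 1) a.1 a.2 p - pieceDensity m μ δ j a.1 a.2 p|

/-- The `ℓ²` norm of the densities at scale `δ j` of the pieces of level `j`. -/
def levelNorm (j : ℕ) (p : O n × LastSpace n m) : ℝ :=
  ‖WithLp.toLp 2 fun q : 𝒬 j => pieceDensity m μ δ j j q p‖

/-- The weight of level `j`: the sum of the squared `L²` norms of the densities of the pieces of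
level `j` is of order `levelWeight m s j ^ (-2)` when `μ` has growth of order `s`. -/
def levelWeight (j : ℕ) : ℝ := ((2 : ℝ) ^ j) ^ ((s - m) / 2)

/-- A common bound for the convergence and for the energy of the densities: summability of
`sliceControl` along `j` gives the first, its boundedness the second. The factor `(j + 1) ^ (-4)`
makes its `L²` norm summable. -/
def sliceControl (j : ℕ) (p : O n × LastSpace n m) : ℝ :=
  levelWeight m s j * increment m μ 𝒬 δ j p +
    levelWeight m s j / ((j : ℝ) + 1) ^ 4 * levelNorm m μ 𝒬 δ j p

end Control

section ControlLemmas

variable {n m : ℕ} {s : ℝ} {μ : Measure (E n)} {𝒬 : ℕ → Finset (Fin n → ℤ)} {δ : ℕ → ℝ}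

theorem levelWeight_pos (j : ℕ) : 0 < levelWeight m s j := by
  unfold levelWeight; positivity

theorem levelWeight_sq (j : ℕ) : levelWeight m s j ^ 2 = ((2 : ℝ) ^ j) ^ (s - m) := by
  rw [levelWeight, ← Real.rpow_mul_natCast (by positivity), Nat.cast_ofNat,
    div_mul_cancel₀ _ two_ne_zero]

theorem levelWeight_mono (hms : (m : ℝ) ≤ s) : Monotone (levelWeight m s) := fun i j hij =>
  Real.rpow_le_rpow (by positivity) (pow_le_pow_right₀ one_le_two hij)
    (div_nonneg (sub_nonneg.2 hms) zero_le_two)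

theorem one_le_levelWeight (hms : (m : ℝ) ≤ s) (j : ℕ) : 1 ≤ levelWeight m s j :=
  Real.one_le_rpow (one_le_pow₀ one_le_two) (div_nonneg (sub_nonneg.2 hms) zero_le_two)

theorem increment_nonneg (j : ℕ) (p : O n × LastSpace n m) : 0 ≤ increment m μ 𝒬 δ j p :=
  Finset.sum_nonneg fun _ _ => abs_nonneg _

theorem levelNorm_nonneg (j : ℕ) (p : O n × LastSpace n m) : 0 ≤ levelNorm m μ 𝒬 δ j p :=
  norm_nonneg _

theorem levelNorm_sq (j : ℕ) (p : O n × LastSpace n m) :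
    levelNorm m μ 𝒬 δ j p ^ 2 = ∑ q ∈ 𝒬 j, pieceDensity m μ δ j j q p ^ 2 := by
  rw [levelNorm, EuclideanSpace.real_norm_sq_eq]
  exact Finset.sum_coe_sort (𝒬 j) fun q => pieceDensity m μ δ j j q p ^ 2

theorem weight_mul_increment_le_sliceControl (j : ℕ) (p : O n × LastSpace n m) :
    levelWeight m s j * increment m μ 𝒬 δ j p ≤ sliceControl m s μ 𝒬 δ j p :=
  le_add_of_nonneg_right <|
    mul_nonneg (div_nonneg (levelWeight_pos j).le (by positivity)) (levelNorm_nonneg j p)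

theorem weight_mul_levelNorm_le_sliceControl (j : ℕ) (p : O n × LastSpace n m) :
    levelWeight m s j / ((j : ℝ) + 1) ^ 4 * levelNorm m μ 𝒬 δ j p ≤ sliceControl m s μ 𝒬 δ j p :=
  le_add_of_nonneg_left <| mul_nonneg (levelWeight_pos j).le (increment_nonneg j p)

theorem sliceControl_nonneg (j : ℕ) (p : O n × LastSpace n m) : 0 ≤ sliceControl m s μ 𝒬 δ j p :=
  (mul_nonneg (levelWeight_pos j).le (increment_nonneg j p)).trans
    (weight_mul_increment_le_sliceControl j p)

variable [IsFiniteMeasure μ]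

@[fun_prop]
theorem measurable_pieceDensity (j k : ℕ) (q : Fin n → ℤ) :
    Measurable (pieceDensity m μ δ j k q) := measurable_smoothed

@[fun_prop]
theorem measurable_increment (j : ℕ) : Measurable (increment m μ 𝒬 δ j) := by
  unfold increment
  fun_prop

@[fun_prop]
theorem measurable_levelNorm (j : ℕ) : Measurable (levelNorm m μ 𝒬 δ j) := by
  unfold levelNorm
  fun_prop

theorem measurable_sliceControl (j : ℕ) : Measurable (sliceControl m s μ 𝒬 δ j) := by
  unfold sliceControl
  fun_prop

theorem uniformEquicontinuous_sliceControl (hδ : ∀ j, 0 < δ j) (j : ℕ) :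
    UniformEquicontinuous fun (g : O n) (u : LastSpace n m) => sliceControl m s μ 𝒬 δ j (g, u) := by
  let Φ : (ℕ × (Σ _ : ℕ, Fin n → ℤ) → ℝ) → ℝ := fun x =>
    levelWeight m s j * ∑ a ∈ (Finset.range (j + 1)).sigma 𝒬, |x (j + 1, a) - x (j, a)| +
      levelWeight m s j / ((j : ℝ) + 1) ^ 4 * ‖WithLp.toLp 2 fun q : 𝒬 j => x (j, ⟨j, q⟩)‖
  have hΦ : UniformContinuous Φ := by
    have hsum : UniformContinuous fun x : ℕ × (Σ _ : ℕ, Fin n → ℤ) → ℝ =>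
        ∑ a ∈ (Finset.range (j + 1)).sigma 𝒬, |x (j + 1, a) - x (j, a)| :=
      uniformContinuous_finsetSum _ fun a _ => Real.uniformContinuous_abs.comp <|
        (Pi.uniformContinuous_proj _ _).sub (Pi.uniformContinuous_proj _ _)
    have hnorm : UniformContinuous fun x : ℕ × (Σ _ : ℕ, Fin n → ℤ) → ℝ =>
        ‖WithLp.toLp 2 fun q : 𝒬 j => x (j, ⟨j, q⟩)‖ :=
      uniformContinuous_norm.comp <| (PiLp.uniformContinuous_toLp 2 _).comp <|
        uniformContinuous_pi.2 fun q => Pi.uniformContinuous_proj _ _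
    exact (hsum.const_mul' _).add (hnorm.const_mul' _)
  exact uniformEquicontinuous_comp_pi hΦ
    (F := fun k g u => pieceDensity m μ δ k.1 k.2.1 k.2.2 (g, u))
    fun k => uniformEquicontinuous_smoothed (hδ k.1)

theorem exists_scales_increment_le [NullSingletonClass μ] (h : m < n)
    (hE : ∀ k q, rieszEnergy m (μ.restrict (dyadicCube k q)) ≠ ∞) (𝒬 : ℕ → Finset (Fin n → ℤ))
    {η : ℕ → ℝ} (hη : ∀ j, 0 < η j) : ∃ δ : ℕ → ℝ, (∀ j, 0 < δ j) ∧ Tendsto δ atTop (𝓝[>] 0) ∧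
      ∀ j, ∫⁻ p, ENNReal.ofReal (increment m μ 𝒬 δ j p ^ 2) ∂bundleMeasure n m ≤
        ENNReal.ofReal (η j) := by
  have hev (j : ℕ) : ∀ᶠ d : ℝ × ℝ in 𝓝[>] 0 ×ˢ 𝓝[>] 0, 0 < d.2 ∧ ∫⁻ p, ENNReal.ofReal
      ((∑ a ∈ (Finset.range (j + 1)).sigma 𝒬, |smoothed m d.1 (μ.restrict (dyadicCube a.1 a.2)) p -
        smoothed m d.2 (μ.restrict (dyadicCube a.1 a.2)) p|) ^ 2) ∂bundleMeasure n m ≤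
          ENNReal.ofReal (η j) :=
    (tendsto_snd.eventually self_mem_nhdsWithin).and <|
      (tendsto_lintegral_sum_abs_smoothed_sub_sq h _ fun a _ => hE a.1 a.2).eventually_le_const
        (ENNReal.ofReal_pos.2 (hη j))
  obtain ⟨δ, hδ, hδP⟩ := exists_seq_tendsto_forall_consecutive hev
  exact ⟨δ, fun j => (hδP j).1, hδ, fun j => (hδP j).2⟩

theorem lintegral_levelNorm_sq (j : ℕ) :
    ∫⁻ p, ENNReal.ofReal (levelNorm m μ 𝒬 δ j p ^ 2) ∂bundleMeasure n m =
      ∑ q ∈ 𝒬 j, ∫⁻ p, ENNReal.ofReal (pieceDensity m μ δ j j q p ^ 2) ∂bundleMeasure n m := by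
  rw [← lintegral_finsetSum _ fun q _ => by fun_prop]
  refine lintegral_congr fun p => ?_
  rw [levelNorm_sq, ENNReal.ofReal_sum_of_nonneg fun q _ => sq_nonneg _]

theorem lintegral_mul_add_mul_sq_le {α : Type*} [MeasurableSpace α] {ν : Measure α} {f g : α → ℝ}
    (hf : Measurable f) (a b : ℝ) :
    ∫⁻ x, ENNReal.ofReal ((a * f x + b * g x) ^ 2) ∂ν ≤
      ENNReal.ofReal (2 * a ^ 2) * ∫⁻ x, ENNReal.ofReal (f x ^ 2) ∂ν +
        ENNReal.ofReal (2 * b ^ 2) * ∫⁻ x, ENNReal.ofReal (g x ^ 2) ∂ν := by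
  rw [← lintegral_const_mul' _ _ ENNReal.ofReal_ne_top,
    ← lintegral_const_mul' _ _ ENNReal.ofReal_ne_top, ← lintegral_add_left (by fun_prop)]
  refine lintegral_mono fun x => ?_
  rw [← ENNReal.ofReal_mul (by positivity), ← ENNReal.ofReal_mul (by positivity),
    ← ENNReal.ofReal_add (by positivity) (by positivity)]
  refine ENNReal.ofReal_le_ofReal (add_sq_le.trans_eq ?_)
  ring

theorem lintegral_sliceControl_sq_le {D : ℝ} (hD : 0 ≤ D) (hδ : ∀ j, 0 < δ j)
    (hlev : ∀ (k : ℕ) (𝒯 : Finset (Fin n → ℤ)) (ε : ℝ), 0 < ε →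
      ∑ q ∈ 𝒯, ∫⁻ p, ENNReal.ofReal (smoothed m ε (μ.restrict (dyadicCube k q)) p ^ 2)
        ∂bundleMeasure n m ≤ ENNReal.ofReal (D * ((1 / 2 : ℝ) ^ k) ^ (s - m)))
    (j : ℕ) (hinc : ∫⁻ p, ENNReal.ofReal (increment m μ 𝒬 δ j p ^ 2) ∂bundleMeasure n m ≤
      ENNReal.ofReal (1 / (levelWeight m s j ^ 2 * ((j : ℝ) + 1) ^ 8))) :
    ∫⁻ p, ENNReal.ofReal (sliceControl m s μ 𝒬 δ j p ^ 2) ∂bundleMeasure n m ≤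
      ENNReal.ofReal ((2 + 2 * D) / ((j : ℝ) + 1) ^ 8) := by
  have hW := levelWeight_pos (m := m) (s := s) j
  have hnorm : ∫⁻ p, ENNReal.ofReal (levelNorm m μ 𝒬 δ j p ^ 2) ∂bundleMeasure n m ≤
      ENNReal.ofReal (D / levelWeight m s j ^ 2) := by
    rw [lintegral_levelNorm_sq, levelWeight_sq, div_eq_mul_inv, ← Real.inv_rpow (by positivity),
      ← inv_pow, ← one_div]
    exact hlev j (𝒬 j) (δ j) (hδ j)
  refine (lintegral_mul_add_mul_sq_le (measurable_increment j) _ _).trans ?_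
  refine (add_le_add (mul_le_mul_right hinc _) (mul_le_mul_right hnorm _)).trans_eq ?_
  rw [← ENNReal.ofReal_mul (by positivity), ← ENNReal.ofReal_mul (by positivity),
    ← ENNReal.ofReal_add (by positivity) (by positivity)]
  congr 1
  field_simp

end ControlLemmas

section Energy

variable {n m : ℕ} {s : ℝ} {μ : Measure (E n)} {𝒬 : ℕ → Finset (Fin n → ℤ)} {δ : ℕ → ℝ}
  {p : O n × LastSpace n m}

theorem sum_abs_sub_le_increment {k j : ℕ} (hkj : k ≤ j) (p : O n × LastSpace n m) :
    ∑ q ∈ 𝒬 k, |pieceDensity m μ δ (j + 1) k q p - pieceDensity m μ δ j k q p| ≤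
      increment m μ 𝒬 δ j p := by
  rw [increment, Finset.sum_sigma]
  exact Finset.single_le_sum (f := fun k => ∑ q ∈ 𝒬 k,
    |pieceDensity m μ δ (j + 1) k q p - pieceDensity m μ δ j k q p|)
    (fun i _ => Finset.sum_nonneg fun _ _ => abs_nonneg _)
    (Finset.mem_range.2 (Nat.lt_succ_of_le hkj))

theorem sum_sq_le_two_mul_sum_sq_add {ι : Type*} (I : Finset ι) (x y : ι → ℝ) :
    ∑ i ∈ I, x i ^ 2 ≤ 2 * ∑ i ∈ I, y i ^ 2 + 2 * (∑ i ∈ I, |x i - y i|) ^ 2 := by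
  have hdiff : ∑ i ∈ I, (x i - y i) ^ 2 ≤ (∑ i ∈ I, |x i - y i|) ^ 2 := by
    simpa only [sq_abs] using
      Finset.sum_sq_le_sq_sum_of_nonneg (s := I) (f := fun i => |x i - y i|) fun _ _ => abs_nonneg _
  calc ∑ i ∈ I, x i ^ 2 ≤ ∑ i ∈ I, 2 * (y i ^ 2 + (x i - y i) ^ 2) :=
        Finset.sum_le_sum fun i _ => by
          simpa only [add_sub_cancel] using add_sq_le (a := y i) (b := x i - y i)
    _ = 2 * ∑ i ∈ I, y i ^ 2 + 2 * ∑ i ∈ I, (x i - y i) ^ 2 := by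
        rw [← Finset.mul_sum, Finset.sum_add_distrib, mul_add]
    _ ≤ _ := by gcongr

theorem levelNorm_le (hsum : Summable fun j => sliceControl m s μ 𝒬 δ j p) (k : ℕ) :
    levelNorm m μ 𝒬 δ k p ≤
      (∑' i, sliceControl m s μ 𝒬 δ i p) * ((k : ℝ) + 1) ^ 4 / levelWeight m s k := by
  have hle := (weight_mul_levelNorm_le_sliceControl (s := s) k p).trans
    (hsum.le_tsum k fun i _ => sliceControl_nonneg i p)
  rw [div_mul_eq_mul_div, div_le_iff₀ (by positivity)] at hle
  rwa [le_div_iff₀' (levelWeight_pos k)]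

theorem sum_abs_pieceDensity_sub_le (hms : (m : ℝ) ≤ s)
    (hsum : Summable fun j => sliceControl m s μ 𝒬 δ j p) {k j : ℕ} (hkj : k ≤ j) :
    ∑ q ∈ 𝒬 k, |pieceDensity m μ δ j k q p - pieceDensity m μ δ k k q p| ≤
      (∑' i, sliceControl m s μ 𝒬 δ i p) / levelWeight m s k := by
  have hW : 0 < levelWeight m s k := levelWeight_pos k
  calc ∑ q ∈ 𝒬 k, |pieceDensity m μ δ j k q p - pieceDensity m μ δ k k q p|
      ≤ ∑ q ∈ 𝒬 k, ∑ i ∈ Finset.Ico k j,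
        |pieceDensity m μ δ (i + 1) k q p - pieceDensity m μ δ i k q p| := by
        refine Finset.sum_le_sum fun q _ => ?_
        rw [← Finset.sum_Ico_sub (fun i => pieceDensity m μ δ i k q p) hkj]
        exact Finset.abs_sum_le_sum_abs _ _
    _ ≤ ∑ i ∈ Finset.Ico k j, increment m μ 𝒬 δ i p := by
        rw [Finset.sum_comm]
        exact Finset.sum_le_sum fun i hi => sum_abs_sub_le_increment (Finset.mem_Ico.1 hi).1 p
    _ ≤ ∑ i ∈ Finset.Ico k j, sliceControl m s μ 𝒬 δ i p / levelWeight m s k := by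
        refine Finset.sum_le_sum fun i hi => (le_div_iff₀' hW).2 ?_
        refine le_trans ?_ (weight_mul_increment_le_sliceControl i p)
        exact mul_le_mul_of_nonneg_right (levelWeight_mono hms (Finset.mem_Ico.1 hi).1)
          (increment_nonneg i p)
    _ ≤ (∑' i, sliceControl m s μ 𝒬 δ i p) / levelWeight m s k := by
        rw [← Finset.sum_div]
        gcongr
        exact hsum.sum_le_tsum _ fun i _ => sliceControl_nonneg i p

theorem sum_sq_pieceDensity_le (hms : (m : ℝ) ≤ s)
    (hsum : Summable fun j => sliceControl m s μ 𝒬 δ j p) {k j : ℕ} (hkj : k ≤ j) :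
    ∑ q ∈ 𝒬 k, pieceDensity m μ δ j k q p ^ 2 ≤
      4 * (∑' i, sliceControl m s μ 𝒬 δ i p) ^ 2 * ((k : ℝ) + 1) ^ 8 / levelWeight m s k ^ 2 := by
  set M := ∑' i, sliceControl m s μ 𝒬 δ i p
  set W := levelWeight m s k
  have hlevel : ∑ q ∈ 𝒬 k, pieceDensity m μ δ k k q p ^ 2 ≤ (M * ((k : ℝ) + 1) ^ 4 / W) ^ 2 := by
    rw [← levelNorm_sq]
    exact pow_le_pow_left₀ (levelNorm_nonneg k p) (levelNorm_le hsum k) 2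
  calc ∑ q ∈ 𝒬 k, pieceDensity m μ δ j k q p ^ 2
      ≤ 2 * ∑ q ∈ 𝒬 k, pieceDensity m μ δ k k q p ^ 2 +
          2 * (∑ q ∈ 𝒬 k, |pieceDensity m μ δ j k q p - pieceDensity m μ δ k k q p|) ^ 2 :=
        sum_sq_le_two_mul_sum_sq_add _ _ _
    _ ≤ 2 * (M * ((k : ℝ) + 1) ^ 4 / W) ^ 2 + 2 * (M / W) ^ 2 := by
        gcongr
        exact sum_abs_pieceDensity_sub_le hms hsum hkj
    _ ≤ 2 * (M * ((k : ℝ) + 1) ^ 4 / W) ^ 2 + 2 * ((M / W) ^ 2 * ((k : ℝ) + 1) ^ 8) := by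
        gcongr
        exact le_mul_of_one_le_right (by positivity)
          (one_le_pow₀ (le_add_of_nonneg_left k.cast_nonneg))
    _ = _ := by ring

theorem summable_levelWeight_bound {t : ℝ} (ht : t < s - m) (M : ℝ) :
    Summable fun k : ℕ => ((2 : ℝ) ^ k) ^ t *
      (4 * M ^ 2 * ((k : ℝ) + 1) ^ 8 / levelWeight m s k ^ 2) := by
  set r : ℝ := (2 : ℝ) ^ (t - (s - m))
  have hr0 : 0 < r := by positivity
  have hr1 : ‖r‖ < 1 := by
    rw [Real.norm_of_nonneg hr0.le]
    exact Real.rpow_lt_one_of_one_lt_of_neg one_lt_two (sub_neg.2 ht)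
  have hgeom : Summable fun k : ℕ => (k : ℝ) ^ 8 * r ^ k :=
    summable_pow_mul_geometric_of_norm_lt_one 8 hr1
  refine (((summable_nat_add_iff 1).2 hgeom).mul_left (4 * M ^ 2 * r⁻¹)).congr fun k => ?_
  have hratio : ((2 : ℝ) ^ k) ^ t / levelWeight m s k ^ 2 = r ^ k := by
    rw [levelWeight_sq, ← Real.rpow_sub (by positivity), Real.rpow_pow_comm zero_le_two]
  calc 4 * M ^ 2 * r⁻¹ * (((k + 1 : ℕ) : ℝ) ^ 8 * r ^ (k + 1))
      = 4 * M ^ 2 * ((k : ℝ) + 1) ^ 8 * r ^ k * (r⁻¹ * r) := by push_cast; ring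
    _ = ((2 : ℝ) ^ k) ^ t * (4 * M ^ 2 * ((k : ℝ) + 1) ^ 8 / levelWeight m s k ^ 2) := by
        rw [inv_mul_cancel₀ hr0.ne', mul_one, ← hratio]
        ring

end Energy

section Covering

variable {n m : ℕ} {s : ℝ} {μ : Measure (E n)} [IsFiniteMeasure μ]
  {𝒬 : ℕ → Finset (Fin n → ℤ)} {δ : ℕ → ℝ} {K : Set (E n)}

theorem smoothed_eq_sum_pieceDensity (hμK : μ Kᶜ = 0) {k : ℕ}
    (h𝒬 : ∀ y ∈ K, ∃ q ∈ 𝒬 k, y ∈ dyadicCube k q) {j : ℕ} (hδ : 0 < δ j)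
    (p : O n × LastSpace n m) :
    smoothed m (δ j) μ p = ∑ q ∈ 𝒬 k, pieceDensity m μ δ j k q p := by
  have hcover : ∀ᵐ y ∂μ, y ∈ ⋃ q ∈ 𝒬 k, dyadicCube k q :=
    measure_mono_null (compl_subset_compl.2 fun y hy => by simpa using h𝒬 y hy) hμK
  have hsum := integral_biUnion_finset (𝒬 k) (fun q _ => measurableSet_dyadicCube k q)
    (fun q _ q' _ hne => disjoint_dyadicCube k hne)
    fun q _ => (integrable_gaussKernel_transv (μ := μ) hδ p).integrableOn
  rwa [Measure.restrict_eq_self_of_ae_mem hcover] at hsum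

theorem abs_smoothed_sub_le_sliceControl (hms : (m : ℝ) ≤ s) (hμK : μ Kᶜ = 0)
    (h𝒬 : ∀ y ∈ K, ∃ q ∈ 𝒬 0, y ∈ dyadicCube 0 q) (hδ : ∀ j, 0 < δ j) (j : ℕ)
    (p : O n × LastSpace n m) :
    |smoothed m (δ (j + 1)) μ p - smoothed m (δ j) μ p| ≤ sliceControl m s μ 𝒬 δ j p := by
  rw [smoothed_eq_sum_pieceDensity hμK h𝒬 (hδ _), smoothed_eq_sum_pieceDensity hμK h𝒬 (hδ _),
    ← Finset.sum_sub_distrib]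
  calc _ ≤ increment m μ 𝒬 δ j p :=
        (Finset.abs_sum_le_sum_abs _ _).trans (sum_abs_sub_le_increment j.zero_le p)
    _ ≤ levelWeight m s j * increment m μ 𝒬 δ j p :=
        le_mul_of_one_le_left (increment_nonneg j p) (one_le_levelWeight hms j)
    _ ≤ sliceControl m s μ 𝒬 δ j p := weight_mul_increment_le_sliceControl j p

end Covering

/-! ### Measures on the slices -/

section Slices

variable {n m : ℕ} {μ : Measure (E n)} {K : Set (E n)}

theorem tendsto_gaussKernel_nhdsGT_zero {F : Type*} [NormedAddCommGroup F] {v : F} (hv : v ≠ 0) :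
    Tendsto (fun ε => gaussKernel m ε v) (𝓝[>] 0) (𝓝 0) := by
  have hexp := tendsto_rpow_abs_mul_exp_neg_mul_sq_cocompact (pow_pos (norm_pos_iff.2 hv) 2) m
  refine ((hexp.mono_left atTop_le_cocompact).comp tendsto_inv_nhdsGT_zero).congr' ?_
  filter_upwards [self_mem_nhdsWithin] with ε (hε : 0 < ε)
  simp only [gaussKernel, Function.comp_apply, abs_of_pos (inv_pos.2 hε), Real.rpow_natCast,
    inv_pow, neg_mul, div_eq_mul_inv]

/-- The measure `μ` weighted by the Gaussian kernel at scale `ε` centred at the fibre `p`: its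
weak limits as `ε → 0` live on the slice over `p`. -/
def sliceMeasure (m : ℕ) (ε : ℝ) (μ : Measure (E n)) (p : O n × LastSpace n m) :
    Measure (E n) :=
  μ.withDensity fun y => ENNReal.ofReal (gaussKernel m ε (transv m p.1 y - p.2))

theorem sliceMeasure_apply_eq_zero {ε : ℝ} {p : O n × LastSpace n m} {A : Set (E n)}
    (hA : μ A = 0) : sliceMeasure m ε μ p A = 0 :=
  withDensity_absolutelyContinuous _ _ hA

variable [IsFiniteMeasure μ]

theorem sliceMeasure_apply {ε : ℝ} (hε : 0 < ε) (p : O n × LastSpace n m) {A : Set (E n)}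
    (hA : MeasurableSet A) :
    sliceMeasure m ε μ p A = ENNReal.ofReal (smoothed m ε (μ.restrict A) p) := by
  rw [sliceMeasure, withDensity_apply _ hA, ofReal_smoothed hε]

theorem sliceMeasure_real_apply {ε : ℝ} (hε : 0 < ε) (p : O n × LastSpace n m) {A : Set (E n)}
    (hA : MeasurableSet A) : (sliceMeasure m ε μ p).real A = smoothed m ε (μ.restrict A) p := by
  rw [Measure.real, sliceMeasure_apply hε p hA, ENNReal.toReal_ofReal (smoothed_nonneg hε p)]

theorem isFiniteMeasure_sliceMeasure {ε : ℝ} (hε : 0 < ε) (p : O n × LastSpace n m) :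
    IsFiniteMeasure (sliceMeasure m ε μ p) :=
  ⟨by rw [sliceMeasure_apply hε p MeasurableSet.univ]; exact ENNReal.ofReal_lt_top⟩

theorem tendsto_sliceMeasure_diff (hK : IsCompact K) (g : O n) (x : E n) {U : Set (E n)}
    (hU : IsOpen U) (hKU : K ∩ {y | transv m g (y - x) = 0} ⊆ U) :
    Tendsto (fun ε => (sliceMeasure m ε μ (g, transv m g x)).real (K \ U)) (𝓝[>] 0) (𝓝 0) := by
  have hKd : IsCompact (K \ U) := hK.diff hU
  rcases (K \ U).eq_empty_or_nonempty with hempty | hne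
  · simp only [hempty, measureReal_empty, tendsto_const_nhds]
  have hcont : Continuous fun y => ‖transv m g (y - x)‖ := by fun_prop
  obtain ⟨y₀, hy₀, hmin⟩ := hKd.exists_isMinOn hne hcont.continuousOn
  have hy₀' : transv m g (y₀ - x) ≠ 0 := fun h0 => hy₀.2 (hKU ⟨hy₀.1, h0⟩)
  have hlim := (tendsto_gaussKernel_nhdsGT_zero (m := m) hy₀').mul_const (μ.real (K \ U))
  rw [zero_mul] at hlim
  refine squeeze_zero' (.of_forall fun ε => measureReal_nonneg) ?_ hlim
  filter_upwards [self_mem_nhdsWithin] with ε (hε : 0 < ε)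
  have hle : ∀ y ∈ K \ U, gaussKernel m ε (transv m g y - transv m g x) ≤
      gaussKernel m ε (transv m g (y₀ - x)) := fun y hy => by
    have hnorm : ‖transv m g (y₀ - x)‖ ≤ ‖transv m g (y - x)‖ := hmin hy
    rw [← map_sub, gaussKernel, gaussKernel]
    gcongr
  rw [sliceMeasure_real_apply hε _ hKd.measurableSet, smoothed]
  calc _ ≤ ∫ _ in K \ U, gaussKernel m ε (transv m g (y₀ - x)) ∂μ :=
        setIntegral_mono_on (integrable_gaussKernel_transv hε (g, transv m g x)).integrableOn
          (integrable_const _).integrableOn hKd.measurableSet hle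
    _ = _ := by rw [setIntegral_const, smul_eq_mul, mul_comm]

variable {s : ℝ} {𝒬 : ℕ → Finset (Fin n → ℤ)} {δ : ℕ → ℝ}

theorem sum_sq_sliceMeasure_le (hms : (m : ℝ) ≤ s) (hμK : μ Kᶜ = 0)
    (h𝒬 : ∀ k, ∀ y ∈ K, ∃ q ∈ 𝒬 k, y ∈ dyadicCube k q) {p : O n × LastSpace n m}
    (hsum : Summable fun j => sliceControl m s μ 𝒬 δ j p) {k j : ℕ} (hδ : 0 < δ j)
    (hkj : k ≤ j) (𝒯 : Finset (Fin n → ℤ)) :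
    ∑ q ∈ 𝒯, (sliceMeasure m (δ j) μ p).real (dyadicCube k q) ^ 2 ≤
      4 * (∑' i, sliceControl m s μ 𝒬 δ i p) ^ 2 * ((k : ℝ) + 1) ^ 8 / levelWeight m s k ^ 2 := by
  refine le_trans ?_ (sum_sq_pieceDensity_le hms hsum hkj)
  have hzero : ∀ q ∉ 𝒬 k, (sliceMeasure m (δ j) μ p).real (dyadicCube k q) ^ 2 = 0 := by
    intro q hq
    have hsub : dyadicCube k q ⊆ Kᶜ := fun y hy hyK => by
      obtain ⟨q', hq', hy'⟩ := h𝒬 k y hyK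
      exact (disjoint_dyadicCube k fun h : q = q' => hq (h ▸ hq')).le_bot ⟨hy, hy'⟩
    rw [Measure.real, sliceMeasure_apply_eq_zero (measure_mono_null hsub hμK), ENNReal.toReal_zero,
      zero_pow two_ne_zero]
  classical
  calc ∑ q ∈ 𝒯, (sliceMeasure m (δ j) μ p).real (dyadicCube k q) ^ 2
      = ∑ q ∈ 𝒯 with q ∈ 𝒬 k, (sliceMeasure m (δ j) μ p).real (dyadicCube k q) ^ 2 :=
        (Finset.sum_filter_of_ne fun q _ => not_imp_comm.1 (hzero q)).symm
    _ ≤ ∑ q ∈ 𝒬 k, (sliceMeasure m (δ j) μ p).real (dyadicCube k q) ^ 2 :=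
        Finset.sum_le_sum_of_subset_of_nonneg (fun q hq => (Finset.mem_filter.1 hq).2)
          fun _ _ _ => sq_nonneg _
    _ = ∑ q ∈ 𝒬 k, pieceDensity m μ δ j k q p ^ 2 :=
        Finset.sum_congr rfl fun q _ => by
          rw [sliceMeasure_real_apply hδ p (measurableSet_dyadicCube k q), pieceDensity]

theorem le_dimH_slice (hms : (m : ℝ) ≤ s) (hK : IsCompact K) (hμK : μ Kᶜ = 0)
    (h𝒬 : ∀ k, ∀ y ∈ K, ∃ q ∈ 𝒬 k, y ∈ dyadicCube k q) (hδ : ∀ j, 0 < δ j)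
    (hδt : Tendsto δ atTop (𝓝[>] 0)) {g : O n} {x : E n}
    (hsum : Summable fun j => sliceControl m s μ 𝒬 δ j (g, transv m g x)) {c : ℝ} (hc : 0 < c)
    (hlim : Tendsto (fun j => smoothed m (δ j) μ (g, transv m g x)) atTop (𝓝 c)) :
    ENNReal.ofReal (s - m) ≤ dimH (K ∩ {y | transv m g (y - x) = 0}) := by
  have hclosed : IsClosed {y : E n | transv m g (y - x) = 0} :=
    isClosed_eq (by fun_prop) continuous_const
  have hmass : ∀ᶠ j in atTop,
      c / 2 ≤ (sliceMeasure m (δ j) μ (g, transv m g x)).real univ := by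
    filter_upwards [hlim.eventually_const_le (half_lt_self hc)] with j hj
    rwa [sliceMeasure_real_apply (hδ j) _ MeasurableSet.univ, Measure.restrict_univ]
  have hfin (j : ℕ) := isFiniteMeasure_sliceMeasure (μ := μ) (hδ j) (g, transv m g x)
  refine ENNReal.le_of_forall_nnreal_lt fun t ht => ?_
  rw [ENNReal.lt_ofReal_iff_toReal_lt ENNReal.coe_ne_top, ENNReal.coe_toReal] at ht
  obtain rfl | ht0 := eq_zero_or_pos t
  · exact zero_le
  exact le_dimH_of_hausdorffMeasure_ne_zero <|
    hausdorffMeasure_ne_zero_of_dyadic_sq_sum_le (NNReal.coe_pos.2 ht0) (hK.inter_right hclosed)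
      (fun j => sliceMeasure_apply_eq_zero hμK)
      (fun U hU hKU => (tendsto_sliceMeasure_diff hK g x hU hKU).comp hδt) (half_pos hc) hmass
      (fun k => by positivity) (summable_levelWeight_bound ht _)
      fun k j hkj => sum_sq_sliceMeasure_le hms hμK h𝒬 hsum (hδ j) hkj

end Slices

/-! ### Slices through a point outside the exceptional set -/

section PositiveSlices

variable {n m : ℕ} {s : ℝ} {μ : Measure (E n)} [IsFiniteMeasure μ]
  {𝒬 : ℕ → Finset (Fin n → ℤ)} {δ : ℕ → ℝ} {K : Set (E n)}

theorem lintegral_smoothed_transv {ε : ℝ} (hε : 0 < ε) (x : E n) :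
    ∫⁻ g, ENNReal.ofReal (smoothed m ε μ (g, transv m g x)) ∂haarO n =
      ∫⁻ y, avgKernel n m ε (y - x) ∂μ := by
  simp only [ofReal_smoothed hε, ← map_sub, avgKernel]
  exact lintegral_lintegral_swap (Measurable.aemeasurable (by fun_prop))

theorem not_tendsto_lintegral_smoothed [NullSingletonClass μ] (h : m < n) (hμ : μ ≠ 0)
    (hδ : ∀ j, 0 < δ j) (hδt : Tendsto δ atTop (𝓝[>] 0)) (x : E n) :
    ¬ Tendsto (fun j => ∫⁻ g, ENNReal.ofReal (smoothed m (δ j) μ (g, transv m g x)) ∂haarO n)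
      atTop (𝓝 0) := by
  intro hzero
  obtain ⟨c, hc0, -, hlim⟩ := exists_tendsto_avgKernel (n := n) h
  simp only [lintegral_smoothed_transv (hδ _)] at hzero
  have hmeas (j : ℕ) : Measurable fun y : E n => avgKernel n m (δ j) (y - x) := by fun_prop
  have hfatou := lintegral_liminf_le (μ := μ) (u := atTop) hmeas
  rw [hzero.liminf_eq, nonpos_iff_eq_zero, lintegral_eq_zero_iff (.liminf hmeas)] at hfatou
  have : (ae μ).NeBot := ae_neBot.2 hμ
  obtain ⟨y, hy, hyx⟩ := (hfatou.and (compl_mem_ae_iff.2 (measure_singleton x))).exists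
  have hnorm : 0 < ‖y - x‖ := norm_pos_iff.2 (sub_ne_zero.2 hyx)
  have hy' := ((hlim (y - x) (norm_pos_iff.1 hnorm)).comp hδt).liminf_eq.symm.trans hy
  exact mul_ne_zero hc0.ne' (ENNReal.ofReal_pos.2 (by positivity)).ne' hy'

theorem ofReal_smoothed_le_tsum_sliceControl (hms : (m : ℝ) ≤ s) (hK : IsCompact K)
    (hμK : μ Kᶜ = 0) (h𝒬 : ∀ k, ∀ y ∈ K, ∃ q ∈ 𝒬 k, y ∈ dyadicCube k q) (hδ : ∀ j, 0 < δ j)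
    (hδt : Tendsto δ atTop (𝓝[>] 0)) {g : O n} {x : E n}
    (hsum : Summable fun j => sliceControl m s μ 𝒬 δ j (g, transv m g x))
    (hdim : ¬ ENNReal.ofReal (s - m) ≤ dimH (K ∩ {y | transv m g (y - x) = 0})) (j : ℕ) :
    ENNReal.ofReal (smoothed m (δ j) μ (g, transv m g x)) ≤
      ∑' i, ENNReal.ofReal (sliceControl m s μ 𝒬 δ (j + i) (g, transv m g x)) := by
  have hdist (i : ℕ) : edist (smoothed m (δ i) μ (g, transv m g x))
      (smoothed m (δ (i + 1)) μ (g, transv m g x)) ≤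
        ENNReal.ofReal (sliceControl m s μ 𝒬 δ i (g, transv m g x)) := by
    rw [edist_comm, edist_dist, Real.dist_eq]
    exact ENNReal.ofReal_le_ofReal (abs_smoothed_sub_le_sliceControl hms hμK (h𝒬 0) hδ i _)
  obtain ⟨c, hlim⟩ := cauchySeq_tendsto_of_complete
    (cauchySeq_of_edist_le_of_tsum_ne_top _ hdist hsum.tsum_ofReal_ne_top)
  have hc : c = 0 := by
    refine (ge_of_tendsto' hlim fun i => smoothed_nonneg (hδ i) _).antisymm'
      (not_lt.1 fun hc => hdim ?_)
    exact le_dimH_slice hms hK hμK h𝒬 hδ hδt hsum hc hlim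
  simpa only [hc, edist_zero_right, Real.enorm_of_nonneg (smoothed_nonneg (hδ j) _)] using
    edist_le_tsum_of_edist_le_of_tendsto _ hdist hlim j

theorem frequently_le_dimH_slice [NullSingletonClass μ] (h : m < n) (hms : (m : ℝ) ≤ s)
    (hK : IsCompact K) (hμ : μ ≠ 0) (hμK : μ Kᶜ = 0)
    (h𝒬 : ∀ k, ∀ y ∈ K, ∃ q ∈ 𝒬 k, y ∈ dyadicCube k q) (hδ : ∀ j, 0 < δ j)
    (hδt : Tendsto δ atTop (𝓝[>] 0)) (x : E n) {l : ℕ → ℝ} (hl : Summable l)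
    (hle : ∀ᶠ j in atTop, ∫⁻ g, ENNReal.ofReal (sliceControl m s μ 𝒬 δ j (g, transv m g x))
      ∂haarO n ≤ ENNReal.ofReal (l j)) :
    ∃ᵐ g ∂haarO n, ENNReal.ofReal (s - m) ≤ dimH (K ∩ {y | transv m g (y - x) = 0}) := by
  refine fun hdim => not_tendsto_lintegral_smoothed h hμ hδ hδt x ?_
  have hmeas (j : ℕ) : Measurable fun g =>
      ENNReal.ofReal (sliceControl m s μ 𝒬 δ j (g, transv m g x)) :=
    ((measurable_sliceControl j).comp (by fun_prop)).ennreal_ofReal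
  have htail {N : ℕ} (hN : ∀ j ≥ N, ∫⁻ g, ENNReal.ofReal
      (sliceControl m s μ 𝒬 δ j (g, transv m g x)) ∂haarO n ≤ ENNReal.ofReal (l j)) :
      ∫⁻ g, ∑' i, ENNReal.ofReal (sliceControl m s μ 𝒬 δ (N + i) (g, transv m g x)) ∂haarO n ≤
        ∑' i, ENNReal.ofReal (l (i + N)) := by
    rw [lintegral_tsum fun i => (hmeas _).aemeasurable]
    refine ENNReal.tsum_le_tsum fun i => ?_
    rw [add_comm i]
    exact hN _ (Nat.le_add_right N i)
  obtain ⟨N, hN⟩ := eventually_atTop.1 hle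
  have hsum : ∀ᵐ g ∂haarO n, Summable fun j => sliceControl m s μ 𝒬 δ j (g, transv m g x) := by
    have hfin := ne_top_of_le_ne_top ((summable_nat_add_iff N).2 hl).tsum_ofReal_ne_top (htail hN)
    filter_upwards [ae_lt_top (.tsum fun _ => hmeas _) hfin] with g hg
    refine (summable_nat_add_iff N).1 ((ENNReal.summable_toReal hg.ne).congr fun j => ?_)
    rw [ENNReal.toReal_ofReal (sliceControl_nonneg _ _), add_comm]
  refine tendsto_of_tendsto_of_tendsto_of_le_of_le' tendsto_const_nhds
    (ENNReal.tendsto_sum_nat_add _ hl.tsum_ofReal_ne_top) (.of_forall fun _ => zero_le) ?_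
  filter_upwards [eventually_ge_atTop N] with j hj
  refine (lintegral_mono_ae ?_).trans (htail fun i hi => hN i (hj.trans hi))
  filter_upwards [hsum, hdim] with g hg hgdim
  exact ofReal_smoothed_le_tsum_sliceControl hms hK hμK h𝒬 hδ hδt hg hgdim j

theorem exists_exceptional_set_slices [NullSingletonClass μ] (h : m < n) (hms : (m : ℝ) < s)
    (hK : IsCompact K) (hμ : μ ≠ 0) (hμK : μ Kᶜ = 0) {C : ℝ} (hC : 0 ≤ C)
    (hgrowth : ∀ᵐ y ∂μ, ∀ r, 0 < r → μ (Metric.closedBall y r) ≤ ENNReal.ofReal (C * r ^ s)) :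
    ∃ B : Set (E n), MeasurableSet B ∧ dimH B ≤ (m : ℝ≥0∞) ∧ ∀ x ∉ B,
      ∃ᵐ g ∂haarO n, ENNReal.ofReal (s - m) ≤ dimH (K ∩ {y | transv m g (y - x) = 0}) := by
  obtain ⟨R, hR⟩ := hK.isBounded.subset_closedBall 0
  choose 𝒬 h𝒬 using fun k => exists_finset_dyadicCube hR k
  have hE (k : ℕ) (q : Fin n → ℤ) : rieszEnergy m (μ.restrict (dyadicCube k q)) ≠ ∞ :=
    ne_top_of_le_ne_top (ENNReal.mul_ne_top ENNReal.ofReal_ne_top (measure_ne_top μ _))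
      (rieszEnergy_restrict_dyadicCube_le h hms hC hgrowth k q)
  obtain ⟨D, hD, hlevel⟩ := exists_sum_lintegral_smoothed_dyadicCube_sq_le h hms hC hgrowth
  obtain ⟨δ, hδ, hδt, hinc⟩ := exists_scales_increment_le h hE 𝒬
    (η := fun j => 1 / (levelWeight m s j ^ 2 * ((j : ℝ) + 1) ^ 8))
    fun j => by have := levelWeight_pos (m := m) (s := s) j; positivity
  have hl {p : ℕ} (hp : 1 < p) : Summable fun j : ℕ => 1 / ((j : ℝ) + 1) ^ p := by
    simpa only [Nat.cast_succ] using
      (summable_nat_add_iff 1).2 (Real.summable_one_div_nat_pow.2 hp)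
  have hquot (j : ℕ) : (∫⁻ p, ENNReal.ofReal (sliceControl m s μ 𝒬 δ j p ^ 2) ∂bundleMeasure n m) /
      ENNReal.ofReal (1 / ((j : ℝ) + 1) ^ 2) ^ 2 ≤
        ENNReal.ofReal ((2 + 2 * D) * (1 / ((j : ℝ) + 1) ^ 4)) := by
    have hle := lintegral_sliceControl_sq_le hD hδ hlevel j (hinc j)
    rw [← ENNReal.ofReal_pow (by positivity)]
    refine (ENNReal.div_le_div_right hle _).trans_eq ?_
    rw [← ENNReal.ofReal_div_of_pos (by positivity)]
    congr 1
    field_simp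
  obtain ⟨B, hBm, hBd, hB⟩ := exists_exceptional_set h (F := sliceControl m s μ 𝒬 δ)
    measurable_sliceControl sliceControl_nonneg (uniformEquicontinuous_sliceControl hδ)
    (l := fun j => 1 / ((j : ℝ) + 1) ^ 2) (fun j => by positivity)
    (ne_top_of_le_ne_top ((hl (by norm_num)).mul_left (2 + 2 * D)).tsum_ofReal_ne_top
      (ENNReal.tsum_le_tsum hquot))
  exact ⟨B, hBm, hBd, fun x hx =>
    frequently_le_dimH_slice h hms.le hK hμ hμK h𝒬 hδ hδt x (hl one_lt_two) (hB x hx)⟩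

end PositiveSlices

/-! ### Sections by planes -/

section Sections

variable {n m : ℕ} {s : ℝ} {A K : Set (E n)}

theorem exists_exceptional_set_compact_slices (h : m < n) (hms : (m : ℝ) < s) (hK : IsCompact K)
    (hpos : 0 < μH[s] K) (hfin : μH[s] K < ∞) {C : ℝ} (hC : 0 ≤ C)
    (hgrowth : ∀ y ∈ K, ∀ r, 0 < r →
      μH[s] (K ∩ Metric.closedBall y r) ≤ ENNReal.ofReal (C * r ^ s)) :
    ∃ B : Set (E n), MeasurableSet B ∧ dimH B ≤ (m : ℝ≥0∞) ∧ ∀ x ∉ B,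
      ∃ᵐ g ∂haarO n, ENNReal.ofReal (s - m) ≤ dimH (K ∩ {y | transv m g (y - x) = 0}) := by
  have : IsFiniteMeasure (μH[s].restrict K) := isFiniteMeasure_restrict.2 hfin.ne
  have : NullSingletonClass (μH[s] : Measure (E n)) :=
    Measure.nullSingletonClass_hausdorff (E n) ((Nat.cast_nonneg m).trans_lt hms)
  refine exists_exceptional_set_slices (μ := μH[s].restrict K) h hms hK
    (mt Measure.restrict_eq_zero.1 hpos.ne') ?_ hC ?_
  · rw [Measure.restrict_apply hK.measurableSet.compl, compl_inter_self, measure_empty]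
  · filter_upwards [ae_restrict_mem hK.measurableSet] with y hy r hr
    rw [Measure.restrict_apply Metric.isClosed_closedBall.measurableSet, inter_comm]
    exact hgrowth y hy r hr

theorem gammaG_sectionPlanes_pos (h : m < n) (hms : (m : ℝ) < s) (hfin : μH[s] A < ∞)
    (hKA : K ⊆ A) {x : E n}
    (hx : ∃ᵐ g ∂haarO n, ENNReal.ofReal (s - m) ≤ dimH (K ∩ {y | transv m g (y - x) = 0})) :
    0 < gammaG n (n - m) (sectionPlanes m s A x) := by
  refine pos_iff_ne_zero.2 fun h0 => hx ?_
  rw [gammaG, dif_pos (Nat.sub_le n m)] at h0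
  have hrotate := (G.continuous_rotate (G.coordPlane n (n - m) (Nat.sub_le n m))).measurable
  have hnull := Measure.preimage_null_of_map_null hrotate.aemeasurable h0
  filter_upwards [ae_dimH_section_le h hms hfin x, compl_mem_ae_iff.2 hnull] with g hle hg hge
  refine hg ?_
  have hset : (G.rotate g (G.coordPlane n (n - m) (Nat.sub_le n m))).translate x =
      {y | transv m g (y - x) = 0} := Set.ext fun y => mem_translate_rotate_iff g x y
  rw [mem_preimage, sectionPlanes, mem_ofPred_eq, hset]
  exact le_antisymm hle (hge.trans (dimH_mono (inter_subset_inter_left _ hKA)))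

end Sections

end

/-- Measurability of `A` is Carathéodory measurability for the Hausdorff outer measure; measures
of arbitrary sets are the outer measures. -/
theorem theorem1p2 (n m : ℕ) (s : ℝ) (hms : (m : ℝ) < s) (hsn : s ≤ (n : ℝ))
    (A : Set (E n))
    (hA : (Measure.hausdorffMeasure s : Measure (E n)).toOuterMeasure.IsCaratheodory A)
    (hpos : 0 < (Measure.hausdorffMeasure s : Measure (E n)) A)
    (hfin : (Measure.hausdorffMeasure s : Measure (E n)) A < ∞) :
    dimH {x : E n | gammaG n (n - m) (sectionPlanes m s A x) = 0} ≤ (m : ℝ≥0∞) ∧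
    ∃ B : Set (E n), MeasurableSet B ∧ dimH B ≤ (m : ℝ≥0∞) ∧
      ∀ x : E n, x ∉ B → 0 < gammaG n (n - m) (sectionPlanes m s A x) := by
  have h : m < n := by exact_mod_cast hms.trans_le hsn
  have hs : 0 ≤ s := (Nat.cast_nonneg m).trans hms.le
  obtain ⟨K, hKA, hK, hKpos, C, hC, hgrowth⟩ := exists_isCompact_growth hs hA hpos hfin
  obtain ⟨B, hBm, hBd, hB⟩ := exists_exceptional_set_compact_slices h hms hK hKpos
    ((measure_mono hKA).trans_lt hfin) hC hgrowth
  have hgood : ∀ x ∉ B, 0 < gammaG n (n - m) (sectionPlanes m s A x) :=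
    fun x hx => gammaG_sectionPlanes_pos h hms hfin hKA (hB x hx)
  have hbad : {x | gammaG n (n - m) (sectionPlanes m s A x) = 0} ⊆ B :=
    fun x hx => by_contra fun hxB => (hgood x hxB).ne' hx
  exact ⟨(dimH_mono hbad).trans hBd, B, hBm, hBd, hgood⟩
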